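/- **Setting.** Let $d\in\mathbb N_0$, let $\mathfrak L^-$ be a finite set, $\mathfrak s\in[1,\infty)^d$, $\eta>0$, $\alpha_{\mathfrak l}\in\mathbb R$ for $\mathfrak l\in\mathfrak L^-$, $\alpha_0=0$, and let $\mathrm{reg}:\mathfrak L^-\cup\{0\}\to\mathbb R$ and $r\in\mathbb R$ satisfy $\mathrm{reg}(\mathfrak l)<\alpha_{\mathfrak l}$ for all $\mathfrak l\in\mathfrak L^-\cup\{0\}$ and $r\le \mathfrak s_i$ for $i=1,\dots,d$. For a set $I$, $M(I)$ denotes the finitely supported maps $I\to\mathbb N_0$, $e_i$ the unit multi-indices, $m!=\prod_i m(i)!$. Put $|\mathbf n|=\sum_i\mathfrak s_i\mathbf n(i)$ for $\mathbf n\in\mathbb N_0^d$. Consider commuting variables $\mathsf z_{(\mathfrak l,k)}$ ($\mathfrak l\in\mathfrak L^-\cup\{0\}$, $k\in M(\mathbb N_0^d)$) and $\mathsf z_{\mathbf n}$ ($\mathbf n\in\mathbb N_0^d$), and write $\mathsf z^\beta$ for the monomial of a multi-index $\beta$ over the set of their indices. The pair $(\mathfrak l,k)$ is *subcritical* if $r<\eta+\min\{\mathrm{reg}(\mathfrak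 l),\,m_k,\,\mathrm{reg}(\mathfrak l)+m_k\}$, where $m_k=\min_{0<k'\le k}\sum_{\mathbf n}(r-|\mathbf n|)k'(\mathbf n)$ (and $m_0=+\infty$); $\beta$ is subcritical if $\beta(\mathfrak l,k)\ne0$ implies that $(\mathfrak l,k)$ is subcritical. Put $$[\beta]=\sum_{(\mathfrak l,k)}\Big(1-\sum_{\mathbf n}k(\mathbf n)\Big)\beta(\mathfrak l,k)+\sum_{\mathbf n}\beta(\mathbf n),$$ $$|\beta|=\sum_{(\mathfrak l,k)}\Big(\alpha_{\mathfrak l}+\sum_{\mathbf n}(\eta-|\mathbf n|)k(\mathbf n)\Big)\beta(\mathfrak l,k)+\sum_{\mathbf n}(|\mathbf n|-\eta)\beta(\mathbf n).$$ Let $\mathcal N^-$ be the set of subcritical $\beta$ with $[\beta]=1$ and $\beta(\mathbf n)=0$ whenever $|\mathbf n|<r$; let $\mathcal N$ be the set of $\beta\in\mathcal N^-$ with $\sum_{\mathfrak l\in\mathfrak L^-}\sum_k\beta(\mathfrak l,k)>0$; and let $\mathcal P=\{e_{\mathbf n}\}_{\mathbf n}\sqcup\mathcal N$. Let $T_{\mathcal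 P\cup\mathcal N^-}$ be the vector space with basis $\{\mathsf z_\beta\}_{\beta\in\mathcal P\cup\mathcal N^-}$. Consider the derivations $$D^{(\mathbf n)}=\sum_{(\mathfrak l,k+e_{\mathbf n})\text{ subcritical}}(k(\mathbf n)+1)\,\mathsf z_{(\mathfrak l,k+e_{\mathbf n})}\partial_{\mathsf z_{(\mathfrak l,k)}}+\partial_{\mathsf z_{\mathbf n}},\qquad \boldsymbol\partial_i=\sum_{\mathbf n}(\mathbf n(i)+1)\,\mathsf z_{\mathbf n+e_i}D^{(\mathbf n)},$$ let $\mathcal M^+=\{(\gamma,\mathbf n)\in\mathcal N\times\mathbb N_0^d : |\mathbf n|<\eta+|\gamma|\}$, let $L^+$ be the Lie algebra of derivations generated by $\{\mathsf z^\gamma D^{(\mathbf n)}\}_{(\gamma,\mathbf n)\in\mathcal M^+}\sqcup\{\boldsymbol\partial_i\}_{i=1}^d$, and let $\rho$ be the action of its universal enveloping algebra $\mathrm U(L^+)$ extending the action by derivations. For $(\gamma,\mathbf n)\in\mathcal M^+$ define linear maps $U\mapsto\mathsf z^\gamma UD^{(\mathbf n)}$ on $\mathrm U(L^+)$ by $\mathsf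 z^\gamma 1D^{(\mathbf n)}=\mathsf z^\gamma D^{(\mathbf n)}$ and $$\mathsf z^\gamma (DU)D^{(\mathbf n)}=D\,(\mathsf z^\gamma UD^{(\mathbf n)})-\sum_\beta D^\gamma_\beta\,\mathsf z^\beta UD^{(\mathbf n)}\qquad(D\in L^+),\qquad\text{where } D\mathsf z^\gamma=\sum_\beta D_\beta^\gamma\mathsf z^\beta.$$ For $J\in M(\mathcal M^+)$ and $\mathbf m\in\mathbb N_0^d$ let $$\mathsf D_{(J,\mathbf m)}=\frac1{J!\,\mathbf m!}\prod_{(\gamma,\mathbf n)}(\mathsf z^\gamma)^{J(\gamma,\mathbf n)}\;\boldsymbol\partial^{\mathbf m}\prod_{(\gamma,\mathbf n)}(D^{(\mathbf n)})^{J(\gamma,\mathbf n)},$$ i.e. apply to $\boldsymbol\partial^{\mathbf m}=\prod_i\boldsymbol\partial_i^{\mathbf m(i)}$ each map $U\mapsto\mathsf z^\gamma UD^{(\mathbf n)}$ exactly $J(\gamma,\mathbf n)$ times, in any order, and divide by $J!\,\mathbf m!$. Let $T^+=\mathbb R[\mathcal M^+\sqcup\{1,\dots,d\}]$ be the polynomial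 algebra with monomials $\mathsf Z^{(J,\mathbf m)}$, and put $|(J,\mathbf m)|=\sum_{(\gamma,\mathbf n)}J(\gamma,\mathbf n)(|\gamma|+\eta-|\mathbf n|)+\sum_i\mathbf m(i)\mathfrak s_i$. **Proposition.** The $\mathsf D_{(J,\mathbf m)}$ do not depend on the order chosen and form a basis of $\mathrm U(L^+)$. Let $(\Delta)_{(J',\mathbf m'),(J'',\mathbf m'')}^{(J,\mathbf m)}$ be the coefficient of $\mathsf D_{(J,\mathbf m)}$ in the product $\mathsf D_{(J',\mathbf m')}\mathsf D_{(J'',\mathbf m'')}$ and $(\Delta)^{\gamma}_{(J,\mathbf m),\beta}$ the coefficient of $\mathsf z^\beta$ in $\rho(\mathsf D_{(J,\mathbf m)})\mathsf z^\gamma$. For fixed $(J,\mathbf m)$ only finitely many $((J',\mathbf m'),(J'',\mathbf m''))$ have a non-zero coefficient of the first kind, and for fixed $\beta\in\mathcal P\cup\mathcal N^-$ only finitely many $((J,\mathbf m),\gamma)$ with $\gamma\in\mathcal P\cup\mathcal N^-$ have a non-zero coefficient of the second kind. Moreover: 1. With the coproduct $$\Delta^+\mathsf Z^{(J,\mathbf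 m)}=\sum_{(J',\mathbf m'),(J'',\mathbf m'')}(\Delta)_{(J',\mathbf m'),(J'',\mathbf m'')}^{(J,\mathbf m)}\,\mathsf Z^{(J',\mathbf m')}\otimes\mathsf Z^{(J'',\mathbf m'')},$$ the constant coefficient as counit, and a suitable antipode $\mathcal A^+$, the polynomial algebra $T^+$ is a Hopf algebra. It is graded by $|(J,\mathbf m)|\in[0,\infty)$ (product, coproduct, counit and antipode respect the degree) and connected (its part of degree $0$ is $\mathbb R1$). The antipode is the transpose of the antipode $S$ of $\mathrm U(L^+)$ (the anti-automorphism extending $x\mapsto-x$): $\langle U,\mathcal A^+M\rangle=\langle SU,M\rangle$ for all $U\in\mathrm U(L^+)$, $M\in T^+$, where $\langle\mathsf D_{(J,\mathbf m)},\mathsf Z^{(J',\mathbf m')}\rangle=\delta_{(J,\mathbf m)}^{(J',\mathbf m')}$. 2. With $$\Delta^+\mathsf z_\beta=\sum_{(J,\mathbf m),\ \gamma\in\mathcal P\cup\mathcal N^-}(\Delta)^\gamma_{(J,\mathbf m),\beta}\,\mathsf Z^{(J,\mathbf m)}\otimes\mathsf z_\gamma,$$ the space $T_{\mathcal P\cup\mathcal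 N^-}$ is a left comodule over $T^+$: $(\mathrm{id}\otimes\Delta^+)\Delta^+=(\Delta^+\otimes\mathrm{id})\Delta^+$, and $(\varepsilon\otimes\mathrm{id})\Delta^+=\mathrm{id}$ for the counit $\varepsilon$ of $T^+$. -/

import Mathlib

open scoped TensorProduct

noncomputable section

/-! ### General algebra: Hopf algebras, gradings, comodules, antipode of an enveloping algebra -/

/-- `Δ`, `ε`, `S` make the (unital associative) real algebra `A` a Hopf algebra. -/
structure IsHopfAlgebraWith {A : Type*} [Ring A] [Algebra ℝ A]
    (Δ : A →ₗ[ℝ] A ⊗[ℝ] A) (ε : A →ₗ[ℝ] ℝ) (S : A →ₗ[ℝ] A) : Prop where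
  coassoc : TensorProduct.assoc ℝ A A A ∘ₗ Δ.rTensor A ∘ₗ Δ = Δ.lTensor A ∘ₗ Δ
  rTensor_counit : ε.rTensor A ∘ₗ Δ = TensorProduct.mk ℝ ℝ A 1
  lTensor_counit : ε.lTensor A ∘ₗ Δ = (TensorProduct.mk ℝ A ℝ).flip 1
  comul_one : Δ 1 = 1
  comul_mul : ∀ x y : A, Δ (x * y) = Δ x * Δ y
  counit_one : ε 1 = 1
  counit_mul : ∀ x y : A, ε (x * y) = ε x * ε y
  antipode_left : LinearMap.mul' ℝ A ∘ₗ S.rTensor A ∘ₗ Δ = Algebra.linearMap ℝ A ∘ₗ ε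
  antipode_right : LinearMap.mul' ℝ A ∘ₗ S.lTensor A ∘ₗ Δ = Algebra.linearMap ℝ A ∘ₗ ε

/-- Such data are a Hopf algebra in the sense of Mathlib, on the given algebra. -/
@[reducible] def IsHopfAlgebraWith.toHopfAlgebra {A : Type*} [Ring A] [Algebra ℝ A]
    {Δ : A →ₗ[ℝ] A ⊗[ℝ] A} {ε : A →ₗ[ℝ] ℝ} {S : A →ₗ[ℝ] A}
    (h : IsHopfAlgebraWith Δ ε S) : HopfAlgebra ℝ A :=
  letI : Bialgebra ℝ A :=
    Bialgebra.ofAlgHom (AlgHom.ofLinearMap Δ h.comul_one h.comul_mul)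
      (AlgHom.ofLinearMap ε h.counit_one h.counit_mul)
      (AlgHom.ext fun x => LinearMap.congr_fun h.coassoc x)
      (AlgHom.ext fun x => LinearMap.congr_fun h.rTensor_counit x)
      (AlgHom.ext fun x => LinearMap.congr_fun h.lTensor_counit x)
  { antipode := S
    mul_antipode_rTensor_comul := h.antipode_left
    mul_antipode_lTensor_comul := h.antipode_right }

/-- The family `𝒜 ν`, `ν ∈ ℝ`, is a grading of the Hopf algebra `(A, Δ, ε, S)`, it is concentrated
in degrees `ν ≥ 0`, and its part of degree `0` is `ℝ · 1`. -/
structure IsConnectedGradedHopfAlgebra {A : Type*} [Ring A] [Algebra ℝ A]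
    (Δ : A →ₗ[ℝ] A ⊗[ℝ] A) (ε : A →ₗ[ℝ] ℝ) (S : A →ₗ[ℝ] A) (𝒜 : ℝ → Submodule ℝ A) :
    Prop where
  isHopf : IsHopfAlgebraWith Δ ε S
  isInternal : DirectSum.IsInternal 𝒜
  one_mem : (1 : A) ∈ 𝒜 0
  mul_mem : ∀ μ ν : ℝ, ∀ x ∈ 𝒜 μ, ∀ y ∈ 𝒜 ν, x * y ∈ 𝒜 (μ + ν)
  comul_mem : ∀ ν : ℝ, ∀ x ∈ 𝒜 ν,
    Δ x ∈ ⨆ p : {p : ℝ × ℝ // p.1 + p.2 = ν},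
      LinearMap.range (TensorProduct.map (𝒜 p.1.1).subtype (𝒜 p.1.2).subtype)
  counit_mem : ∀ ν : ℝ, ν ≠ 0 → ∀ x ∈ 𝒜 ν, ε x = 0
  antipode_mem : ∀ ν : ℝ, ∀ x ∈ 𝒜 ν, S x ∈ 𝒜 ν
  nonneg : ∀ ν : ℝ, ν < 0 → 𝒜 ν = ⊥
  connected : 𝒜 0 = Submodule.span ℝ {(1 : A)}

/-- `δ : V → A ⊗ V` makes `V` a left comodule over the coalgebra `(A, Δ, ε)`. -/
structure IsLeftComodule {A V : Type*} [Ring A] [Algebra ℝ A] [AddCommGroup V] [Module ℝ V]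
    (Δ : A →ₗ[ℝ] A ⊗[ℝ] A) (ε : A →ₗ[ℝ] ℝ) (δ : V →ₗ[ℝ] A ⊗[ℝ] V) : Prop where
  coassoc : δ.lTensor A ∘ₗ δ = TensorProduct.assoc ℝ A A V ∘ₗ Δ.rTensor V ∘ₗ δ
  counit : ε.rTensor V ∘ₗ δ = TensorProduct.mk ℝ ℝ V 1

section Enveloping

attribute [local instance] LieRing.ofAssociativeRing

variable {L : Type*} [LieRing L] [LieAlgebra ℝ L]

/-- The antipode of `U(L)`, as an algebra morphism to the opposite algebra: the extension of
`x ↦ -x`. -/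
def envelopingAntipodeOp :
    UniversalEnvelopingAlgebra ℝ L →ₐ[ℝ] (UniversalEnvelopingAlgebra ℝ L)ᵐᵒᵖ :=
  UniversalEnvelopingAlgebra.lift ℝ
    { toFun := fun x => MulOpposite.op (-(UniversalEnvelopingAlgebra.ι ℝ x))
      map_add' := by intro x y; simp only [map_add, neg_add, MulOpposite.op_add]
      map_smul' := by
        intro c x; simp only [map_smul, ← smul_neg, MulOpposite.op_smul, RingHom.id_apply]
      map_lie' := by
        intro x y
        simp only [LieHom.map_lie, LieRing.of_associative_ring_bracket, ← MulOpposite.op_mul,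
          ← MulOpposite.op_sub]
        congr 1
        noncomm_ring }

/-- The antipode of `U(L)`: the anti-automorphism extending `x ↦ -x`. -/
def envelopingAntipode :
    UniversalEnvelopingAlgebra ℝ L →ₗ[ℝ] UniversalEnvelopingAlgebra ℝ L :=
  (MulOpposite.opLinearEquiv ℝ).symm.toLinearMap ∘ₗ envelopingAntipodeOp.toLinearMap

end Enveloping

/-! ### Multi-indices -/

/-- Elements `𝐧` of `ℕ₀^d`. -/
abbrev NVec (d : ℕ) := Fin d →₀ ℕ

/-- Indices of the coordinates `z_{(𝔩,k)}` (left, `none` being the index `0` of the additive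
term `ξ₀ = 1`) and `z_𝐧` (right). -/
abbrev Coord (d : ℕ) (𝔏 : Type*) := (Option 𝔏 × (NVec d →₀ ℕ)) ⊕ NVec d

/-- Multi-indices `β ∈ M(Coord)`. -/
abbrev CoordIdx (d : ℕ) (𝔏 : Type*) := Coord d 𝔏 →₀ ℕ

/-- The parameters: scaling `𝔰`, order `η` of the regularization, homogeneities `α_𝔩` of the
noises, and the placeholders `reg(𝔩)`, `𝔩 ∈ 𝔏⁻ ∪ {0}`, and `regSol` of the regularity of the noises
and of the solution. -/
structure RegParams (d : ℕ) (𝔏 : Type*) where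
  scal : Fin d → ℝ
  η : ℝ
  α : 𝔏 → ℝ
  reg : Option 𝔏 → ℝ
  regSol : ℝ

namespace RegParams

variable {d : ℕ} {𝔏 : Type*} (P : RegParams d 𝔏)

/-- `α_𝔩` for `𝔩 ∈ 𝔏⁻ ∪ {0}`, with `α_0 = 0`. -/
def alpha (l : Option 𝔏) : ℝ := l.elim 0 P.α

/-- The scaled degree `|𝐧| = ∑ᵢ 𝔰ᵢ 𝐧(i)`. -/
def scaledDeg (n : NVec d) : ℝ := ∑ i, P.scal i * n i

/-- Subcriticality of `(𝔩, k)`. An inequality `regSol < η + min …` is written as the family of the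
inequalities for the members of the set; the minimum over the empty set (`k = 0`) is `+∞`. -/
def SubcritPair (l : Option 𝔏) (k : NVec d →₀ ℕ) : Prop :=
  P.regSol < P.η + P.reg l ∧
  ∀ k' : NVec d →₀ ℕ, k' ≠ 0 → k' ≤ k →
    P.regSol < P.η + k'.sum (fun n j => (P.regSol - P.scaledDeg n) * j) ∧
    P.regSol < P.η + (P.reg l + k'.sum (fun n j => (P.regSol - P.scaledDeg n) * j))

/-- `β` is subcritical. -/
def Subcrit (β : CoordIdx d 𝔏) : Prop :=
  ∀ l k, β (Sum.inl (l, k)) ≠ 0 → P.SubcritPair l k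

/-- `[β] = ∑_{(𝔩,k)} (1 - length k) β(𝔩,k) + ∑_𝐧 β(𝐧)`. -/
def bracket (β : CoordIdx d 𝔏) : ℤ :=
  β.sum fun c j => Sum.elim (fun p => 1 - (p.2.sum fun _ i => (i : ℤ))) (fun _ => 1) c * (j : ℤ)

/-- The noise homogeneity `∑_{𝔩 ∈ 𝔏⁻} ∑_k β(𝔩,k)`. -/
def noiseHom (β : CoordIdx d 𝔏) : ℕ :=
  β.sum fun c j => Sum.elim (fun p => if p.1.isSome then 1 else 0) (fun _ => 0) c * j

/-- The homogeneity `|β|`. -/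
def hom (β : CoordIdx d 𝔏) : ℝ :=
  β.sum fun c j =>
    Sum.elim (fun p => P.alpha p.1 + p.2.sum (fun n i => (P.η - P.scaledDeg n) * (i : ℝ)))
      (fun n => P.scaledDeg n - P.η) c * (j : ℝ)

/-- The set `𝒩⁻`. -/
def NMinus : Set (CoordIdx d 𝔏) :=
  {β | bracket β = 1 ∧ P.Subcrit β ∧ ∀ n, P.scaledDeg n < P.regSol → β (Sum.inr n) = 0}

/-- The set `𝒩`. -/
def NSet : Set (CoordIdx d 𝔏) := {β | β ∈ P.NMinus ∧ 0 < noiseHom β}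

/-- The set `𝒫` of the purely polynomial multi-indices `e_𝐧`. -/
def PolySet : Set (CoordIdx d 𝔏) := Set.range fun n : NVec d => Finsupp.single (Sum.inr n) 1

/-- The set of populated multi-indices, `𝒫 ⊔ 𝒩`. -/
def Populated : Set (CoordIdx d 𝔏) := PolySet ∪ P.NSet

/-- The index set of the model space: the union of the populated multi-indices and `𝒩⁻`. -/
abbrev ModelIdx := {β : CoordIdx d 𝔏 // β ∈ P.Populated ∪ P.NMinus}

/-- The vector space with basis `z_β`, `β` populated or in `𝒩⁻`. -/
abbrev ModelSpace := P.ModelIdx →₀ ℝ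

/-! ### The generators and the Lie algebra `L⁺` -/

/-- Polynomials in the coordinates. The subcriticality restriction makes `D^{(𝐧)}` and `∂ᵢ`
derivations of this algebra; as operators on power series they are given by the same matrix
coefficients. -/
abbrev CoordPoly (d : ℕ) (𝔏 : Type*) := MvPolynomial (Coord d 𝔏) ℝ

open Classical in
/-- The derivation
`D^{(𝐧)} = ∑_{(𝔩,k) : (𝔩,k+e_𝐧) subcritical} (k(𝐧)+1) z_{(𝔩,k+e_𝐧)} ∂_{z_{(𝔩,k)}} + ∂_{z_𝐧}`. -/
def dN (n : NVec d) : Derivation ℝ (CoordPoly d 𝔏) (CoordPoly d 𝔏) :=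
  MvPolynomial.mkDerivation ℝ <| Sum.elim
    (fun p => if P.SubcritPair p.1 (p.2 + Finsupp.single n 1) then
        ((p.2 n : ℝ) + 1) • MvPolynomial.X (Sum.inl (p.1, p.2 + Finsupp.single n 1))
      else 0)
    (fun m => if m = n then 1 else 0)

/-- The derivation `∂ᵢ = ∑_𝐧 (𝐧(i)+1) z_{𝐧+eᵢ} D^{(𝐧)}`, given by its values on the variables, for
which the sum over `𝐧` is finite. -/
def dX (i : Fin d) : Derivation ℝ (CoordPoly d 𝔏) (CoordPoly d 𝔏) :=
  MvPolynomial.mkDerivation ℝ fun c =>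
    ∑ᶠ n : NVec d, ((n i : ℝ) + 1) •
      (MvPolynomial.X (Sum.inr (n + Finsupp.single i 1)) * P.dN n (MvPolynomial.X c))

/-- The derivation `z^γ D^{(𝐧)}`. -/
def zD (γ : CoordIdx d 𝔏) (n : NVec d) : Derivation ℝ (CoordPoly d 𝔏) (CoordPoly d 𝔏) :=
  (MvPolynomial.monomial γ (1 : ℝ)) • P.dN n

/-- The set `ℳ⁺` of the `(γ,𝐧) ∈ 𝒩 × ℕ₀^d` with `|𝐧| < η + |γ|`. -/
def MPlus : Set (CoordIdx d 𝔏 × NVec d) :=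
  {p | p.1 ∈ P.NSet ∧ P.scaledDeg p.2 < P.η + P.hom p.1}

/-- The index set `ℳ⁺ ⊔ {1,…,d}` of the generators. -/
abbrev PlusGen := P.MPlus ⊕ Fin d

/-- The generator with a given index. -/
def genDer : P.PlusGen → Derivation ℝ (CoordPoly d 𝔏) (CoordPoly d 𝔏) :=
  Sum.elim (fun p => P.zD p.1.1 p.1.2) P.dX

/-- The Lie algebra `L⁺` generated by the `z^γ D^{(𝐧)}`, `(γ,𝐧) ∈ ℳ⁺`, and the `∂ᵢ`. -/
def LPlus : LieSubalgebra ℝ (Derivation ℝ (CoordPoly d 𝔏) (CoordPoly d 𝔏)) :=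
  LieSubalgebra.lieSpan ℝ _ (Set.range P.genDer)

/-- The generators as elements of `L⁺`. -/
def gen (g : P.PlusGen) : P.LPlus :=
  ⟨P.genDer g, LieSubalgebra.subset_lieSpan (Set.mem_range_self g)⟩

/-- The universal enveloping algebra `U(L⁺)`. -/
abbrev UPlus := UniversalEnvelopingAlgebra ℝ P.LPlus

/-- The generators as elements of `U(L⁺)`. -/
def uGen (g : P.PlusGen) : P.UPlus := UniversalEnvelopingAlgebra.ι ℝ (P.gen g)

section Actions

attribute [local instance] LieRing.ofAssociativeRing

/-- The representation `ρ` of `U(L⁺)` extending the action of `L⁺` by derivations. -/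
def rho : P.UPlus →ₐ[ℝ] Module.End ℝ (CoordPoly d 𝔏) :=
  UniversalEnvelopingAlgebra.lift ℝ
    { toFun := fun D => (D.1 : CoordPoly d 𝔏 →ₗ[ℝ] CoordPoly d 𝔏)
      map_add' := fun _ _ => rfl
      map_smul' := fun _ _ => rfl
      map_lie' := by
        intro x y
        ext1 p
        simp [LieRing.of_associative_ring_bracket] }

/-- The action of `L⁺` on linear maps `f` from polynomials to `U(L⁺)`,
`(D · f)(π) = D f(π) - f(D π)`, extended to `U(L⁺)`. -/
def homAction : P.UPlus →ₐ[ℝ] Module.End ℝ (CoordPoly d 𝔏 →ₗ[ℝ] P.UPlus) :=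
  UniversalEnvelopingAlgebra.lift ℝ
    { toFun := fun D =>
        { toFun := fun f => LinearMap.mulLeft ℝ (UniversalEnvelopingAlgebra.ι ℝ D) ∘ₗ f -
            f ∘ₗ (D.1 : CoordPoly d 𝔏 →ₗ[ℝ] CoordPoly d 𝔏)
          map_add' := by
            intro f g
            refine LinearMap.ext fun p => ?_
            simp only [LinearMap.sub_apply, LinearMap.add_apply, LinearMap.comp_apply, map_add]
            abel
          map_smul' := by
            intro c f
            refine LinearMap.ext fun p => ?_
            simp only [LinearMap.sub_apply, LinearMap.smul_apply, LinearMap.comp_apply, map_smul,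
              RingHom.id_apply, smul_sub] }
      map_add' := by
        intro x y
        refine LinearMap.ext fun f => LinearMap.ext fun p => ?_
        simp only [LinearMap.coe_mk, AddHom.coe_mk, LinearMap.add_apply, LinearMap.sub_apply,
          LinearMap.comp_apply, LinearMap.mulLeft_apply, map_add, add_mul, AddMemClass.coe_add,
          Derivation.coe_add_linearMap]
        abel
      map_smul' := by
        intro c x
        refine LinearMap.ext fun f => LinearMap.ext fun p => ?_
        simp only [LinearMap.coe_mk, AddHom.coe_mk, LinearMap.smul_apply, LinearMap.sub_apply,
          LinearMap.comp_apply, LinearMap.mulLeft_apply, map_smul, smul_mul_assoc, smul_sub,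
          SetLike.val_smul, Derivation.coe_smul_linearMap, RingHom.id_apply]
      map_lie' := by
        intro x y
        refine LinearMap.ext fun f => LinearMap.ext fun p => ?_
        simp only [LinearMap.coe_mk, AddHom.coe_mk, LinearMap.sub_apply,
          LinearMap.comp_apply, LinearMap.mulLeft_apply, LieHom.map_lie,
          LieRing.of_associative_ring_bracket, Module.End.mul_apply, map_sub, sub_mul,
          LieSubalgebra.coe_bracket, Derivation.commutator_coe_linear_map, mul_assoc]
        abel }

end Actions

open Classical in
/-- The linear map `z^γ ↦ z^γ D^{(𝐧)} ∈ U(L⁺)`, for `(γ,𝐧) ∈ ℳ⁺` (and `0` for other `γ`). -/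
def zDLinear (n : NVec d) : CoordPoly d 𝔏 →ₗ[ℝ] P.UPlus :=
  (MvPolynomial.basisMonomials (Coord d 𝔏) ℝ).constr ℝ fun γ =>
    if h : (γ, n) ∈ P.MPlus then P.uGen (Sum.inl ⟨(γ, n), h⟩) else 0

/-- The element `z^γ U D^{(𝐧)}` of `U(L⁺)`, for `(γ,𝐧) ∈ ℳ⁺` and `U ∈ U(L⁺)`. -/
def sandwich (p : P.MPlus) (U : P.UPlus) : P.UPlus :=
  P.homAction U (P.zDLinear p.1.2) (MvPolynomial.monomial p.1.1 1)

/-- `z^γ 1 D^{(𝐧)} = z^γ D^{(𝐧)}`. -/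
theorem sandwich_one (p : P.MPlus) : P.sandwich p 1 = P.uGen (Sum.inl p) := by
  classical
  rw [sandwich, map_one, Module.End.one_apply, zDLinear,
    ← congrFun (MvPolynomial.coe_basisMonomials (Coord d 𝔏) ℝ) p.1.1, Module.Basis.constr_basis]
  exact dif_pos p.2

/-- The recursion `z^γ (D U) D^{(𝐧)} = D (z^γ U D^{(𝐧)}) - ∑_β D_β^γ z^β U D^{(𝐧)}`. -/
theorem sandwich_ι_mul (p : P.MPlus) (D : P.LPlus) (U : P.UPlus) :
    P.sandwich p (UniversalEnvelopingAlgebra.ι ℝ D * U) =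
      UniversalEnvelopingAlgebra.ι ℝ D * P.sandwich p U -
        P.homAction U (P.zDLinear p.1.2) (D.1 (MvPolynomial.monomial p.1.1 1)) := by
  simp only [sandwich, map_mul, homAction]
  rw [Module.End.mul_apply, UniversalEnvelopingAlgebra.lift_ι_apply]
  rfl

/-! ### The order-independent basis of `U(L⁺)` -/

/-- Multi-indices `(J,𝐦) ∈ M(ℳ⁺) × ℕ₀^d`, as multi-indices over `ℳ⁺ ⊔ {1,…,d}`. -/
abbrev PlusIdx := P.PlusGen →₀ ℕ

/-- The component `J` of `K = (J,𝐦)`, as a multiset of elements of `ℳ⁺`. -/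
def jPart (K : P.PlusIdx) : Multiset P.MPlus :=
  Finsupp.toMultiset (K.comapDomain Sum.inl Sum.inl_injective.injOn)

/-- The degree `|(γ,𝐧)| = |γ| + η - |𝐧|`, `|i| = |eᵢ| = 𝔰ᵢ` of a generator. -/
def genDeg : P.PlusGen → ℝ :=
  Sum.elim (fun p => P.hom p.1.1 + P.η - P.scaledDeg p.1.2) P.scal

/-- `∂^𝐦 = ∏ᵢ ∂ᵢ^{𝐦(i)}` in `U(L⁺)`, for `K = (J,𝐦)`. -/
def dXPow (K : P.PlusIdx) : P.UPlus :=
  (List.ofFn fun i : Fin d => P.uGen (Sum.inr i) ^ K (Sum.inr i)).prod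

/-- The element `(1 / (J! 𝐦!)) ∏ z^γ ∂^𝐦 ∏ D^{(𝐧)}` of `U(L⁺)`, for `K = (J,𝐦)`, obtained from
`∂^𝐦` by applying the maps `U ↦ z^γ U D^{(𝐧)}` for the entries `(γ,𝐧)` of a list `l`, which is to
be an enumeration of `J`. -/
def sfD (K : P.PlusIdx) (l : List P.MPlus) : P.UPlus :=
  ((K.prod fun _ j => (j.factorial : ℝ))⁻¹) • l.foldr P.sandwich (P.dXPow K)

/-! ### `T⁺` and the transposed maps -/

/-- `T⁺ = ℝ[ℳ⁺ ⊔ {1,…,d}]`. -/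
abbrev TPlus := MvPolynomial P.PlusGen ℝ

/-- The monomials `Z^{(J,𝐦)}`. -/
def Zmon (K : P.PlusIdx) : P.TPlus := MvPolynomial.monomial K 1

/-- The part of `T⁺` of degree `ν`, spanned by the `Z^{(J,𝐦)}` with `|(J,𝐦)| = ν`. -/
def gradePlus (ν : ℝ) : Submodule ℝ P.TPlus :=
  MvPolynomial.weightedHomogeneousSubmodule ℝ P.genDeg ν

/-- The counit: the constant coefficient. -/
def counitPlus : P.TPlus →ₗ[ℝ] ℝ := MvPolynomial.lcoeff ℝ (0 : P.PlusIdx)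

section Transpose

variable {P} (b : Module.Basis P.PlusIdx ℝ P.UPlus)

/-- The pairing between `U(L⁺)` and `T⁺` for which the basis `b` is dual to the monomials. -/
def pairing : P.UPlus →ₗ[ℝ] P.TPlus →ₗ[ℝ] ℝ :=
  b.constr ℝ fun K => MvPolynomial.lcoeff ℝ K

/-- The structure constant of the product: the `K`-coefficient of `b K' * b K''`. -/
def prodCoeff (K' K'' K : P.PlusIdx) : ℝ := b.repr (b K' * b K'') K

/-- The structure constant of the action: the `z^β`-coefficient of `ρ(b K) z^γ`. -/
def actCoeff (K : P.PlusIdx) (β γ : CoordIdx d 𝔏) : ℝ :=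
  MvPolynomial.coeff β (P.rho (b K) (MvPolynomial.monomial γ 1))

/-- The transposed product `Δ⁺ Z^K = ∑_{K',K''} (b K' b K'')_K Z^{K'} ⊗ Z^{K''}`. -/
def comulPlus : P.TPlus →ₗ[ℝ] P.TPlus ⊗[ℝ] P.TPlus :=
  (MvPolynomial.basisMonomials P.PlusGen ℝ).constr ℝ fun K =>
    ∑ᶠ q : P.PlusIdx × P.PlusIdx, prodCoeff b q.1 q.2 K • (P.Zmon q.1 ⊗ₜ[ℝ] P.Zmon q.2)

/-- The transposed action `Δ⁺ z_β = ∑_{K,γ} (b K)_β^γ Z^K ⊗ z_γ`. -/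
def coactPlus : P.ModelSpace →ₗ[ℝ] P.TPlus ⊗[ℝ] P.ModelSpace :=
  Finsupp.basisSingleOne.constr ℝ fun β : P.ModelIdx =>
    ∑ᶠ q : P.PlusIdx × P.ModelIdx,
      actCoeff b q.1 β.1 q.2.1 • (P.Zmon q.1 ⊗ₜ[ℝ] Finsupp.single q.2 (1 : ℝ))

end Transpose

end RegParams

end

/-!
The enveloping algebra `U(L⁺)` is a cocommutative bialgebra acting on polynomials. Left
multiplication by `∂ᵢ` and the maps `U ↦ z^γ U D^{(𝐧)}` act as coderivations on the `𝖣_{(J,𝐦)}`,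
whose coproduct is therefore that of divided powers. The `𝖣_{(J,𝐦)}` span because their span is
stable under left multiplication by the generators of `L⁺`. They are independent because the
coefficient of a single generator can be read off the action on a variable `z_𝐧`, and convolving
these functionals gives a dual family.

The axioms of `T⁺` and of its comodule are the transposes of those of `U(L⁺)` and of its action.
The same convolution reduces the finiteness of the product coefficients to that of the action
coefficients. The antipode is transposed recursively along the proper left factors of a monomial:
this terminates because the degree, shifted by the number of noises, is bounded away from `0` on
the generators.
-/

noncomputable section

/-! ### The Hopf algebra structure of an enveloping algebra -/

section PrimitiveElements

variable {R A : Type*} [CommRing R] [Ring A] [Algebra R A]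

theorem rTensor_primitive_mul {f g : A →ₗ[R] A} {a : A} (h : ∀ u, f (a * u) = a * f u - g u)
    (t : A ⊗[R] A) :
    f.rTensor A ((a ⊗ₜ[R] 1 + 1 ⊗ₜ[R] a) * t) =
      (a ⊗ₜ[R] 1 + 1 ⊗ₜ[R] a) * f.rTensor A t - g.rTensor A t := by
  induction t with
  | zero => simp
  | add s t hs ht => simp only [mul_add, map_add, hs, ht]; abel
  | tmul u v =>
    simp only [add_mul, Algebra.TensorProduct.tmul_mul_tmul, one_mul, map_add,
      LinearMap.rTensor_tmul, h, TensorProduct.sub_tmul]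
    abel

theorem lTensor_primitive_mul {f g : A →ₗ[R] A} {a : A} (h : ∀ u, f (a * u) = a * f u - g u)
    (t : A ⊗[R] A) :
    f.lTensor A ((a ⊗ₜ[R] 1 + 1 ⊗ₜ[R] a) * t) =
      (a ⊗ₜ[R] 1 + 1 ⊗ₜ[R] a) * f.lTensor A t - g.lTensor A t := by
  induction t with
  | zero => simp
  | add s t hs ht => simp only [mul_add, map_add, hs, ht]; abel
  | tmul u v =>
    simp only [add_mul, Algebra.TensorProduct.tmul_mul_tmul, one_mul, map_add,
      LinearMap.lTensor_tmul, h, TensorProduct.tmul_sub]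
    abel

theorem mul'_rTensor_primitive_mul {S : A →ₗ[R] A} {a : A} (h : ∀ u, S (a * u) = -(S u * a))
    (t : A ⊗[R] A) :
    LinearMap.mul' R A (S.rTensor A ((a ⊗ₜ[R] 1 + 1 ⊗ₜ[R] a) * t)) = 0 := by
  induction t with
  | zero => simp
  | add s t hs ht => rw [mul_add, map_add, map_add, hs, ht, add_zero]
  | tmul u v =>
    simp only [add_mul, Algebra.TensorProduct.tmul_mul_tmul, one_mul, map_add,
      LinearMap.rTensor_tmul, LinearMap.mul'_apply, h]
    noncomm_ring

theorem mul'_lTensor_primitive_mul {S : A →ₗ[R] A} {a : A} (h : ∀ u, S (a * u) = -(S u * a))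
    (t : A ⊗[R] A) :
    LinearMap.mul' R A (S.lTensor A ((a ⊗ₜ[R] 1 + 1 ⊗ₜ[R] a) * t)) =
      a * LinearMap.mul' R A (S.lTensor A t) - LinearMap.mul' R A (S.lTensor A t) * a := by
  induction t with
  | zero => simp
  | add s t hs ht =>
    rw [mul_add, map_add, map_add, hs, ht, map_add, map_add, mul_add, add_mul]
    abel
  | tmul u v =>
    simp only [add_mul, Algebra.TensorProduct.tmul_mul_tmul, one_mul, map_add,
      LinearMap.lTensor_tmul, LinearMap.mul'_apply, h]
    noncomm_ring

end PrimitiveElements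

section EnvelopingBialgebra

open UniversalEnvelopingAlgebra (ι lift lift_ι_apply hom_ext)

attribute [local instance] LieRing.ofAssociativeRing

section CommRing

variable {R L : Type*} [CommRing R] [LieRing L] [LieAlgebra R L]

local notation "𝒰" => UniversalEnvelopingAlgebra R L

theorem enveloping_subalgebra_eq_top {A : Subalgebra R 𝒰} (h : ∀ x : L, ι R x ∈ A) : A = ⊤ := by
  let f : L →ₗ⁅R⁆ A :=
    { toFun := fun x => ⟨ι R x, h x⟩
      map_add' := fun x y => Subtype.ext (map_add _ _ _)
      map_smul' := fun c x => Subtype.ext (map_smul _ _ _)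
      map_lie' := fun {x y} => Subtype.ext (LieHom.map_lie _ _ _) }
  have hid : A.val.comp (lift R f) = AlgHom.id R 𝒰 :=
    hom_ext R <| LieHom.ext fun x => congrArg A.val (lift_ι_apply R f x)
  refine eq_top_iff.mpr fun u _ => ?_
  rw [← AlgHom.id_apply (R := R) u, ← hid]
  exact (lift R f u).2

@[elab_as_elim]
theorem enveloping_induction {motive : 𝒰 → Prop} (one : motive 1)
    (add : ∀ u v, motive u → motive v → motive (u + v))
    (smul : ∀ (c : R) u, motive u → motive (c • u))
    (ι_mul : ∀ (x : L) u, motive u → motive (ι R x * u)) (u : 𝒰) : motive u := by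
  let A : Subalgebra R 𝒰 :=
    { carrier := {a | ∀ u, motive u → motive (a * u)}
      mul_mem' := fun ha hb u hu => by rw [mul_assoc]; exact ha _ (hb u hu)
      add_mem' := fun ha hb u hu => by rw [add_mul]; exact add _ _ (ha u hu) (hb u hu)
      algebraMap_mem' := fun c u hu => by rw [← Algebra.smul_def]; exact smul c u hu }
  have hu : u ∈ A := enveloping_subalgebra_eq_top (A := A) ι_mul ▸ Algebra.mem_top
  simpa only [mul_one] using hu 1 one

theorem enveloping_linearMap_ext {V : Type*} [AddCommGroup V] [Module R V] {f g : 𝒰 →ₗ[R] V}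
    (one : f 1 = g 1) (ι_mul : ∀ (x : L) (u : 𝒰), f u = g u → f (ι R x * u) = g (ι R x * u)) :
    f = g := by
  ext u
  induction u using enveloping_induction with
  | one => exact one
  | add u v hu hv => rw [map_add, map_add, hu, hv]
  | smul c u hu => rw [map_smul, map_smul, hu]
  | ι_mul x u hu => exact ι_mul x u hu

/-- The coproduct of `U(L)` for which the elements of `L` are primitive. -/
def envelopingComul : 𝒰 →ₐ[R] 𝒰 ⊗[R] 𝒰 :=
  lift R
    { toFun := fun x => ι R x ⊗ₜ[R] 1 + 1 ⊗ₜ[R] ι R x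
      map_add' := fun x y => by
        simp only [map_add, TensorProduct.add_tmul, TensorProduct.tmul_add]
        abel
      map_smul' := fun c x => by
        simp only [map_smul, TensorProduct.smul_tmul', TensorProduct.tmul_smul, smul_add,
          RingHom.id_apply]
      map_lie' := fun {x y} => by
        simp only [LieHom.map_lie, LieRing.of_associative_ring_bracket, mul_add, add_mul,
          Algebra.TensorProduct.tmul_mul_tmul, mul_one, one_mul, TensorProduct.sub_tmul,
          TensorProduct.tmul_sub]
        abel }

/-- The counit of `U(L)`, which vanishes on `L`. -/
def envelopingCounit : 𝒰 →ₐ[R] R :=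
  lift R 0

theorem envelopingComul_ι (x : L) :
    envelopingComul (ι R x) = ι R x ⊗ₜ[R] 1 + 1 ⊗ₜ[R] ι R x :=
  lift_ι_apply R _ x

theorem envelopingCounit_ι (x : L) : envelopingCounit (ι R x) = 0 :=
  lift_ι_apply R _ x

end CommRing

variable {L : Type*} [LieRing L] [LieAlgebra ℝ L]

local notation "𝒰" => UniversalEnvelopingAlgebra ℝ L

theorem envelopingAntipode_one : envelopingAntipode (1 : 𝒰) = 1 :=
  congrArg MulOpposite.unop (map_one envelopingAntipodeOp)

theorem envelopingAntipode_mul (u v : 𝒰) :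
    envelopingAntipode (u * v) = envelopingAntipode v * envelopingAntipode u :=
  congrArg MulOpposite.unop (map_mul envelopingAntipodeOp u v)

theorem envelopingAntipode_ι (x : L) : envelopingAntipode (ι ℝ x) = -ι ℝ x :=
  congrArg MulOpposite.unop (lift_ι_apply ℝ _ x)

theorem envelopingAntipode_ι_mul (x : L) (u : 𝒰) :
    envelopingAntipode (ι ℝ x * u) = -(envelopingAntipode u * ι ℝ x) := by
  rw [envelopingAntipode_mul, envelopingAntipode_ι, mul_neg]

theorem mul'_rTensor_envelopingAntipode :
    LinearMap.mul' ℝ 𝒰 ∘ₗ envelopingAntipode.rTensor 𝒰 ∘ₗ envelopingComul.toLinearMap =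
      Algebra.linearMap ℝ 𝒰 ∘ₗ envelopingCounit.toLinearMap := by
  refine enveloping_linearMap_ext ?_ fun x u _ => ?_
  · simp [Algebra.TensorProduct.one_def, envelopingAntipode_one]
  · simp only [LinearMap.comp_apply, AlgHom.toLinearMap_apply, map_mul, envelopingComul_ι,
      envelopingCounit_ι, zero_mul, map_zero]
    exact mul'_rTensor_primitive_mul (envelopingAntipode_ι_mul x) _

theorem mul'_lTensor_envelopingAntipode :
    LinearMap.mul' ℝ 𝒰 ∘ₗ envelopingAntipode.lTensor 𝒰 ∘ₗ envelopingComul.toLinearMap =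
      Algebra.linearMap ℝ 𝒰 ∘ₗ envelopingCounit.toLinearMap := by
  refine enveloping_linearMap_ext ?_ fun x u hu => ?_
  · simp [Algebra.TensorProduct.one_def, envelopingAntipode_one]
  · simp only [LinearMap.comp_apply, AlgHom.toLinearMap_apply, map_mul, envelopingComul_ι,
      envelopingCounit_ι, zero_mul, map_zero, Algebra.linearMap_apply] at hu ⊢
    rw [mul'_lTensor_primitive_mul (envelopingAntipode_ι_mul x), hu, Algebra.commutes, sub_self]

end EnvelopingBialgebra

end

noncomputable section

open MvPolynomial
open Finsupp (single single_le_iff single_eq_of_ne)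

/-! ### Derivations of polynomial algebras -/

section Derivations

variable {σ R : Type*}

theorem exists_of_coeff_derivation_monomial_ne_zero [CommSemiring R]
    (D : Derivation R (MvPolynomial σ R) (MvPolynomial σ R)) {γ β : σ →₀ ℕ}
    (h : coeff β (D (monomial γ 1)) ≠ 0) :
    ∃ c δ, γ c ≠ 0 ∧ coeff δ (D (X c)) ≠ 0 ∧ β + single c 1 = γ + δ := by
  classical
  have hD : D = mkDerivation R fun c => D (X c) :=
    derivation_ext fun c => (mkDerivation_X R (fun c => D (X c)) c).symm
  rw [hD, mkDerivation_monomial, one_smul, Finsupp.sum, coeff_sum] at h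
  obtain ⟨c, hc, hne⟩ := Finset.exists_ne_zero_of_sum_ne_zero h
  rw [Finsupp.mem_support_iff] at hc
  rw [smul_eq_mul, coeff_monomial_mul'] at hne
  split_ifs at hne with hle
  · obtain ⟨δ, rfl⟩ := le_iff_exists_add.mp hle
    rw [add_tsub_cancel_left] at hne
    have hcγ : single c 1 ≤ γ := single_le_iff.mpr (Nat.one_le_iff_ne_zero.mpr hc)
    exact ⟨c, δ, hc, right_ne_zero_of_mul hne, by rw [add_right_comm, tsub_add_cancel_of_le hcγ]⟩
  · exact absurd rfl hne

theorem derivation_sum_apply {ι A : Type*} [CommSemiring R] [CommSemiring A] [Algebra R A]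
    (s : Finset ι) (D : ι → Derivation R A A) (a : A) : (∑ i ∈ s, D i) a = ∑ i ∈ s, D i a :=
  map_sum (⟨⟨fun E : Derivation R A A => E a, rfl⟩, fun _ _ => rfl⟩ : Derivation R A A →+ A) D s

theorem map_mem_restrictSupport {τ : Type*} [CommSemiring R]
    {T : MvPolynomial σ R →ₗ[R] MvPolynomial τ R} {s : Set (σ →₀ ℕ)}
    {W : Submodule R (MvPolynomial τ R)} (h : ∀ γ ∈ s, T (monomial γ 1) ∈ W)
    {q : MvPolynomial σ R} (hq : q ∈ restrictSupport R s) : T q ∈ W := by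
  have hle : restrictSupport R s ≤ W.comap T := by
    rw [restrictSupport_eq_span, Submodule.span_le]
    rintro _ ⟨γ, hγ, rfl⟩
    exact h γ hγ
  exact hle hq

theorem apply_mem_of_mem_lieSpan {A : Type*} [CommRing R] [CommRing A] [Algebra R A]
    {S : Set (Derivation R A A)} {W : Submodule R A} (hS : ∀ D ∈ S, ∀ a ∈ W, D a ∈ W)
    {D : Derivation R A A} (hD : D ∈ LieSubalgebra.lieSpan R (Derivation R A A) S) :
    ∀ a ∈ W, D a ∈ W := by
  induction hD using LieSubalgebra.lieSpan_induction with
  | mem D hD => exact hS D hD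
  | zero => exact fun _ _ => W.zero_mem
  | add D E _ _ hD hE => exact fun a ha => W.add_mem (hD a ha) (hE a ha)
  | smul c D _ hD => exact fun a ha => W.smul_mem c (hD a ha)
  | lie D E _ _ hD hE =>
    intro a ha
    rw [Derivation.commutator_apply]
    exact W.sub_mem (hD _ (hE a ha)) (hE _ (hD a ha))

end Derivations

/-! ### Weights of multi-indices -/

section Weights

theorem sum_mul_natCast_add {σ R : Type*} [NonAssocSemiring R] (w : σ → R) (β γ : σ →₀ ℕ) :
    ((β + γ).sum fun c j => w c * (j : R)) =
      (β.sum fun c j => w c * (j : R)) + γ.sum fun c j => w c * (j : R) :=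
  Finsupp.sum_add_index' (by simp) (by simp [mul_add])

theorem sum_mul_natCast_single {σ R : Type*} [NonAssocSemiring R] (w : σ → R) (c : σ) :
    ((single c 1).sum fun c j => w c * ((j : ℕ) : R)) = w c := by
  simp

theorem finite_sum_mul_natCast_lt {ι : Type*} [Fintype ι] {s : ι → ℝ} (hs : ∀ i, 0 < s i)
    (C : ℝ) : {n : ι →₀ ℕ | ∑ i, s i * n i < C}.Finite := by
  classical
  refine (Set.finite_Iic (Finsupp.equivFunOnFinite.symm fun i => ⌈C / s i⌉₊)).subset
    fun n hn i => ?_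
  have hle : s i * n i ≤ ∑ j, s j * n j :=
    Finset.single_le_sum (f := fun j => s j * (n j : ℝ))
      (fun j _ => mul_nonneg (hs j).le (Nat.cast_nonneg _)) (Finset.mem_univ i)
  have hlt : (n i : ℝ) < C / s i := (lt_div_iff₀' (hs i)).mpr (hle.trans_lt hn)
  exact_mod_cast hlt.le.trans (Nat.le_ceil _)

end Weights

namespace RegParams

variable {d : ℕ} {𝔏 : Type*}

/-- The total degree `∑_𝐧 (∑ᵢ 𝐧(i)) β(𝐧)` of the polynomial part of `β`. It grows under `∂ᵢ`, which
bounds the powers of `∂ᵢ` contributing to a given monomial. -/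
def polyDeg (β : CoordIdx d 𝔏) : ℕ :=
  β.sum fun c j => Sum.elim (fun _ => 0) (fun n => n.degree) c * j

theorem bracket_add (β γ : CoordIdx d 𝔏) : bracket (β + γ) = bracket β + bracket γ :=
  sum_mul_natCast_add _ β γ

theorem noiseHom_add (β γ : CoordIdx d 𝔏) : noiseHom (β + γ) = noiseHom β + noiseHom γ :=
  sum_mul_natCast_add (R := ℕ) _ β γ

theorem polyDeg_add (β γ : CoordIdx d 𝔏) : polyDeg (β + γ) = polyDeg β + polyDeg γ :=
  sum_mul_natCast_add (R := ℕ) _ β γ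

theorem bracket_inr (n : NVec d) : bracket (single (Sum.inr n) 1 : CoordIdx d 𝔏) = 1 :=
  sum_mul_natCast_single _ _

theorem noiseHom_inr (n : NVec d) : noiseHom (single (Sum.inr n) 1 : CoordIdx d 𝔏) = 0 :=
  sum_mul_natCast_single (R := ℕ) _ _

theorem polyDeg_inr (n : NVec d) : polyDeg (single (Sum.inr n) 1 : CoordIdx d 𝔏) = n.degree :=
  sum_mul_natCast_single (R := ℕ) _ _

theorem bracket_inl (l : Option 𝔏) (k : NVec d →₀ ℕ) :
    bracket (single (Sum.inl (l, k)) 1 : CoordIdx d 𝔏) = 1 - k.sum fun _ i => (i : ℤ) :=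
  sum_mul_natCast_single _ _

theorem noiseHom_inl (l : Option 𝔏) (k : NVec d →₀ ℕ) :
    noiseHom (single (Sum.inl (l, k)) 1 : CoordIdx d 𝔏) = if l.isSome then 1 else 0 :=
  sum_mul_natCast_single (R := ℕ) _ _

theorem polyDeg_inl (p : Option 𝔏 × (NVec d →₀ ℕ)) :
    polyDeg (single (Sum.inl p) 1 : CoordIdx d 𝔏) = 0 :=
  sum_mul_natCast_single (R := ℕ) _ _

variable (P : RegParams d 𝔏)

theorem hom_add (β γ : CoordIdx d 𝔏) : P.hom (β + γ) = P.hom β + P.hom γ :=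
  sum_mul_natCast_add _ β γ

theorem hom_inr (n : NVec d) : P.hom (single (Sum.inr n) 1) = P.scaledDeg n - P.η :=
  sum_mul_natCast_single _ _

theorem hom_inl (l : Option 𝔏) (k : NVec d →₀ ℕ) :
    P.hom (single (Sum.inl (l, k)) 1) =
      P.alpha l + k.sum fun n i => (P.η - P.scaledDeg n) * (i : ℝ) :=
  sum_mul_natCast_single _ _

theorem scaledDeg_add (n m : NVec d) : P.scaledDeg (n + m) = P.scaledDeg n + P.scaledDeg m := by
  simp only [scaledDeg, Finsupp.add_apply, Nat.cast_add, mul_add, Finset.sum_add_distrib]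

theorem scaledDeg_single (i : Fin d) : P.scaledDeg (single i 1) = P.scal i := by
  classical
  simp [scaledDeg, Finsupp.single_apply]

theorem scaledDeg_nonneg (hscal : ∀ i, 0 < P.scal i) (n : NVec d) : 0 ≤ P.scaledDeg n :=
  Finset.sum_nonneg fun i _ => mul_nonneg (hscal i).le (Nat.cast_nonneg _)

theorem scaledDeg_tsub_le (hscal : ∀ i, 0 < P.scal i) (n m : NVec d) :
    P.scaledDeg (n - m) ≤ P.scaledDeg n :=
  Finset.sum_le_sum fun j _ =>
    mul_le_mul_of_nonneg_left (Nat.cast_le.mpr (Nat.sub_le _ _)) (hscal j).le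

variable {P}

/-! ### Subcriticality -/

theorem SubcritPair.mono {l : Option 𝔏} {k k' : NVec d →₀ ℕ} (h : P.SubcritPair l k)
    (hk : k' ≤ k) : P.SubcritPair l k' :=
  ⟨h.1, fun k'' h0 h1 => h.2 k'' h0 (h1.trans hk)⟩

theorem SubcritPair.scaledDeg_lt {l : Option 𝔏} {k : NVec d →₀ ℕ} {n : NVec d}
    (h : P.SubcritPair l (k + single n 1)) : P.scaledDeg n < P.η := by
  have hn := (h.2 (single n 1) (by simp) le_add_self).1
  rw [sum_mul_natCast_single (fun n => P.regSol - P.scaledDeg n)] at hn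
  linarith

theorem Subcrit.add {β γ : CoordIdx d 𝔏} (hβ : P.Subcrit β) (hγ : P.Subcrit γ) :
    P.Subcrit (β + γ) := by
  intro l k hne
  by_cases h0 : β (Sum.inl (l, k)) = 0
  · exact hγ l k (by simpa [h0] using hne)
  · exact hβ l k h0

theorem subcrit_inr (n : NVec d) : P.Subcrit (single (Sum.inr n) 1) :=
  fun _ _ hne => absurd (single_eq_of_ne Sum.inl_ne_inr) hne

variable (P)

/-! ### The derivations `D^{(𝐧)}` -/

open Classical in
theorem dN_X_inl (n : NVec d) (l : Option 𝔏) (k : NVec d →₀ ℕ) :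
    P.dN n (X (Sum.inl (l, k))) =
      if P.SubcritPair l (k + single n 1) then
        ((k n : ℝ) + 1) • X (Sum.inl (l, k + single n 1))
      else 0 :=
  mkDerivation_X ℝ _ _

open Classical in
theorem dN_X_inr (n m : NVec d) : P.dN n (X (Sum.inr m)) = if m = n then 1 else 0 :=
  mkDerivation_X ℝ _ _

theorem coeff_dN_X_inl {n : NVec d} {l : Option 𝔏} {k : NVec d →₀ ℕ} {δ : CoordIdx d 𝔏}
    (h : coeff δ (P.dN n (X (Sum.inl (l, k)))) ≠ 0) :
    P.SubcritPair l (k + single n 1) ∧ δ = single (Sum.inl (l, k + single n 1)) 1 := by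
  classical
  rw [dN_X_inl] at h
  split_ifs at h with hs
  · rw [coeff_smul, coeff_X] at h
    exact ⟨hs, by_contra fun hne => h (by rw [if_neg (Ne.symm hne), smul_zero])⟩
  · exact absurd (coeff_zero δ) h

theorem coeff_dN_X_inr {n m : NVec d} {δ : CoordIdx d 𝔏}
    (h : coeff δ (P.dN n (X (Sum.inr m))) ≠ 0) : m = n ∧ δ = 0 := by
  classical
  rw [dN_X_inr] at h
  split_ifs at h with hmn
  · rw [coeff_one] at h
    exact ⟨hmn, by_contra fun hne => h (if_neg (Ne.symm hne))⟩
  · exact absurd (coeff_zero δ) h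

theorem coeff_dN_monomial {n : NVec d} {γ β : CoordIdx d 𝔏}
    (h : coeff β (P.dN n (monomial γ 1)) ≠ 0) :
    (∃ l k, γ (Sum.inl (l, k)) ≠ 0 ∧ P.SubcritPair l (k + single n 1) ∧
      β + single (Sum.inl (l, k)) 1 = γ + single (Sum.inl (l, k + single n 1)) 1) ∨
    β + single (Sum.inr n) 1 = γ := by
  obtain ⟨⟨l, k⟩ | m, δ, hc, hδ, he⟩ := exists_of_coeff_derivation_monomial_ne_zero _ h
  · obtain ⟨hs, rfl⟩ := P.coeff_dN_X_inl hδ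
    exact .inl ⟨l, k, hc, hs, he⟩
  · obtain ⟨rfl, rfl⟩ := P.coeff_dN_X_inr hδ
    exact .inr (he.trans (add_zero γ))

theorem weight_of_coeff_dN {G : Type*} [AddCancelCommMonoid G] {φ : CoordIdx d 𝔏 → G}
    (hφ : ∀ β γ, φ (β + γ) = φ β + φ γ) {n : NVec d}
    (hn : ∀ l k, φ (single (Sum.inl (l, k + single n 1)) 1) + φ (single (Sum.inr n) 1) =
      φ (single (Sum.inl (l, k)) 1))
    {γ β : CoordIdx d 𝔏} (h : coeff β (P.dN n (monomial γ 1)) ≠ 0) :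
    φ β + φ (single (Sum.inr n) 1) = φ γ := by
  rcases P.coeff_dN_monomial h with ⟨l, k, -, -, he⟩ | rfl
  · have hw := congrArg φ he
    rw [hφ, hφ, ← hn l k, add_comm (φ (single (Sum.inl _) 1)), ← add_assoc] at hw
    exact add_right_cancel hw
  · exact (hφ _ _).symm

theorem bracket_inl_add (l : Option 𝔏) (k : NVec d →₀ ℕ) (n : NVec d) :
    bracket (single (Sum.inl (l, k + single n 1)) 1 : CoordIdx d 𝔏) +
      bracket (single (Sum.inr n) 1 : CoordIdx d 𝔏) = bracket (single (Sum.inl (l, k)) 1) := by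
  rw [bracket_inl, bracket_inl, bracket_inr, Finsupp.sum_add_index' (by simp) (by simp),
    Finsupp.sum_single_index (by simp), Nat.cast_one]
  ring

theorem noiseHom_inl_add (l : Option 𝔏) (k : NVec d →₀ ℕ) (n : NVec d) :
    noiseHom (single (Sum.inl (l, k + single n 1)) 1 : CoordIdx d 𝔏) +
      noiseHom (single (Sum.inr n) 1 : CoordIdx d 𝔏) = noiseHom (single (Sum.inl (l, k)) 1) := by
  rw [noiseHom_inl, noiseHom_inl, noiseHom_inr, add_zero]

theorem hom_inl_add (l : Option 𝔏) (k : NVec d →₀ ℕ) (n : NVec d) :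
    P.hom (single (Sum.inl (l, k + single n 1)) 1) + P.hom (single (Sum.inr n) 1) =
      P.hom (single (Sum.inl (l, k)) 1) := by
  rw [hom_inl, hom_inl, hom_inr, sum_mul_natCast_add, sum_mul_natCast_single]
  ring

section dNSupport

variable {n : NVec d} {γ β : CoordIdx d 𝔏} (h : coeff β (P.dN n (monomial γ 1)) ≠ 0)
include h

theorem bracket_of_coeff_dN : bracket β = bracket γ - 1 :=
  eq_sub_of_add_eq <| bracket_inr (𝔏 := 𝔏) n ▸
    P.weight_of_coeff_dN bracket_add (fun l k => bracket_inl_add l k n) h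

theorem noiseHom_of_coeff_dN : noiseHom β = noiseHom γ := by
  simpa only [noiseHom_inr, add_zero] using
    P.weight_of_coeff_dN noiseHom_add (fun l k => noiseHom_inl_add l k n) h

theorem hom_of_coeff_dN : P.hom β = P.hom γ + P.η - P.scaledDeg n := by
  have hw := P.weight_of_coeff_dN P.hom_add (fun l k => P.hom_inl_add l k n) h
  rw [hom_inr] at hw
  linarith

theorem polyDeg_of_coeff_dN : polyDeg γ ≤ polyDeg β + n.degree := by
  rcases P.coeff_dN_monomial h with ⟨l, k, -, -, he⟩ | rfl
  · have hw := congrArg polyDeg he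
    simp only [polyDeg_add, polyDeg_inl, add_zero] at hw
    exact hw ▸ Nat.le_add_right _ _
  · rw [polyDeg_add, polyDeg_inr]

theorem subcrit_of_coeff_dN (hγ : P.Subcrit γ) : P.Subcrit β := by
  have hβ : P.Subcrit (β + single (Sum.inr n) 1) ∨
      ∃ l k, P.Subcrit (β + single (Sum.inl (l, k)) 1) := by
    rcases P.coeff_dN_monomial h with ⟨l, k, -, hs, he⟩ | he
    · exact .inr ⟨l, k, he ▸ hγ.add fun l' k' hne => by
        obtain ⟨⟩ := Finsupp.single_apply_ne_zero.mp hne |>.1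
        exact hs⟩
    · exact .inl (he ▸ hγ)
  rcases hβ with hβ | ⟨l, k, hβ⟩ <;>
  exact fun l' k' hne => hβ l' k' fun h0 => hne (Nat.eq_zero_of_add_eq_zero_right h0)

theorem inr_eq_zero_of_coeff_dN {m : NVec d} (hγ : γ (Sum.inr m) = 0) : β (Sum.inr m) = 0 := by
  rcases P.coeff_dN_monomial h with ⟨l, k, -, -, he⟩ | rfl
  · simpa [hγ] using DFunLike.congr_fun he (Sum.inr m)
  · exact Nat.eq_zero_of_add_eq_zero_right hγ

end dNSupport

theorem finite_dN_X_ne_zero (hscal : ∀ i, 0 < P.scal i) (c : Coord d 𝔏) :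
    {n | P.dN n (X c) ≠ 0}.Finite := by
  classical
  rcases c with ⟨l, k⟩ | m
  · refine (finite_sum_mul_natCast_lt hscal P.η).subset fun n hn => ?_
    rw [Set.mem_ofPred_eq, dN_X_inl] at hn
    exact (ite_ne_right_iff.mp hn).1.scaledDeg_lt
  · refine (Set.finite_singleton m).subset fun n hn => ?_
    rw [Set.mem_ofPred_eq, dN_X_inr] at hn
    exact (ite_ne_right_iff.mp hn).1.symm

theorem finite_dN_ne_zero (hscal : ∀ i, 0 < P.scal i) (q : CoordPoly d 𝔏) :
    {n | P.dN n q ≠ 0}.Finite := by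
  refine (q.vars.finite_toSet.biUnion fun c _ => P.finite_dN_X_ne_zero hscal c).subset
    fun n hn => ?_
  by_contra hne
  refine hn (derivation_eq_zero_of_forall_mem_vars fun c hc => ?_)
  by_contra hX
  exact hne (Set.mem_biUnion (Finset.mem_coe.mpr hc) hX)

theorem dN_dN_X_inl {n m : NVec d} (hnm : n ≠ m) (l : Option 𝔏) (k : NVec d →₀ ℕ)
    [Decidable (P.SubcritPair l (k + single n 1 + single m 1))] :
    P.dN n (P.dN m (X (Sum.inl (l, k)))) =
      if P.SubcritPair l (k + single n 1 + single m 1) then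
        (((k n : ℝ) + 1) * ((k m : ℝ) + 1)) • X (Sum.inl (l, k + single n 1 + single m 1))
      else 0 := by
  classical
  rw [dN_X_inl]
  by_cases hs : P.SubcritPair l (k + single n 1 + single m 1)
  · rw [if_pos (hs.mono (add_le_add le_self_add le_rfl)), Derivation.map_smul, dN_X_inl,
      add_right_comm k, if_pos hs, if_pos hs, smul_smul, Finsupp.add_apply, single_eq_of_ne hnm,
      add_zero, mul_comm]
  · rw [if_neg hs]
    split_ifs
    · rw [Derivation.map_smul, dN_X_inl, add_right_comm k, if_neg hs, smul_zero]
    · exact map_zero _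

theorem dN_comm (n m : NVec d) (q : CoordPoly d 𝔏) : P.dN n (P.dN m q) = P.dN m (P.dN n q) := by
  classical
  have h : ⁅P.dN n, P.dN m⁆ = 0 := by
    refine derivation_ext fun c => ?_
    rw [Derivation.commutator_apply, Derivation.zero_apply, sub_eq_zero]
    rcases eq_or_ne n m with rfl | hnm
    · rfl
    rcases c with ⟨l, k⟩ | a
    · rw [P.dN_dN_X_inl hnm, P.dN_dN_X_inl hnm.symm, add_right_comm k, mul_comm ((k n : ℝ) + 1)]
    · rw [dN_X_inr, dN_X_inr]
      split_ifs <;> simp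
  rw [← sub_eq_zero, ← Derivation.commutator_apply, h, Derivation.zero_apply]

/-! ### The derivations `∂ᵢ` -/

section dX

variable {P} (hscal : ∀ i, 0 < P.scal i)
include hscal

theorem dX_eq_sum (i : Fin d) (q : CoordPoly d 𝔏) {F : Finset (NVec d)}
    (hF : ∀ n ∉ F, P.dN n q = 0) :
    P.dX i q = ∑ n ∈ F, ((n i : ℝ) + 1) • (X (Sum.inr (n + single i 1)) * P.dN n q) := by
  classical
  let G := F ∪ q.vars.biUnion fun c => (P.finite_dN_X_ne_zero hscal c).toFinset
  let D : Derivation ℝ (CoordPoly d 𝔏) (CoordPoly d 𝔏) :=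
    ∑ n ∈ G, ((n i : ℝ) + 1) • ((X (Sum.inr (n + single i 1)) : CoordPoly d 𝔏) • P.dN n)
  have hD (p : CoordPoly d 𝔏) :
      D p = ∑ n ∈ G, ((n i : ℝ) + 1) • (X (Sum.inr (n + single i 1)) * P.dN n p) :=
    derivation_sum_apply _ _ _
  have hDq : P.dX i q = D q := by
    refine derivation_eq_of_forall_mem_vars fun c hc => ?_
    rw [hD, dX, mkDerivation_X]
    refine finsum_eq_sum_of_support_subset _ fun n hn => ?_
    refine Finset.mem_union_right _ (Finset.mem_biUnion.mpr ⟨c, hc, ?_⟩)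
    exact (Set.Finite.mem_toFinset _).mpr fun h0 => hn (by simp only [h0, mul_zero, smul_zero])
  rw [hDq, hD]
  refine (Finset.sum_subset Finset.subset_union_left fun n _ hn => ?_).symm
  rw [hF n hn, mul_zero, smul_zero]

theorem exists_finset_dN_eq_zero (q : CoordPoly d 𝔏) :
    ∃ F : Finset (NVec d), ∀ n ∉ F, P.dN n q = 0 :=
  ⟨(P.finite_dN_ne_zero hscal q).toFinset, fun n hn => by simpa using hn⟩

theorem exists_coeff_dN_of_coeff_dX {i : Fin d} {q : CoordPoly d 𝔏} {β : CoordIdx d 𝔏}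
    (h : coeff β (P.dX i q) ≠ 0) :
    ∃ n ε, coeff ε (P.dN n q) ≠ 0 ∧ β = ε + single (Sum.inr (n + single i 1)) 1 := by
  classical
  obtain ⟨F, hF⟩ := exists_finset_dN_eq_zero hscal q
  rw [dX_eq_sum hscal i q hF, coeff_sum] at h
  obtain ⟨n, -, hn⟩ := Finset.exists_ne_zero_of_sum_ne_zero h
  rw [coeff_smul, coeff_X_mul'] at hn
  split_ifs at hn with hβ
  · rw [Finsupp.mem_support_iff, ← Nat.one_le_iff_ne_zero, ← single_le_iff] at hβ
    exact ⟨n, _, right_ne_zero_of_smul hn, (tsub_add_cancel_of_le hβ).symm⟩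
  · simp at hn

theorem dX_X_inr (i : Fin d) (n : NVec d) :
    P.dX i (X (Sum.inr n)) = ((n i : ℝ) + 1) • X (Sum.inr (n + single i 1)) := by
  classical
  have hF : ∀ m ∉ ({n} : Finset (NVec d)), P.dN m (X (Sum.inr n)) = 0 := fun m hm => by
    rw [dN_X_inr, if_neg fun h => hm (Finset.mem_singleton.mpr h.symm)]
  rw [dX_eq_sum hscal i _ hF, Finset.sum_singleton, dN_X_inr, if_pos rfl, mul_one]

theorem dN_dX (n : NVec d) (i : Fin d) (q : CoordPoly d 𝔏) :
    P.dN n (P.dX i q) = P.dX i (P.dN n q) + (n i : ℝ) • P.dN (n - single i 1) q := by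
  classical
  obtain ⟨F, hF⟩ := exists_finset_dN_eq_zero hscal q
  have hF' : ∀ m ∉ F, P.dN m (P.dN n q) = 0 := fun m hm => by rw [P.dN_comm, hF m hm, map_zero]
  have hterm (m : NVec d) :
      P.dN n (((m i : ℝ) + 1) • (X (Sum.inr (m + single i 1)) * P.dN m q)) =
        ((m i : ℝ) + 1) • (X (Sum.inr (m + single i 1)) * P.dN m (P.dN n q)) +
          if m + single i 1 = n then ((m i : ℝ) + 1) • P.dN m q else 0 := by
    rw [Derivation.map_smul, Derivation.leibniz, P.dN_comm m n, dN_X_inr, smul_eq_mul, smul_eq_mul,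
      mul_ite, mul_one, mul_zero, smul_add, smul_ite, smul_zero]
  have hsum : ∑ m ∈ F, (if m + single i 1 = n then ((m i : ℝ) + 1) • P.dN m q else 0) =
      (n i : ℝ) • P.dN (n - single i 1) q := by
    rcases eq_or_ne (n i) 0 with hn | hn
    · rw [hn, Nat.cast_zero, zero_smul]
      refine Finset.sum_eq_zero fun m _ => if_neg ?_
      rintro rfl
      simp at hn
    · obtain ⟨m, rfl⟩ : ∃ m, n = m + single i 1 :=
        ⟨_, (tsub_add_cancel_of_le (single_le_iff.mpr (Nat.one_le_iff_ne_zero.mpr hn))).symm⟩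
      simp only [add_left_inj, Finset.sum_ite_eq', add_tsub_cancel_right, Finsupp.add_apply,
        Finsupp.single_eq_same, Nat.cast_add, Nat.cast_one, ite_eq_left_iff]
      exact fun hm => by rw [hF m hm, smul_zero]
  rw [dX_eq_sum hscal i q hF, dX_eq_sum hscal i _ hF', map_sum, ← hsum, ← Finset.sum_add_distrib]
  exact Finset.sum_congr rfl fun m _ => hterm m

theorem dX_dX_eq_sum (i j : Fin d) (q : CoordPoly d 𝔏) {F : Finset (NVec d)}
    (hF : ∀ n ∉ F, P.dN n q = 0) :
    P.dX i (P.dX j q) =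
      ∑ n ∈ F, (((n j : ℝ) + 1) * (((n + single j 1 : NVec d) i : ℝ) + 1)) •
        (X (Sum.inr (n + single j 1 + single i 1)) * P.dN n q) +
      ∑ n ∈ F, ∑ m ∈ F, (((n j : ℝ) + 1) * ((m i : ℝ) + 1)) •
        (X (Sum.inr (n + single j 1)) * (X (Sum.inr (m + single i 1)) * P.dN m (P.dN n q))) := by
  have hF' (n : NVec d) : ∀ m ∉ F, P.dN m (P.dN n q) = 0 := fun m hm => by
    rw [P.dN_comm, hF m hm, map_zero]
  rw [dX_eq_sum hscal j q hF, map_sum, ← Finset.sum_add_distrib]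
  refine Finset.sum_congr rfl fun n _ => ?_
  rw [Derivation.map_smul, Derivation.leibniz, dX_X_inr hscal, dX_eq_sum hscal i _ (hF' n),
    smul_add, add_comm]
  simp only [smul_eq_mul, mul_smul_comm, smul_mul_assoc, smul_smul, mul_comm (P.dN n q),
    Finset.mul_sum, Finset.smul_sum]

theorem dX_comm (i j : Fin d) (q : CoordPoly d 𝔏) :
    P.dX i (P.dX j q) = P.dX j (P.dX i q) := by
  obtain ⟨F, hF⟩ := exists_finset_dN_eq_zero hscal q
  have hcoeff (n : NVec d) : ((n j : ℝ) + 1) * (((n + single j 1 : NVec d) i : ℝ) + 1) =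
      ((n i : ℝ) + 1) * (((n + single i 1 : NVec d) j : ℝ) + 1) := by
    rcases eq_or_ne i j with rfl | hij
    · rfl
    · rw [Finsupp.add_apply, Finsupp.add_apply, single_eq_of_ne hij, single_eq_of_ne hij.symm,
        add_zero, add_zero, mul_comm]
  rw [dX_dX_eq_sum hscal i j q hF, dX_dX_eq_sum hscal j i q hF,
    Finset.sum_comm (s := F) (t := F)]
  refine congrArg₂ (· + ·) (Finset.sum_congr rfl fun n _ => ?_)
    (Finset.sum_congr rfl fun n _ => Finset.sum_congr rfl fun m _ => ?_)
  · rw [add_right_comm n, hcoeff]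
  · rw [P.dN_comm n m, mul_comm ((m j : ℝ) + 1), mul_left_comm (X (Sum.inr (m + _)))]

section dXSupport

variable {i : Fin d} {γ β : CoordIdx d 𝔏} (h : coeff β (P.dX i (monomial γ 1)) ≠ 0)
include h

theorem bracket_of_coeff_dX : bracket β = bracket γ := by
  obtain ⟨n, ε, hε, rfl⟩ := exists_coeff_dN_of_coeff_dX hscal h
  rw [bracket_add, bracket_inr, P.bracket_of_coeff_dN hε, sub_add_cancel]

theorem noiseHom_of_coeff_dX : noiseHom β = noiseHom γ := by
  obtain ⟨n, ε, hε, rfl⟩ := exists_coeff_dN_of_coeff_dX hscal h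
  rw [noiseHom_add, noiseHom_inr, P.noiseHom_of_coeff_dN hε, add_zero]

theorem hom_of_coeff_dX : P.hom β = P.hom γ + P.scal i := by
  obtain ⟨n, ε, hε, rfl⟩ := exists_coeff_dN_of_coeff_dX hscal h
  rw [hom_add, hom_inr, P.hom_of_coeff_dN hε, scaledDeg_add, scaledDeg_single]
  ring

theorem polyDeg_of_coeff_dX : polyDeg γ + 1 ≤ polyDeg β := by
  obtain ⟨n, ε, hε, rfl⟩ := exists_coeff_dN_of_coeff_dX hscal h
  rw [polyDeg_add, polyDeg_inr, map_add, Finsupp.degree_single, ← add_assoc]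
  exact Nat.add_le_add_right (P.polyDeg_of_coeff_dN hε) 1

theorem subcrit_of_coeff_dX (hγ : P.Subcrit γ) : P.Subcrit β := by
  obtain ⟨n, ε, hε, rfl⟩ := exists_coeff_dN_of_coeff_dX hscal h
  exact (P.subcrit_of_coeff_dN hε hγ).add (subcrit_inr _)

theorem inr_eq_zero_of_coeff_dX {m : NVec d} (hγ : γ (Sum.inr m) = 0)
    (hm : P.scaledDeg m < P.scal i) : β (Sum.inr m) = 0 := by
  obtain ⟨n, ε, hε, rfl⟩ := exists_coeff_dN_of_coeff_dX hscal h
  have hne : m ≠ n + single i 1 := by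
    rintro rfl
    rw [scaledDeg_add, scaledDeg_single] at hm
    linarith [P.scaledDeg_nonneg hscal n]
  rw [Finsupp.add_apply, P.inr_eq_zero_of_coeff_dN hε hγ, single_eq_of_ne (by simpa using hne),
    add_zero]

end dXSupport

end dX

/-! ### Stability of the index sets -/

/-- The span of the monomials `z^γ` with `(γ,𝐧) ∈ ℳ⁺`. -/
def coeffSpan (n : NVec d) : Submodule ℝ (CoordPoly d 𝔏) := restrictSupport ℝ {γ | (γ, n) ∈ P.MPlus}

/-- The model space, as the span of the monomials `z^β` with `β ∈ 𝒫 ∪ 𝒩⁻`. -/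
def modelSpan : Submodule ℝ (CoordPoly d 𝔏) := restrictSupport ℝ (P.Populated ∪ P.NMinus)

theorem coeffSpan_anti {n m : NVec d} (h : P.scaledDeg n ≤ P.scaledDeg m) :
    P.coeffSpan m ≤ P.coeffSpan n :=
  restrictSupport_mono _ fun _ hγ => ⟨hγ.1, h.trans_lt hγ.2⟩

section Stability

variable {P}

theorem add_mem_NSet_of_coeff_dN {n : NVec d} {γ γ' β : CoordIdx d 𝔏} (hγ : γ ∈ P.NSet)
    (hγ' : γ' ∈ P.NMinus) (h : coeff β (P.dN n (monomial γ' 1)) ≠ 0) : γ + β ∈ P.NSet := by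
  refine ⟨⟨?_, hγ.1.2.1.add (P.subcrit_of_coeff_dN h hγ'.2.1), fun m hm => ?_⟩, ?_⟩
  · rw [bracket_add, P.bracket_of_coeff_dN h, hγ.1.1, hγ'.1, sub_self, add_zero]
  · rw [Finsupp.add_apply, hγ.1.2.2 m hm, P.inr_eq_zero_of_coeff_dN h (hγ'.2.2 m hm)]
  · rw [noiseHom_add]
    exact Nat.add_pos_left hγ.2 _

theorem coeff_zD_monomial {γ γ' β : CoordIdx d 𝔏} {n : NVec d}
    (h : coeff β (P.zD γ n (monomial γ' 1)) ≠ 0) :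
    ∃ β', β = γ + β' ∧ coeff β' (P.dN n (monomial γ' 1)) ≠ 0 := by
  rw [zD, Derivation.smul_apply, smul_eq_mul, coeff_monomial_mul', one_mul] at h
  obtain ⟨hle, hne⟩ := ite_ne_right_iff.mp h
  exact ⟨β - γ, (add_tsub_cancel_of_le hle).symm, hne⟩

theorem LPlus_apply_mem_restrictSupport (S : Set (CoordIdx d 𝔏))
    (hzD : ∀ p : P.MPlus, ∀ γ ∈ S, ∀ β, coeff β (P.dN p.1.2 (monomial γ 1)) ≠ 0 → p.1.1 + β ∈ S)
    (hdX : ∀ i, ∀ γ ∈ S, ∀ β, coeff β (P.dX i (monomial γ 1)) ≠ 0 → β ∈ S)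
    (x : P.LPlus) : ∀ q ∈ restrictSupport ℝ S, x.1 q ∈ restrictSupport ℝ S := by
  refine apply_mem_of_mem_lieSpan ?_ x.2
  rintro _ ⟨p | i, rfl⟩ q hq
  · refine map_mem_restrictSupport (T := (P.zD p.1.1 p.1.2).toLinearMap)
      (W := restrictSupport ℝ S) (fun γ hγ => (mem_restrictSupport_iff ℝ).mpr fun β hβ => ?_) hq
    obtain ⟨β', rfl, h⟩ := coeff_zD_monomial (mem_support_iff.mp hβ)
    exact hzD p γ hγ β' h
  · exact map_mem_restrictSupport (T := (P.dX i).toLinearMap) (W := restrictSupport ℝ S)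
      (fun γ hγ => (mem_restrictSupport_iff ℝ).mpr fun β hβ =>
        hdX i γ hγ β (mem_support_iff.mp hβ)) hq

variable (hscal : ∀ i, 0 < P.scal i) (hsol : ∀ i, P.regSol ≤ P.scal i)
include hscal hsol

theorem mem_NMinus_of_coeff_dX {i : Fin d} {γ β : CoordIdx d 𝔏} (hγ : γ ∈ P.NMinus)
    (h : coeff β (P.dX i (monomial γ 1)) ≠ 0) : β ∈ P.NMinus :=
  ⟨(bracket_of_coeff_dX hscal h).trans hγ.1, subcrit_of_coeff_dX hscal h hγ.2.1, fun m hm =>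
    inr_eq_zero_of_coeff_dX hscal h (hγ.2.2 m hm) (hm.trans_le (hsol i))⟩

theorem mem_NSet_of_coeff_dX {i : Fin d} {γ β : CoordIdx d 𝔏} (hγ : γ ∈ P.NSet)
    (h : coeff β (P.dX i (monomial γ 1)) ≠ 0) : β ∈ P.NSet :=
  ⟨mem_NMinus_of_coeff_dX hscal hsol hγ.1 h, (noiseHom_of_coeff_dX hscal h).symm ▸ hγ.2⟩

theorem LPlus_apply_mem_coeffSpan (x : P.LPlus) (n : NVec d) :
    ∀ q ∈ P.coeffSpan n, x.1 q ∈ P.coeffSpan n := by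
  refine LPlus_apply_mem_restrictSupport _ (fun p γ hγ β h => ?_) (fun i γ hγ β h => ?_) x
  · refine ⟨add_mem_NSet_of_coeff_dN p.2.1 hγ.1.1 h, ?_⟩
    have hp : P.scaledDeg p.1.2 < P.η + P.hom p.1.1 := p.2.2
    have hn : P.scaledDeg n < P.η + P.hom γ := hγ.2
    change P.scaledDeg n < P.η + P.hom (p.1.1 + β)
    rw [hom_add, P.hom_of_coeff_dN h]
    linarith
  · refine ⟨mem_NSet_of_coeff_dX hscal hsol hγ.1 h, hγ.2.trans ?_⟩
    change P.η + P.hom γ < P.η + P.hom β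
    rw [hom_of_coeff_dX hscal h]
    linarith [hscal i]

theorem LPlus_apply_mem_modelSpan (x : P.LPlus) :
    ∀ q ∈ P.modelSpan, x.1 q ∈ P.modelSpan := by
  refine LPlus_apply_mem_restrictSupport _ (fun p γ hγ β h => ?_) (fun i γ hγ β h => ?_) x
  · rcases hγ with (⟨m, rfl⟩ | hγ) | hγ
    · obtain ⟨rfl, rfl⟩ := P.coeff_dN_X_inr h
      exact .inl (.inr ((add_zero p.1.1).symm ▸ p.2.1))
    · exact .inl (.inr (add_mem_NSet_of_coeff_dN p.2.1 hγ.1 h))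
    · exact .inl (.inr (add_mem_NSet_of_coeff_dN p.2.1 hγ h))
  · rcases hγ with (⟨m, rfl⟩ | hγ) | hγ
    · obtain ⟨n, ε, hε, rfl⟩ := exists_coeff_dN_of_coeff_dX hscal h
      obtain ⟨rfl, rfl⟩ := P.coeff_dN_X_inr hε
      exact .inl (.inl ⟨_, (zero_add _).symm⟩)
    · exact .inr (mem_NMinus_of_coeff_dX hscal hsol hγ.1 h)
    · exact .inr (mem_NMinus_of_coeff_dX hscal hsol hγ h)

end Stability

end RegParams

end

noncomputable section

namespace RegParams

variable {d : ℕ} {𝔏 : Type*} (P : RegParams d 𝔏)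

open MvPolynomial
open Finsupp (single)

attribute [local instance] LieRing.ofAssociativeRing

local notation "ιU" => UniversalEnvelopingAlgebra.ι ℝ (L := P.LPlus)

/-! ### The action `ρ` -/

theorem rho_ι_apply (x : P.LPlus) (q : CoordPoly d 𝔏) : P.rho (ιU x) q = x.1 q := by
  rw [rho, UniversalEnvelopingAlgebra.lift_ι_apply]
  rfl

theorem rho_ι_mul_apply (x : P.LPlus) (u : P.UPlus) (q : CoordPoly d 𝔏) :
    P.rho (ιU x * u) q = x.1 (P.rho u q) := by
  rw [map_mul, Module.End.mul_apply, rho_ι_apply]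

theorem rho_apply_one (u : P.UPlus) : P.rho u 1 = C (envelopingCounit u) := by
  induction u using enveloping_induction with
  | one => simp
  | add u v hu hv => rw [map_add, LinearMap.add_apply, hu, hv, map_add, map_add]
  | smul c u hu =>
    rw [map_smul, LinearMap.smul_apply, hu, map_smul, smul_eq_mul, map_mul, smul_eq_C_mul]
  | ι_mul x u hu =>
    rw [rho_ι_mul_apply, hu, map_mul, envelopingCounit_ι, zero_mul, map_zero]
    exact Derivation.map_algebraMap _ _

theorem rho_mem_of_LPlus_apply_mem {W : Submodule ℝ (CoordPoly d 𝔏)}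
    (hW : ∀ x : P.LPlus, ∀ q ∈ W, x.1 q ∈ W) (u : P.UPlus) : ∀ q ∈ W, P.rho u q ∈ W := by
  induction u using enveloping_induction with
  | one => exact fun q hq => by rwa [map_one, Module.End.one_apply]
  | add u v hu hv => exact fun q hq => by rw [map_add]; exact W.add_mem (hu q hq) (hv q hq)
  | smul c u hu => exact fun q hq => by rw [map_smul]; exact W.smul_mem c (hu q hq)
  | ι_mul x u hu => exact fun q hq => by rw [rho_ι_mul_apply]; exact hW x _ (hu q hq)

/-! ### The maps `U ↦ π U D^{(𝐧)}` -/

/-- The map `U ↦ π U D^{(𝐧)}` for a polynomial `π`, the linear extension of `sandwich` in `z^γ`. -/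
def sandwichLin (n : NVec d) (π : CoordPoly d 𝔏) : P.UPlus →ₗ[ℝ] P.UPlus where
  toFun U := P.homAction U (P.zDLinear n) π
  map_add' U V := by rw [map_add, LinearMap.add_apply, LinearMap.add_apply]
  map_smul' c U := by rw [map_smul, LinearMap.smul_apply, LinearMap.smul_apply, RingHom.id_apply]

theorem sandwichLin_one (n : NVec d) (π : CoordPoly d 𝔏) :
    P.sandwichLin n π 1 = P.zDLinear n π := by
  change P.homAction 1 (P.zDLinear n) π = _
  rw [map_one, Module.End.one_apply]

theorem sandwichLin_ι_mul (n : NVec d) (π : CoordPoly d 𝔏) (x : P.LPlus) (U : P.UPlus) :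
    P.sandwichLin n π (ιU x * U) = ιU x * P.sandwichLin n π U - P.sandwichLin n (x.1 π) U := by
  change P.homAction (ιU x * U) (P.zDLinear n) π = _
  simp only [map_mul, homAction]
  rw [Module.End.mul_apply, UniversalEnvelopingAlgebra.lift_ι_apply]
  rfl

theorem sandwichLin_ι (n : NVec d) (π : CoordPoly d 𝔏) (x : P.LPlus) :
    P.sandwichLin n π (ιU x) = ιU x * P.zDLinear n π - P.zDLinear n (x.1 π) := by
  simpa only [mul_one, sandwichLin_one] using P.sandwichLin_ι_mul n π x 1

theorem sandwich_eq_sandwichLin (p : P.MPlus) :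
    P.sandwich p = P.sandwichLin p.1.2 (monomial p.1.1 1) := rfl

theorem monomial_mem_coeffSpan (p : P.MPlus) : monomial p.1.1 1 ∈ P.coeffSpan p.1.2 :=
  (monomial_mem_restrictSupport ℝ).mpr (.inl p.2)

theorem exists_zDLinear_eq_ι {n : NVec d} {π : CoordPoly d 𝔏} (hπ : π ∈ P.coeffSpan n) :
    ∃ x : P.LPlus, x.1 = π • P.dN n ∧ P.zDLinear n π = ιU x := by
  rw [coeffSpan, restrictSupport_eq_span] at hπ
  induction hπ using Submodule.span_induction with
  | mem q hq =>
    obtain ⟨γ, hγ, rfl⟩ := hq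
    refine ⟨P.gen (Sum.inl ⟨(γ, n), hγ⟩), rfl, ?_⟩
    exact (P.sandwichLin_one n _).symm.trans (P.sandwich_one ⟨(γ, n), hγ⟩)
  | zero => exact ⟨0, (zero_smul _ _).symm, by rw [map_zero, map_zero]⟩
  | add p q _ _ hp hq =>
    obtain ⟨x, hx, hx'⟩ := hp
    obtain ⟨y, hy, hy'⟩ := hq
    exact ⟨x + y, by rw [add_smul, ← hx, ← hy]; rfl, by rw [map_add, map_add, hx', hy']⟩
  | smul c p _ hp =>
    obtain ⟨x, hx, hx'⟩ := hp
    exact ⟨c • x, by rw [smul_assoc, ← hx]; rfl, by rw [map_smul, map_smul, hx']⟩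

section Sandwich

variable {P} (hscal : ∀ i, 0 < P.scal i)
include hscal

theorem uGen_inr_commute (i j : Fin d) :
    Commute (P.uGen (Sum.inr i)) (P.uGen (Sum.inr j)) := by
  have hij : ⁅P.gen (Sum.inr i), P.gen (Sum.inr j)⁆ = 0 :=
    Subtype.ext <| Derivation.ext fun q => sub_eq_zero.mpr (dX_comm hscal i j q)
  have h := congrArg (UniversalEnvelopingAlgebra.ι ℝ) hij
  rwa [LieHom.map_lie, LieRing.of_associative_ring_bracket, map_zero, sub_eq_zero] at h

theorem zDLinear_mul_uGen_inr (i : Fin d) {n : NVec d} {π : CoordPoly d 𝔏}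
    (hπ : π ∈ P.coeffSpan n) (hi : P.dX i π ∈ P.coeffSpan n) :
    P.zDLinear n π * P.uGen (Sum.inr i) = P.uGen (Sum.inr i) * P.zDLinear n π -
      P.zDLinear n (P.dX i π) + (n i : ℝ) • P.zDLinear (n - single i 1) π := by
  obtain ⟨x, hx, hxι⟩ := P.exists_zDLinear_eq_ι hπ
  obtain ⟨y, hy, hyι⟩ := P.exists_zDLinear_eq_ι hi
  obtain ⟨w, hw, hwι⟩ := P.exists_zDLinear_eq_ι
    (P.coeffSpan_anti (P.scaledDeg_tsub_le hscal n (single i 1)) hπ)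
  have hlie : ⁅x, P.gen (Sum.inr i)⁆ = (n i : ℝ) • w - y := by
    refine Subtype.ext (Derivation.ext fun q => ?_)
    rw [LieSubalgebra.coe_bracket, AddSubgroupClass.coe_sub, Derivation.commutator_apply,
      Derivation.sub_apply, SetLike.val_smul, Derivation.smul_apply, hy, hw, hx]
    change π * P.dN n (P.dX i q) - P.dX i (π * P.dN n q) =
      (n i : ℝ) • (π * P.dN (n - single i 1) q) - P.dX i π * P.dN n q
    rw [dN_dX hscal, Derivation.leibniz, smul_eq_mul, smul_eq_mul, mul_add, mul_smul_comm]
    ring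
  have h : ιU x * P.uGen (Sum.inr i) - P.uGen (Sum.inr i) * ιU x = (n i : ℝ) • ιU w - ιU y := by
    rw [← map_smul, ← map_sub, ← hlie, LieHom.map_lie]
    rfl
  rw [hxι, hyι, hwι, sub_eq_iff_eq_add.mp h]
  abel

variable (hsol : ∀ i, P.regSol ≤ P.scal i)
include hsol

theorem rho_mem_modelSpan (u : P.UPlus) : ∀ q ∈ P.modelSpan, P.rho u q ∈ P.modelSpan :=
  P.rho_mem_of_LPlus_apply_mem (LPlus_apply_mem_modelSpan hscal hsol) u

theorem rho_sandwichLin (U : P.UPlus) {n : NVec d} : ∀ π ∈ P.coeffSpan n, ∀ q,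
    P.rho (P.sandwichLin n π U) q = π * P.rho U (P.dN n q) := by
  induction U using enveloping_induction with
  | one =>
    intro π hπ q
    obtain ⟨x, hx, hxι⟩ := P.exists_zDLinear_eq_ι hπ
    rw [sandwichLin_one, hxι, rho_ι_apply, hx, map_one, Module.End.one_apply]
    rfl
  | add u v hu hv =>
    intro π hπ q
    simp only [map_add, LinearMap.add_apply, hu π hπ, hv π hπ, mul_add]
  | smul c u hu =>
    intro π hπ q
    simp only [map_smul, LinearMap.smul_apply, hu π hπ, mul_smul_comm]
  | ι_mul x u hu =>
    intro π hπ q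
    rw [sandwichLin_ι_mul, map_sub, LinearMap.sub_apply, rho_ι_mul_apply, hu π hπ,
      hu _ (LPlus_apply_mem_coeffSpan hscal hsol x n π hπ), rho_ι_mul_apply, Derivation.leibniz,
      smul_eq_mul, smul_eq_mul, mul_comm (x.1 π), add_sub_cancel_right]

theorem sandwichLin_zDLinear_comm {n n' : NVec d} {π π' : CoordPoly d 𝔏}
    (hπ : π ∈ P.coeffSpan n) (hπ' : π' ∈ P.coeffSpan n') :
    P.sandwichLin n' π' (P.zDLinear n π) = P.sandwichLin n π (P.zDLinear n' π') := by
  obtain ⟨x, hx, hxι⟩ := P.exists_zDLinear_eq_ι hπ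
  obtain ⟨x', hx', hxι'⟩ := P.exists_zDLinear_eq_ι hπ'
  obtain ⟨y, hy, hyι⟩ :=
    P.exists_zDLinear_eq_ι (LPlus_apply_mem_coeffSpan hscal hsol x n' π' hπ')
  obtain ⟨y', hy', hyι'⟩ :=
    P.exists_zDLinear_eq_ι (LPlus_apply_mem_coeffSpan hscal hsol x' n π hπ)
  have hlie : ⁅x, x'⁆ = y - y' := by
    refine Subtype.ext (Derivation.ext fun q => ?_)
    rw [LieSubalgebra.coe_bracket, AddSubgroupClass.coe_sub, Derivation.commutator_apply,
      Derivation.sub_apply, hy, hy', hx, hx']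
    simp only [Derivation.smul_apply, Derivation.leibniz, smul_eq_mul]
    rw [P.dN_comm n' n]
    ring
  rw [hxι, hxι', sandwichLin_ι, sandwichLin_ι, hxι, hxι', hyι, hyι', sub_eq_sub_iff_sub_eq_sub,
    ← LieRing.of_associative_ring_bracket, ← LieHom.map_lie, hlie, map_sub]

theorem sandwichLin_comm (U : P.UPlus) {n n' : NVec d} :
    ∀ π ∈ P.coeffSpan n, ∀ π' ∈ P.coeffSpan n',
      P.sandwichLin n' π' (P.sandwichLin n π U) = P.sandwichLin n π (P.sandwichLin n' π' U) := by
  induction U using enveloping_induction with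
  | one =>
    intro π hπ π' hπ'
    rw [sandwichLin_one, sandwichLin_one, sandwichLin_zDLinear_comm hscal hsol hπ hπ']
  | add u v hu hv =>
    intro π hπ π' hπ'
    simp only [map_add, hu π hπ π' hπ', hv π hπ π' hπ']
  | smul c u hu =>
    intro π hπ π' hπ'
    simp only [map_smul, hu π hπ π' hπ']
  | ι_mul x u hu =>
    intro π hπ π' hπ'
    simp only [sandwichLin_ι_mul, map_sub]
    rw [hu π hπ π' hπ', hu π hπ _ (LPlus_apply_mem_coeffSpan hscal hsol x n' π' hπ'),
      hu _ (LPlus_apply_mem_coeffSpan hscal hsol x n π hπ) π' hπ']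
    abel

theorem sandwich_comm (p p' : P.MPlus) (U : P.UPlus) :
    P.sandwich p (P.sandwich p' U) = P.sandwich p' (P.sandwich p U) :=
  sandwichLin_comm hscal hsol U _ (P.monomial_mem_coeffSpan p') _ (P.monomial_mem_coeffSpan p)

theorem envelopingComul_sandwichLin (U : P.UPlus) {n : NVec d} : ∀ π ∈ P.coeffSpan n,
    envelopingComul (P.sandwichLin n π U) =
      (P.sandwichLin n π).rTensor P.UPlus (envelopingComul U) +
        (P.sandwichLin n π).lTensor P.UPlus (envelopingComul U) := by
  induction U using enveloping_induction with
  | one =>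
    intro π hπ
    obtain ⟨x, -, hxι⟩ := P.exists_zDLinear_eq_ι hπ
    rw [map_one envelopingComul, Algebra.TensorProduct.one_def, LinearMap.rTensor_tmul,
      LinearMap.lTensor_tmul, sandwichLin_one, hxι, envelopingComul_ι]
  | add u v hu hv =>
    intro π hπ
    simp only [map_add, hu π hπ, hv π hπ]
    abel
  | smul c u hu =>
    intro π hπ
    simp only [map_smul, hu π hπ, smul_add]
  | ι_mul x u hu =>
    intro π hπ
    rw [sandwichLin_ι_mul, map_sub, map_mul, map_mul, envelopingComul_ι,
      rTensor_primitive_mul (P.sandwichLin_ι_mul n π x),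
      lTensor_primitive_mul (P.sandwichLin_ι_mul n π x), hu π hπ,
      hu _ (LPlus_apply_mem_coeffSpan hscal hsol x n π hπ), mul_add]
    abel

end Sandwich

end RegParams

end

noncomputable section

/-! ### Divided powers -/

section DividedPowers

open Finset.HasAntidiagonal (antidiagonal mem_antidiagonal)
open Finsupp (single)

theorem prod_ofFn_pow_add_single {M : Type*} [Monoid M] {d : ℕ} {x : Fin d → M}
    (hx : ∀ i j, Commute (x i) (x j)) (k : Fin d → ℕ) (i : Fin d) :
    (List.ofFn fun j => x j ^ (k + Pi.single i 1 : Fin d → ℕ) j).prod =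
      x i * (List.ofFn fun j => x j ^ k j).prod := by
  induction d with
  | zero => exact i.elim0
  | succ d ih =>
    rw [List.ofFn_succ, List.ofFn_succ, List.prod_cons, List.prod_cons]
    cases i using Fin.cases with
    | zero => simp [pow_succ', mul_assoc]
    | succ i =>
      have hi : ∀ j : Fin d, (k + Pi.single i.succ 1 : Fin (d + 1) → ℕ) j.succ =
          ((fun j => k j.succ) + Pi.single i 1 : Fin d → ℕ) j := fun j => by
        simp [Pi.single_apply]
      simp only [hi]
      rw [ih (fun a b => hx a.succ b.succ), ← mul_assoc, ← mul_assoc]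
      simp [((hx 0 i.succ).pow_left _).eq]

variable {σ : Type*}

theorem prod_factorial_add_single (K : σ →₀ ℕ) (g : σ) :
    ((K + single g 1).prod fun _ j => j.factorial) =
      (K g + 1) * K.prod fun _ j => j.factorial := by
  classical
  rw [← Finsupp.mul_prod_erase' (K + single g 1) g _ (fun _ => Nat.factorial_zero),
    ← Finsupp.mul_prod_erase' K g _ (fun _ => Nat.factorial_zero), Finsupp.erase_add,
    Finsupp.erase_single, add_zero, Finsupp.add_apply, Finsupp.single_eq_same,
    Nat.factorial_succ, mul_assoc]

theorem exists_eq_add_single {K : σ →₀ ℕ} {g : σ} (hg : K g ≠ 0) :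
    ∃ K' : σ →₀ ℕ, K = K' + single g 1 :=
  ⟨K - single g 1, (tsub_add_cancel_of_le
    (Finsupp.single_le_iff.mpr (Nat.one_le_iff_ne_zero.mpr hg))).symm⟩

@[elab_as_elim]
theorem finsupp_sum_induction {α β : Type*} {motive : (α ⊕ β →₀ ℕ) → Prop} (zero : motive 0)
    (inr : ∀ K i, (∀ p, K (Sum.inl p) = 0) → motive K → motive (K + single (Sum.inr i) 1))
    (inl : ∀ K p, motive K → motive (K + single (Sum.inl p) 1)) (K : α ⊕ β →₀ ℕ) :
    motive K := by
  induction hN : K.degree using Nat.strong_induction_on generalizing K with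
  | _ N ih =>
    by_cases h : ∃ p, K (Sum.inl p) ≠ 0
    · obtain ⟨p, hp⟩ := h
      obtain ⟨K, rfl⟩ := exists_eq_add_single hp
      rw [map_add, Finsupp.degree_single] at hN
      exact inl K p (ih _ (by lia) K rfl)
    push Not at h
    by_cases h' : ∃ i, K (Sum.inr i) ≠ 0
    · obtain ⟨i, hi⟩ := h'
      obtain ⟨K, rfl⟩ := exists_eq_add_single hi
      rw [map_add, Finsupp.degree_single] at hN
      exact inr K i (fun p => by simpa using h p) (ih _ (by lia) K rfl)
    push Not at h'
    rwa [show K = 0 from Finsupp.ext (Sum.rec h h')]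

variable [DecidableEq σ]

theorem sum_antidiagonal_add_single {V : Type*} [AddCommMonoid V] (K : σ →₀ ℕ) (g : σ)
    (F : (σ →₀ ℕ) → (σ →₀ ℕ) → V) :
    ∑ q ∈ antidiagonal (K + single g 1), (q.1 : σ →₀ ℕ) g • F q.1 q.2 =
      ∑ q ∈ antidiagonal K, (q.1 g + 1) • F (q.1 + single g 1) q.2 := by
  let e : (σ →₀ ℕ) × (σ →₀ ℕ) ↪ (σ →₀ ℕ) × (σ →₀ ℕ) :=
    (addRightEmbedding (single g 1)).prodMap (.refl _)
  trans ∑ q ∈ (antidiagonal K).map e, q.1 g • F q.1 q.2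
  · refine (Finset.sum_subset ?_ ?_).symm
    · intro q hq
      obtain ⟨p, hp, rfl⟩ := Finset.mem_map.mp hq
      rw [mem_antidiagonal] at hp ⊢
      rw [← hp]
      exact add_right_comm _ _ _
    · rintro ⟨A, B⟩ hq hn
      suffices A g = 0 by rw [this, zero_smul]
      by_contra hA
      obtain ⟨A, rfl⟩ := exists_eq_add_single hA
      rw [mem_antidiagonal, add_right_comm, add_left_inj] at hq
      exact hn (Finset.mem_map.mpr ⟨(A, B), mem_antidiagonal.mpr hq, rfl⟩)
  · rw [Finset.sum_map]
    refine Finset.sum_congr rfl fun q _ => ?_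
    change (q.1 + single g 1 : σ →₀ ℕ) g • F (q.1 + single g 1) q.2 = _
    rw [Finsupp.add_apply, Finsupp.single_eq_same]

theorem smul_sum_antidiagonal_add_single {V : Type*} [AddCommMonoid V] (K : σ →₀ ℕ) (g : σ)
    (F : (σ →₀ ℕ) → (σ →₀ ℕ) → V) :
    (K g + 1) • ∑ q ∈ antidiagonal (K + single g 1), F q.1 q.2 =
      ∑ q ∈ antidiagonal K, ((q.1 g + 1) • F (q.1 + single g 1) q.2 +
        (q.2 g + 1) • F q.1 (q.2 + single g 1)) := by
  have hsplit : ∀ q ∈ antidiagonal (K + single g 1),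
      (K g + 1) • F q.1 q.2 = q.1 g • F q.1 q.2 + q.2 g • F q.1 q.2 := fun q hq => by
    have h := DFunLike.congr_fun (mem_antidiagonal.mp hq) g
    rw [Finsupp.add_apply, Finsupp.add_apply, Finsupp.single_eq_same] at h
    rw [← add_smul, h]
  rw [Finset.smul_sum, Finset.sum_congr rfl hsplit, Finset.sum_add_distrib,
    Finset.sum_add_distrib, sum_antidiagonal_add_single,
    Finsupp.sum_antidiagonal_swap _ fun A B => B g • F A B,
    Finsupp.sum_antidiagonal_swap _ fun A B => (B g + 1) • F A (B + single g 1)]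
  exact congrArg₂ _ rfl (sum_antidiagonal_add_single K g fun A B => F B A)

open TensorProduct in
theorem comul_dividedPower_step {R A : Type*} [Field R] [CharZero R] [AddCommGroup A] [Module R A]
    {Δ : A →ₗ[R] A ⊗[R] A} {T : A →ₗ[R] A} {b : (σ →₀ ℕ) → A} {g : σ} {K : σ →₀ ℕ}
    (hT : Δ (T (b K)) = T.rTensor A (Δ (b K)) + T.lTensor A (Δ (b K)))
    (hb : ∀ k ≤ K, (k g + 1) • b (k + single g 1) = T (b k))
    (hK : Δ (b K) = ∑ q ∈ antidiagonal K, b q.1 ⊗ₜ[R] b q.2) :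
    Δ (b (K + single g 1)) = ∑ q ∈ antidiagonal (K + single g 1), b q.1 ⊗ₜ[R] b q.2 := by
  have : IsAddTorsionFree (A ⊗[R] A) := .of_isTorsionFree R _
  refine nsmul_right_injective (Nat.succ_ne_zero (K g)) ?_
  change (K g + 1) • _ = (K g + 1) • _
  rw [smul_sum_antidiagonal_add_single K g fun k l => b k ⊗ₜ[R] b l, ← map_nsmul, hb K le_rfl, hT,
    hK, map_sum, map_sum, ← Finset.sum_add_distrib]
  refine Finset.sum_congr rfl fun q hq => ?_
  have hq := mem_antidiagonal.mp hq
  rw [LinearMap.rTensor_tmul, LinearMap.lTensor_tmul, ← hb _ (hq ▸ le_self_add),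
    ← hb _ (hq ▸ le_add_self), TensorProduct.smul_tmul', TensorProduct.tmul_smul]

end DividedPowers

namespace RegParams

variable {d : ℕ} {𝔏 : Type*} (P : RegParams d 𝔏)

open MvPolynomial
open Finset.HasAntidiagonal (antidiagonal)
open Finsupp (single)

/-- The elements `𝖣_{(J,𝐦)}` of `U(L⁺)`, for one choice of enumeration of `J`. -/
def dividedD (K : P.PlusIdx) : P.UPlus := P.sfD K (P.jPart K).toList

theorem jPart_add_inl (K : P.PlusIdx) (p : P.MPlus) :
    P.jPart (K + single (Sum.inl p) 1) = p ::ₘ P.jPart K := by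
  rw [jPart, Finsupp.comapDomain_add_of_injective Sum.inl_injective, map_add,
    Finsupp.comapDomain_single, Finsupp.toMultiset_single, one_smul, add_comm,
    Multiset.singleton_add]
  rfl

theorem jPart_eq_zero {K : P.PlusIdx} (hK : ∀ p, K (Sum.inl p) = 0) : P.jPart K = 0 := by
  rw [jPart, show K.comapDomain Sum.inl Sum.inl_injective.injOn = 0 from Finsupp.ext hK, map_zero]

theorem dividedD_zero : P.dividedD 0 = 1 := by
  simp [dividedD, P.jPart_eq_zero, sfD, dXPow]

theorem smul_sfD_add_single (K : P.PlusIdx) (g : P.PlusGen) (l : List P.MPlus) :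
    (K g + 1) • P.sfD (K + single g 1) l =
      (K.prod fun _ j => (j.factorial : ℝ))⁻¹ •
        l.foldr P.sandwich (P.dXPow (K + single g 1)) := by
  have hfact := congrArg (Nat.cast : ℕ → ℝ) (prod_factorial_add_single K g)
  rw [Nat.cast_mul, Finsupp.prod, Finsupp.prod, Nat.cast_prod, Nat.cast_prod] at hfact
  rw [sfD, Finsupp.prod, hfact, ← Nat.cast_smul_eq_nsmul ℝ, smul_smul, mul_inv,
    mul_inv_cancel_left₀ (Nat.cast_ne_zero.mpr (Nat.succ_ne_zero (K g)))]
  rfl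

variable {P}

section Family

variable (hscal : ∀ i, 0 < P.scal i)
include hscal

theorem smul_dividedD_add_inr {K : P.PlusIdx} (hK : ∀ p, K (Sum.inl p) = 0) (i : Fin d) :
    (K (Sum.inr i) + 1) • P.dividedD (K + single (Sum.inr i) 1) =
      P.uGen (Sum.inr i) * P.dividedD K := by
  have hX : P.dXPow (K + single (Sum.inr i) 1) = P.uGen (Sum.inr i) * P.dXPow K := by
    classical
    rw [dXPow, dXPow, ← prod_ofFn_pow_add_single (uGen_inr_commute hscal)]
    refine congrArg List.prod (congrArg List.ofFn (funext fun j => congrArg _ ?_))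
    simp [Finsupp.single_apply, Pi.single_apply, eq_comm]
  rw [dividedD, smul_sfD_add_single, hX, P.jPart_eq_zero (by simpa using hK), dividedD, sfD,
    P.jPart_eq_zero hK, Multiset.toList_zero, List.foldr_nil, List.foldr_nil, mul_smul_comm]

theorem dividedD_add_inr {K : P.PlusIdx} (hK : ∀ p, K (Sum.inl p) = 0) (i : Fin d) :
    P.dividedD (K + single (Sum.inr i) 1) =
      ((K (Sum.inr i) + 1 : ℕ) : ℝ)⁻¹ • (P.uGen (Sum.inr i) * P.dividedD K) := by
  rw [← smul_dividedD_add_inr hscal hK, ← Nat.cast_smul_eq_nsmul ℝ, inv_smul_smul₀]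
  exact Nat.cast_ne_zero.mpr (Nat.succ_ne_zero _)

variable (hsol : ∀ i, P.regSol ≤ P.scal i)
include hsol

theorem foldr_sandwich_perm {l l' : List P.MPlus} (h : l.Perm l') (U : P.UPlus) :
    l.foldr P.sandwich U = l'.foldr P.sandwich U :=
  haveI : LeftCommutative P.sandwich := ⟨sandwich_comm hscal hsol⟩
  h.foldr_eq U

theorem dividedD_eq_sfD {K : P.PlusIdx} {l : List P.MPlus}
    (h : (l : Multiset P.MPlus) = P.jPart K) : P.dividedD K = P.sfD K l := by
  rw [dividedD, sfD, sfD, foldr_sandwich_perm hscal hsol (l' := l)]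
  rw [← Multiset.coe_eq_coe, Multiset.coe_toList, h]

theorem smul_dividedD_add_inl (K : P.PlusIdx) (p : P.MPlus) :
    (K (Sum.inl p) + 1) • P.dividedD (K + single (Sum.inl p) 1) =
      P.sandwichLin p.1.2 (monomial p.1.1 1) (P.dividedD K) := by
  have hX : P.dXPow (K + single (Sum.inl p) 1) = P.dXPow K := by simp [dXPow]
  rw [dividedD_eq_sfD hscal hsol (l := p :: (P.jPart K).toList)
    (by rw [jPart_add_inl, ← Multiset.cons_coe, Multiset.coe_toList]), smul_sfD_add_single, hX,
    List.foldr_cons, dividedD, sfD, map_smul, sandwich_eq_sandwichLin]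

theorem dividedD_add_inl (K : P.PlusIdx) (p : P.MPlus) :
    P.dividedD (K + single (Sum.inl p) 1) = ((K (Sum.inl p) + 1 : ℕ) : ℝ)⁻¹ •
      P.sandwichLin p.1.2 (monomial p.1.1 1) (P.dividedD K) := by
  rw [← smul_dividedD_add_inl hscal hsol, ← Nat.cast_smul_eq_nsmul ℝ, inv_smul_smul₀]
  exact Nat.cast_ne_zero.mpr (Nat.succ_ne_zero _)

theorem envelopingComul_dividedD [DecidableEq P.PlusGen] (K : P.PlusIdx) :
    envelopingComul (P.dividedD K) =
      ∑ q ∈ antidiagonal K, P.dividedD q.1 ⊗ₜ[ℝ] P.dividedD q.2 := by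
  induction K using finsupp_sum_induction with
  | zero =>
    rw [dividedD_zero, map_one envelopingComul, Finsupp.antidiagonal_zero, Finset.sum_singleton,
      dividedD_zero, Algebra.TensorProduct.one_def]
  | inr K i hK ih =>
    refine comul_dividedPower_step (Δ := envelopingComul.toLinearMap)
      (T := LinearMap.mulLeft ℝ (P.uGen (Sum.inr i))) ?_
      (fun k hk => smul_dividedD_add_inr hscal (fun p => Nat.le_zero.mp (hK p ▸ hk _)) i) ih
    rw [LinearMap.rTensor, LinearMap.lTensor, ← LinearMap.mulLeft_one ℝ, ← LinearMap.mulLeft_tmul,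
      ← LinearMap.mulLeft_tmul, LinearMap.mulLeft_apply, LinearMap.mulLeft_apply,
      LinearMap.mulLeft_apply, AlgHom.toLinearMap_apply, AlgHom.toLinearMap_apply, map_mul, uGen,
      envelopingComul_ι, add_mul]
  | inl K p ih =>
    exact comul_dividedPower_step (Δ := envelopingComul.toLinearMap)
      (envelopingComul_sandwichLin hscal hsol _ _ (P.monomial_mem_coeffSpan p))
      (fun k _ => smul_dividedD_add_inl hscal hsol k p) ih

end Family

end RegParams

end

noncomputable section

/-! ### The divided powers form a basis -/

section DividedPowerIndependence

open Finset.HasAntidiagonal (antidiagonal mem_antidiagonal)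
open Finsupp (single)

theorem add_single_one_eq_single_one_iff {σ : Type*} {K : σ →₀ ℕ} {g h : σ} :
    K + single g 1 = single h 1 ↔ K = 0 ∧ g = h := by
  refine ⟨fun hK => ?_, by rintro ⟨rfl, rfl⟩; exact zero_add _⟩
  have hdeg := congrArg Finsupp.degree hK
  rw [map_add, Finsupp.degree_single, Finsupp.degree_single, Nat.add_eq_right,
    Finsupp.degree_eq_zero_iff] at hdeg
  rw [hdeg, zero_add] at hK
  exact ⟨hdeg, Finsupp.single_left_injective one_ne_zero hK⟩

theorem prod_choose_add_single {ι : Type*} [Fintype ι] (n m : ι →₀ ℕ) (i : ι) :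
    (m i + 1) * ∏ j, (n j + (m + single i 1 : ι →₀ ℕ) j).choose (n j) =
      (n i + m i + 1) * ∏ j, (n j + m j).choose (n j) := by
  classical
  have hne : ∀ j ∈ Finset.univ.erase i, (n j + (m + single i 1 : ι →₀ ℕ) j).choose (n j) =
      (n j + m j).choose (n j) := fun j hj => by
    rw [Finsupp.add_apply, Finsupp.single_eq_of_ne (Finset.ne_of_mem_erase hj), add_zero]
  rw [← Finset.mul_prod_erase _ _ (Finset.mem_univ i), Finset.prod_congr rfl hne,
    ← Finset.mul_prod_erase _ (fun j => (n j + m j).choose (n j)) (Finset.mem_univ i), ← mul_assoc,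
    ← mul_assoc, Finsupp.add_apply, Finsupp.single_eq_same, Nat.choose_symm_add,
    Nat.choose_symm_add, ← add_assoc, Nat.add_one_mul_choose_eq, mul_comm (m i + 1)]

variable {R A σ : Type*} [CommRing R] [AddCommGroup A] [Module R A] [DecidableEq σ]
  {Δ : A →ₗ[R] A ⊗[R] A} {b : (σ →₀ ℕ) → A}

open Classical in
theorem exists_dual_dividedPower_add
    (hΔ : ∀ K, Δ (b K) = ∑ q ∈ antidiagonal K, b q.1 ⊗ₜ[R] b q.2) {K L : σ →₀ ℕ}
    (hK : ∃ φ : A →ₗ[R] R, ∀ M, φ (b M) = if M = K then 1 else 0)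
    (hL : ∃ φ : A →ₗ[R] R, ∀ M, φ (b M) = if M = L then 1 else 0) :
    ∃ φ : A →ₗ[R] R, ∀ M, φ (b M) = if M = K + L then 1 else 0 := by
  obtain ⟨φ, hφ⟩ := hK
  obtain ⟨ψ, hψ⟩ := hL
  refine ⟨LinearMap.mul' R R ∘ₗ TensorProduct.map φ ψ ∘ₗ Δ, fun M => ?_⟩
  have hterm : ∀ q : (σ →₀ ℕ) × (σ →₀ ℕ), LinearMap.mul' R R
      (TensorProduct.map φ ψ (b q.1 ⊗ₜ[R] b q.2)) = if q = (K, L) then 1 else 0 := fun q => by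
    rw [TensorProduct.map_tmul, LinearMap.mul'_apply, hφ, hψ]
    by_cases h₁ : q.1 = K <;> by_cases h₂ : q.2 = L <;> simp [Prod.ext_iff, h₁, h₂]
  rw [LinearMap.comp_apply, LinearMap.comp_apply, hΔ, map_sum, map_sum,
    Finset.sum_congr rfl fun q _ => hterm q, Finset.sum_ite_eq']
  simp only [mem_antidiagonal, eq_comm]

open Classical in
theorem exists_dual_dividedPower
    (hΔ : ∀ K, Δ (b K) = ∑ q ∈ antidiagonal K, b q.1 ⊗ₜ[R] b q.2)
    (hzero : ∃ φ : A →ₗ[R] R, ∀ M, φ (b M) = if M = 0 then 1 else 0)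
    (hone : ∀ g, ∃ φ : A →ₗ[R] R, ∀ M, φ (b M) = if M = single g 1 then 1 else 0) (K : σ →₀ ℕ) :
    ∃ φ : A →ₗ[R] R, ∀ M, φ (b M) = if M = K then 1 else 0 := by
  induction K using Finsupp.induction_linear with
  | zero => exact hzero
  | add K L hK hL => exact exists_dual_dividedPower_add hΔ hK hL
  | single g n =>
    induction n with
    | zero => rwa [Finsupp.single_zero]
    | succ n ih =>
      rw [Finsupp.single_add]
      exact exists_dual_dividedPower_add hΔ ih (hone g)

open Classical in
/-- Convolving functionals dual to `1` and to the primitive elements `b_{e_g}` produces the whole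
dual family. -/
theorem linearIndependent_dividedPower
    (hΔ : ∀ K, Δ (b K) = ∑ q ∈ antidiagonal K, b q.1 ⊗ₜ[R] b q.2)
    (hzero : ∃ φ : A →ₗ[R] R, ∀ M, φ (b M) = if M = 0 then 1 else 0)
    (hone : ∀ g, ∃ φ : A →ₗ[R] R, ∀ M, φ (b M) = if M = single g 1 then 1 else 0) :
    LinearIndependent R b := by
  choose φ hφ using exists_dual_dividedPower hΔ hzero hone
  exact .of_pairwise_dual_eq_zero_one _ φ (fun K L h => (hφ K L).trans (if_neg h.symm))
    fun K => (hφ K K).trans (if_pos rfl)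

end DividedPowerIndependence

section LieSpan

open UniversalEnvelopingAlgebra (ι)

attribute [local instance] LieRing.ofAssociativeRing

variable {R L : Type*} [CommRing R] [LieRing L] [LieAlgebra R L] {S : Set L}
  {W : Submodule R (UniversalEnvelopingAlgebra R L)}

theorem ι_mul_mem_of_mem_lieSpan (hS : ∀ g ∈ S, ∀ u ∈ W, ι R g * u ∈ W) {x : L}
    (hx : x ∈ LieSubalgebra.lieSpan R L S) : ∀ u ∈ W, ι R x * u ∈ W := by
  induction hx using LieSubalgebra.lieSpan_induction with
  | mem x hx => exact hS x hx
  | zero =>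
    intro u _
    rw [map_zero, zero_mul]
    exact W.zero_mem
  | add x y _ _ ihx ihy =>
    intro u hu
    rw [map_add, add_mul]
    exact W.add_mem (ihx u hu) (ihy u hu)
  | smul c x _ ih =>
    intro u hu
    rw [map_smul, smul_mul_assoc]
    exact W.smul_mem c (ih u hu)
  | lie x y _ _ ihx ihy =>
    intro u hu
    rw [LieHom.map_lie, LieRing.of_associative_ring_bracket, sub_mul, mul_assoc, mul_assoc]
    exact W.sub_mem (ihx _ (ihy u hu)) (ihy _ (ihx u hu))

theorem enveloping_submodule_eq_top (hL : LieSubalgebra.lieSpan R L S = ⊤) (one : 1 ∈ W)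
    (hS : ∀ g ∈ S, ∀ u ∈ W, ι R g * u ∈ W) : W = ⊤ := by
  refine eq_top_iff.mpr fun u _ => ?_
  induction u using enveloping_induction with
  | one => exact one
  | add u v hu hv => exact W.add_mem (hu trivial) (hv trivial)
  | smul c u hu => exact W.smul_mem c (hu trivial)
  | ι_mul x u hu =>
    exact ι_mul_mem_of_mem_lieSpan hS (hL ▸ LieSubalgebra.mem_top x) u (hu trivial)

end LieSpan

theorem map_mem_of_mem_span_range {R M N ι : Type*} [Semiring R] [AddCommMonoid M]
    [AddCommMonoid N] [Module R M] [Module R N] {b : ι → M} {f : M →ₗ[R] N} {W : Submodule R N}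
    (h : ∀ i, f (b i) ∈ W) : ∀ u ∈ Submodule.span R (Set.range b), f u ∈ W :=
  fun _ hu => (Submodule.span_le (p := W.comap f)).mpr (Set.range_subset_iff.mpr h) hu

namespace RegParams

variable {d : ℕ} {𝔏 : Type*} {P : RegParams d 𝔏}

open MvPolynomial
open Finset.HasAntidiagonal (antidiagonal)
open Finsupp (single)

section Span

variable (P) in
theorem lieSpan_range_gen : LieSubalgebra.lieSpan ℝ P.LPlus (Set.range P.gen) = ⊤ := by
  have h : P.LPlus ≤ (LieSubalgebra.lieSpan ℝ P.LPlus (Set.range P.gen)).map P.LPlus.incl :=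
    LieSubalgebra.lieSpan_le.mpr <| Set.range_subset_iff.mpr fun g =>
      ⟨P.gen g, LieSubalgebra.subset_lieSpan (Set.mem_range_self g), rfl⟩
  refine eq_top_iff.mpr fun x _ => ?_
  obtain ⟨y, hy, hyx⟩ := h x.2
  exact Subtype.ext hyx ▸ hy

variable (hscal : ∀ i, 0 < P.scal i) (hsol : ∀ i, P.regSol ≤ P.scal i)
include hscal hsol

theorem sandwichLin_mem_span_dividedD {n : NVec d} {π : CoordPoly d 𝔏} (hπ : π ∈ P.coeffSpan n) :
    ∀ u ∈ Submodule.span ℝ (Set.range P.dividedD),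
      P.sandwichLin n π u ∈ Submodule.span ℝ (Set.range P.dividedD) := by
  refine map_mem_of_mem_span_range fun K => ?_
  suffices P.coeffSpan n ≤ Submodule.comap (P.homAction (P.dividedD K) (P.zDLinear n))
    (Submodule.span ℝ (Set.range P.dividedD)) from this hπ
  rw [coeffSpan, restrictSupport_eq_span, Submodule.span_le]
  rintro _ ⟨γ, hγ, rfl⟩
  have h := smul_dividedD_add_inl hscal hsol K ⟨(γ, n), hγ⟩
  change P.sandwichLin n (monomial γ 1) (P.dividedD K) ∈ Submodule.span ℝ (Set.range P.dividedD)
  exact h ▸ Submodule.smul_of_tower_mem _ _ (Submodule.subset_span (Set.mem_range_self _))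

theorem ι_mul_dividedD_add_inl_mem_span (x : P.LPlus) {K : P.PlusIdx} (p : P.MPlus)
    (h : UniversalEnvelopingAlgebra.ι ℝ x * P.dividedD K ∈
      Submodule.span ℝ (Set.range P.dividedD)) :
    UniversalEnvelopingAlgebra.ι ℝ x * P.dividedD (K + single (Sum.inl p) 1) ∈
      Submodule.span ℝ (Set.range P.dividedD) := by
  have hp := P.monomial_mem_coeffSpan p
  rw [dividedD_add_inl hscal hsol, mul_smul_comm,
    ← eq_sub_iff_add_eq.mp (P.sandwichLin_ι_mul p.1.2 (monomial p.1.1 1) x (P.dividedD K))]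
  refine Submodule.smul_mem _ _ (Submodule.add_mem _ ?_ ?_)
  · exact sandwichLin_mem_span_dividedD hscal hsol hp _ h
  · exact sandwichLin_mem_span_dividedD hscal hsol (LPlus_apply_mem_coeffSpan hscal hsol _ _ _ hp) _
      (Submodule.subset_span (Set.mem_range_self K))

theorem uGen_inr_mul_mem_span_dividedD (i : Fin d) :
    ∀ u ∈ Submodule.span ℝ (Set.range P.dividedD),
      P.uGen (Sum.inr i) * u ∈ Submodule.span ℝ (Set.range P.dividedD) := by
  suffices ∀ K, P.uGen (Sum.inr i) * P.dividedD K ∈ Submodule.span ℝ (Set.range P.dividedD) from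
    map_mem_of_mem_span_range (f := LinearMap.mulLeft ℝ (P.uGen (Sum.inr i))) this
  have hpure : ∀ K : P.PlusIdx, (∀ p, K (Sum.inl p) = 0) →
      P.uGen (Sum.inr i) * P.dividedD K ∈ Submodule.span ℝ (Set.range P.dividedD) := fun K hK =>
    smul_dividedD_add_inr hscal hK i ▸
      Submodule.smul_of_tower_mem _ _ (Submodule.subset_span (Set.mem_range_self _))
  intro K
  induction K using finsupp_sum_induction with
  | zero => exact hpure 0 fun _ => rfl
  | inr K j hK _ => exact hpure _ (by simpa using hK)
  | inl K p ih => exact ι_mul_dividedD_add_inl_mem_span hscal hsol _ p ih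

theorem zDLinear_mul_dividedD_mem_span (K : P.PlusIdx) : ∀ (n : NVec d), ∀ π ∈ P.coeffSpan n,
    P.zDLinear n π * P.dividedD K ∈ Submodule.span ℝ (Set.range P.dividedD) := by
  induction K using finsupp_sum_induction with
  | zero =>
    intro n π hπ
    rw [dividedD_zero, mul_one, ← sandwichLin_one, ← dividedD_zero]
    exact sandwichLin_mem_span_dividedD hscal hsol hπ _
      (Submodule.subset_span (Set.mem_range_self _))
  | inr K i hK ih =>
    intro n π hπ
    have hi : P.dX i π ∈ P.coeffSpan n :=
      LPlus_apply_mem_coeffSpan hscal hsol (P.gen (Sum.inr i)) n π hπ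
    have hle := P.scaledDeg_tsub_le hscal n (single i 1)
    rw [dividedD_add_inr hscal hK, mul_smul_comm, ← mul_assoc, zDLinear_mul_uGen_inr hscal i hπ hi,
      add_mul, sub_mul, mul_assoc, smul_mul_assoc]
    refine Submodule.smul_mem _ _ (Submodule.add_mem _ (Submodule.sub_mem _ ?_ (ih n _ hi)) ?_)
    · exact uGen_inr_mul_mem_span_dividedD hscal hsol i _ (ih n π hπ)
    · exact Submodule.smul_mem _ _ (ih _ π (P.coeffSpan_anti hle hπ))
  | inl K p ih =>
    intro n π hπ
    obtain ⟨x, -, hxι⟩ := P.exists_zDLinear_eq_ι hπ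
    have h := ih n π hπ
    rw [hxι] at h ⊢
    exact ι_mul_dividedD_add_inl_mem_span hscal hsol x p h

theorem span_dividedD : Submodule.span ℝ (Set.range P.dividedD) = ⊤ := by
  refine enveloping_submodule_eq_top P.lieSpan_range_gen
    (Submodule.subset_span ⟨0, P.dividedD_zero⟩) ?_
  rintro _ ⟨p | i, rfl⟩
  · refine map_mem_of_mem_span_range (f := LinearMap.mulLeft ℝ (P.uGen (Sum.inl p))) fun K => ?_
    rw [LinearMap.mulLeft_apply, ← sandwich_one, sandwich_eq_sandwichLin, sandwichLin_one]
    exact zDLinear_mul_dividedD_mem_span hscal hsol K _ _ (P.monomial_mem_coeffSpan p)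
  · exact uGen_inr_mul_mem_span_dividedD hscal hsol i

end Span

section Independence

variable (P) in
/-- The component `𝐦` of `K = (J,𝐦)`. -/
def polyPart (K : P.PlusIdx) : NVec d := K.comapDomain Sum.inr Sum.inr_injective.injOn

theorem polyPart_add_inr (K : P.PlusIdx) (i : Fin d) :
    P.polyPart (K + single (Sum.inr i) 1) = P.polyPart K + single i 1 := by
  rw [polyPart, Finsupp.comapDomain_add_of_injective Sum.inr_injective, Finsupp.comapDomain_single]
  rfl

theorem polyPart_eq_single_iff {K : P.PlusIdx} (hK : ∀ p, K (Sum.inl p) = 0) {i : Fin d} :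
    P.polyPart K = single i 1 ↔ K = single (Sum.inr i) 1 := by
  classical
  refine ⟨fun h => Finsupp.ext ?_, ?_⟩
  · rintro (p | j)
    · simpa [Finsupp.single_apply] using hK p
    · simpa [polyPart, Finsupp.single_apply] using DFunLike.congr_fun h j
  · rintro rfl
    exact Finsupp.comapDomain_single _ _ _ _

variable (hscal : ∀ i, 0 < P.scal i)
include hscal

theorem rho_dividedD_X_of_inl_eq_zero {K : P.PlusIdx} (hK : ∀ p, K (Sum.inl p) = 0) (n : NVec d) :
    P.rho (P.dividedD K) (X (Sum.inr n)) =
      (∏ j, (n j + P.polyPart K j).choose (n j)) • X (Sum.inr (n + P.polyPart K)) := by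
  induction K using finsupp_sum_induction with
  | zero =>
    rw [dividedD_zero, map_one, show P.polyPart 0 = 0 from Finsupp.ext fun _ => rfl]
    simp
  | inr K i hK' ih =>
    have hchoose := prod_choose_add_single n (P.polyPart K) i
    refine nsmul_right_injective (Nat.succ_ne_zero (K (Sum.inr i))) ?_
    change (K (Sum.inr i) + 1) • _ = (P.polyPart K i + 1) • _
    rw [polyPart_add_inr, smul_smul, hchoose, ← LinearMap.smul_apply, ← map_nsmul,
      smul_dividedD_add_inr hscal hK', uGen, rho_ι_mul_apply, ih hK', map_nsmul]
    change _ • P.dX i _ = _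
    rw [dX_X_inr hscal, ← add_assoc, mul_comm, mul_smul, ← Nat.cast_succ,
      Nat.cast_smul_eq_nsmul]
    rfl
  | inl K p _ => exact absurd (hK p) (by simp)

variable (hsol : ∀ i, P.regSol ≤ P.scal i)
include hsol

open Classical in
theorem envelopingCounit_dividedD (K : P.PlusIdx) :
    envelopingCounit (P.dividedD K) = if K = 0 then 1 else 0 := by
  induction K using finsupp_sum_induction with
  | zero => rw [dividedD_zero, map_one, if_pos rfl]
  | inr K i hK _ =>
    rw [dividedD_add_inr hscal hK, map_smul, map_mul, uGen, envelopingCounit_ι, zero_mul, smul_zero,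
      if_neg (by simp)]
  | inl K p _ =>
    have h : P.rho (P.dividedD (K + single (Sum.inl p) 1)) 1 = 0 := by
      rw [dividedD_add_inl hscal hsol, map_smul, LinearMap.smul_apply,
        rho_sandwichLin hscal hsol _ _ (P.monomial_mem_coeffSpan p), Derivation.map_one_eq_zero,
        map_zero, mul_zero, smul_zero]
    rw [rho_apply_one, C_eq_zero] at h
    rw [h, if_neg (by simp)]

open Classical in
theorem rho_dividedD_add_inl_X (K : P.PlusIdx) (p : P.MPlus) (n : NVec d) :
    P.rho (P.dividedD (K + single (Sum.inl p) 1)) (X (Sum.inr n)) =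
      if K = 0 ∧ n = p.1.2 then monomial p.1.1 1 else 0 := by
  rw [dividedD_add_inl hscal hsol, map_smul, LinearMap.smul_apply,
    rho_sandwichLin hscal hsol _ _ (P.monomial_mem_coeffSpan p), dN_X_inr]
  by_cases hn : n = p.1.2
  · rw [if_pos hn, rho_apply_one, envelopingCounit_dividedD hscal hsol]
    by_cases hK : K = 0
    · simp [hK, hn]
    · simp [hK]
  · simp [hn]

variable (P) in
omit hscal hsol in
/-- The multi-index `β` such that the generator `g` of `L⁺` is detected by the `z^β`-coefficient of
its action on the variable `z_𝐧`, `𝐧` being `genSource g`. -/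
def genTarget : P.PlusGen → CoordIdx d 𝔏 :=
  Sum.elim (fun p => p.1.1) fun i => single (Sum.inr (single i 1)) 1

variable (P) in
omit hscal hsol in
/-- The index `𝐧` of the variable on which the generator `g` of `L⁺` is detected. -/
def genSource : P.PlusGen → NVec d := Sum.elim (fun p => p.1.2) fun _ => 0

variable (P) in
omit hscal hsol in
/-- The functional on `U(L⁺)` reading off the coefficient of the generator `g`. -/
def genCoeff (g : P.PlusGen) : P.UPlus →ₗ[ℝ] ℝ :=
  lcoeff ℝ (P.genTarget g) ∘ₗ LinearMap.applyₗ (X (Sum.inr (P.genSource g))) ∘ₗ P.rho.toLinearMap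

omit hscal hsol in
theorem genCoeff_apply (g : P.PlusGen) (u : P.UPlus) :
    P.genCoeff g u = coeff (P.genTarget g) (P.rho u (X (Sum.inr (P.genSource g)))) := rfl

omit hscal hsol in
theorem ne_single_inr_of_mem_MPlus (p : P.MPlus) (m : NVec d) : p.1.1 ≠ single (Sum.inr m) 1 :=
  fun h => p.2.1.2.ne' (h ▸ noiseHom_inr m)

omit hsol in
open Classical in
theorem genCoeff_dividedD_of_inl_eq_zero (g : P.PlusGen) {K : P.PlusIdx}
    (hK : ∀ p, K (Sum.inl p) = 0) :
    P.genCoeff g (P.dividedD K) = if K = single g 1 then 1 else 0 := by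
  rw [genCoeff_apply, rho_dividedD_X_of_inl_eq_zero hscal hK, coeff_smul, coeff_X]
  rcases g with p | i
  · rw [if_neg fun h => ne_single_inr_of_mem_MPlus p _ h.symm, smul_zero, if_neg]
    rintro rfl
    simpa using hK p
  · simp [genSource, genTarget, polyPart_eq_single_iff hK,
      (Finsupp.single_left_injective (one_ne_zero (α := ℕ))).eq_iff]

open Classical in
theorem genCoeff_dividedD_add_inl (g : P.PlusGen) (K : P.PlusIdx) (p : P.MPlus) :
    P.genCoeff g (P.dividedD (K + single (Sum.inl p) 1)) =
      if K + single (Sum.inl p) 1 = single g 1 then 1 else 0 := by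
  simp only [genCoeff_apply, rho_dividedD_add_inl_X hscal hsol, add_single_one_eq_single_one_iff,
    apply_ite (coeff _), coeff_monomial, coeff_zero, ← ite_and, and_assoc]
  rcases g with p' | i
  · refine if_congr (and_congr_right fun _ => ?_) rfl rfl
    rw [Sum.inl_injective.eq_iff, Subtype.ext_iff, Prod.ext_iff, and_comm, eq_comm (b := p.1.2)]
    rfl
  · simp [genTarget, ne_single_inr_of_mem_MPlus]

open Classical in
theorem genCoeff_dividedD (g : P.PlusGen) (K : P.PlusIdx) :
    P.genCoeff g (P.dividedD K) = if K = single g 1 then 1 else 0 := by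
  by_cases hK : ∀ p, K (Sum.inl p) = 0
  · exact genCoeff_dividedD_of_inl_eq_zero hscal g hK
  · push Not at hK
    obtain ⟨p, hp⟩ := hK
    obtain ⟨K, rfl⟩ := exists_eq_add_single hp
    exact genCoeff_dividedD_add_inl hscal hsol g K p

theorem linearIndependent_dividedD : LinearIndependent ℝ P.dividedD := by
  classical
  exact linearIndependent_dividedPower (Δ := envelopingComul.toLinearMap)
    (envelopingComul_dividedD hscal hsol)
    ⟨envelopingCounit.toLinearMap, envelopingCounit_dividedD hscal hsol⟩
    fun g => ⟨P.genCoeff g, genCoeff_dividedD hscal hsol g⟩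

/-- The basis `𝖣_{(J,𝐦)}` of `U(L⁺)`. -/
def dBasis : Module.Basis P.PlusIdx ℝ P.UPlus :=
  .mk (linearIndependent_dividedD hscal hsol) (span_dividedD hscal hsol).ge

theorem dBasis_apply (K : P.PlusIdx) : dBasis hscal hsol K = P.dividedD K :=
  Module.Basis.mk_apply _ _ K

end Independence

end RegParams

end

noncomputable section

/-! ### Transposition with respect to pairings -/

section Transpose

variable {R U U' U'' V V' T T' T'' W W' : Type*} [CommSemiring R]
  [AddCommMonoid U] [Module R U] [AddCommMonoid U'] [Module R U'] [AddCommMonoid U''] [Module R U'']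
  [AddCommMonoid V] [Module R V] [AddCommMonoid V'] [Module R V']
  [AddCommMonoid T] [Module R T] [AddCommMonoid T'] [Module R T'] [AddCommMonoid T''] [Module R T'']
  [AddCommMonoid W] [Module R W] [AddCommMonoid W'] [Module R W']

/-- The tensor product of two pairings. -/
def tensorPairing (p : U →ₗ[R] T →ₗ[R] R) (p' : U' →ₗ[R] T' →ₗ[R] R) :
    U ⊗[R] U' →ₗ[R] T ⊗[R] T' →ₗ[R] R :=
  TensorProduct.dualDistrib R T T' ∘ₗ TensorProduct.map p p'

/-- The family `b` is dual to the basis `c` under the pairing `p`. -/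
def IsDualFamily {ι : Type*} (p : U →ₗ[R] T →ₗ[R] R) (b : ι → U) (c : Module.Basis ι R T) : Prop :=
  ∀ i, p (b i) = c.coord i

/-- The map `f` is the transpose of `g` with respect to the pairings `p` and `p'`. -/
def IsTranspose (p : U →ₗ[R] T →ₗ[R] R) (p' : V →ₗ[R] W →ₗ[R] R) (g : U →ₗ[R] V)
    (f : W →ₗ[R] T) : Prop :=
  ∀ u x, p u (f x) = p' (g u) x

variable {p : U →ₗ[R] T →ₗ[R] R} {p' : U' →ₗ[R] T' →ₗ[R] R} {p'' : U'' →ₗ[R] T'' →ₗ[R] R}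
  {q : V →ₗ[R] W →ₗ[R] R} {q' : V' →ₗ[R] W' →ₗ[R] R}

@[simp]
theorem tensorPairing_tmul (u : U) (u' : U') (x : T) (x' : T') :
    tensorPairing p p' (u ⊗ₜ[R] u') (x ⊗ₜ[R] x') = p u x * p' u' x' := by
  simp [tensorPairing]

theorem IsDualFamily.tensor {ι ι' : Type*} {b : ι → U} {c : Module.Basis ι R T} {b' : ι' → U'}
    {c' : Module.Basis ι' R T'} (h : IsDualFamily p b c) (h' : IsDualFamily p' b' c') :
    IsDualFamily (tensorPairing p p') (fun i : ι × ι' => b i.1 ⊗ₜ[R] b' i.2)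
      (c.tensorProduct c') := by
  rintro ⟨i, i'⟩
  refine TensorProduct.ext' fun x x' => ?_
  rw [tensorPairing_tmul, h i, h' i', Module.Basis.coord_apply, Module.Basis.coord_apply,
    Module.Basis.coord_apply, Module.Basis.tensorProduct_repr_tmul_apply, smul_eq_mul, mul_comm]

theorem IsDualFamily.tensorProduct {ι ι' : Type*} {b : Module.Basis ι R U} {c : Module.Basis ι R T}
    {b' : Module.Basis ι' R U'} {c' : Module.Basis ι' R T'} (h : IsDualFamily p b c)
    (h' : IsDualFamily p' b' c') :
    IsDualFamily (tensorPairing p p') (b.tensorProduct b') (c.tensorProduct c') :=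
  fun i => by rw [Module.Basis.tensorProduct_apply', h.tensor h' i]

theorem IsDualFamily.ext {ι : Type*} {b : ι → U} {c : Module.Basis ι R T} (h : IsDualFamily p b c)
    {x y : T} (hxy : ∀ i, p (b i) x = p (b i) y) : x = y :=
  c.ext_elem fun i => by simpa only [h i, Module.Basis.coord_apply] using hxy i

theorem tensorPairing_rTensor_tmul {g : U →ₗ[R] V} {a : T} {x : W}
    (h : ∀ u, p u a = q (g u) x) (t : U ⊗[R] U') (y : T') :
    tensorPairing q p' (g.rTensor U' t) (x ⊗ₜ[R] y) = tensorPairing p p' t (a ⊗ₜ[R] y) := by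
  induction t with
  | zero => simp only [map_zero, LinearMap.zero_apply]
  | add s t hs ht => simp only [map_add, LinearMap.add_apply, hs, ht]
  | tmul u v => rw [LinearMap.rTensor_tmul, tensorPairing_tmul, tensorPairing_tmul, h]

namespace IsTranspose

theorem id : IsTranspose p p .id .id := fun _ _ => rfl

theorem comp {g : U →ₗ[R] V} {f : W →ₗ[R] T} (h : IsTranspose p q g f) {g' : V →ₗ[R] V'}
    {f' : W' →ₗ[R] W} (h' : IsTranspose q q' g' f') :
    IsTranspose p q' (g' ∘ₗ g) (f ∘ₗ f') :=
  fun u x => (h u (f' x)).trans (h' (g u) x)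

theorem of_compl₂_eq {g : U →ₗ[R] V} {f : W →ₗ[R] T} (h : p.compl₂ f = q ∘ₗ g) :
    IsTranspose p q g f :=
  fun u x => LinearMap.congr_fun₂ h u x

theorem of_basis {ι κ : Type*} (b : Module.Basis ι R U) (c : Module.Basis κ R W) {g : U →ₗ[R] V}
    {f : W →ₗ[R] T} (h : ∀ i k, p (b i) (f (c k)) = q (g (b i)) (c k)) :
    IsTranspose p q g f :=
  of_compl₂_eq <| b.ext fun i => c.ext fun k => h i k

theorem of_finsum {ι κ : Type*} {b : Module.Basis ι R U} {c : Module.Basis ι R T}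
    (hd : IsDualFamily p b c) (c' : Module.Basis κ R W) {g : U →ₗ[R] V} {f : W →ₗ[R] T}
    (hfin : ∀ k, {i | q (g (b i)) (c' k) ≠ 0}.Finite)
    (hf : ∀ k, f (c' k) = ∑ᶠ i, q (g (b i)) (c' k) • c i) : IsTranspose p q g f := by
  refine of_basis b c' fun i k => ?_
  have hfin' : (fun j => q (g (b j)) (c' k) • c j).HasFiniteSupport :=
    (hfin k).subset fun j hj => left_ne_zero_of_smul hj
  rw [hd i, hf, map_finsum _ hfin', finsum_eq_single _ i fun j hj => by
    rw [map_smul, Module.Basis.coord_apply, Module.Basis.repr_self, Finsupp.single_eq_of_ne hj.symm,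
      smul_zero]]
  rw [map_smul, Module.Basis.coord_apply, Module.Basis.repr_self, Finsupp.single_eq_same,
    smul_eq_mul, mul_one]

theorem unique {ι : Type*} {b : ι → U} {c : Module.Basis ι R T} (hd : IsDualFamily p b c)
    {g : U →ₗ[R] V} {f f' : W →ₗ[R] T} (h : IsTranspose p q g f) (h' : IsTranspose p q g f') :
    f = f' :=
  LinearMap.ext fun x => hd.ext fun i => (h (b i) x).trans (h' (b i) x).symm

theorem map {g : U →ₗ[R] V} {f : W →ₗ[R] T} (h : IsTranspose p q g f) {g' : U' →ₗ[R] V'}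
    {f' : W' →ₗ[R] T'} (h' : IsTranspose p' q' g' f') :
    IsTranspose (tensorPairing p p') (tensorPairing q q') (TensorProduct.map g g')
      (TensorProduct.map f f') :=
  of_compl₂_eq <| TensorProduct.ext' fun u u' => TensorProduct.ext' fun x x' => by
    simp only [LinearMap.compl₂_apply, LinearMap.comp_apply, TensorProduct.map_tmul,
      tensorPairing_tmul, h u x, h' u' x']

theorem rTensor {g : U →ₗ[R] V} {f : W →ₗ[R] T} (h : IsTranspose p q g f) :
    IsTranspose (tensorPairing p p') (tensorPairing q p') (g.rTensor U') (f.rTensor T') :=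
  h.map id

theorem lTensor {g : U →ₗ[R] V} {f : W →ₗ[R] T} (h : IsTranspose p q g f) :
    IsTranspose (tensorPairing p' p) (tensorPairing p' q) (g.lTensor U') (f.lTensor T') :=
  id.map h

theorem assoc :
    IsTranspose (tensorPairing p (tensorPairing p' p'')) (tensorPairing (tensorPairing p p') p'')
      (TensorProduct.assoc R U U' U'').symm.toLinearMap
      (TensorProduct.assoc R T T' T'').toLinearMap :=
  of_compl₂_eq <| TensorProduct.ext_threefold' fun u u' u'' =>
    TensorProduct.ext_threefold fun x x' x'' => by simp [mul_assoc]

theorem tensorTensorTensorComm :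
    IsTranspose (tensorPairing (tensorPairing p p') (tensorPairing p'' q))
      (tensorPairing (tensorPairing p p'') (tensorPairing p' q))
      (TensorProduct.tensorTensorTensorComm R U U' U'' V).toLinearMap
      (TensorProduct.tensorTensorTensorComm R T T'' T' W).toLinearMap :=
  of_compl₂_eq <| TensorProduct.ext_fourfold' fun u u' u'' v =>
    TensorProduct.ext_fourfold' fun x x' x'' y => by simp [mul_mul_mul_comm]

theorem lid_mk :
    IsTranspose (tensorPairing (LinearMap.mul R R) p) p (TensorProduct.lid R U).toLinearMap
      (TensorProduct.mk R R T 1) :=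
  of_compl₂_eq <| TensorProduct.ext' fun r u => LinearMap.ext fun x => by simp

theorem rid_mk :
    IsTranspose (tensorPairing p (LinearMap.mul R R)) p (TensorProduct.rid R U).toLinearMap
      ((TensorProduct.mk R T R).flip 1) :=
  of_compl₂_eq <| TensorProduct.ext' fun u r => LinearMap.ext fun x => by simp [mul_comm]

end IsTranspose

theorem isDualFamily_mul :
    IsDualFamily (LinearMap.mul R R) (fun _ : Unit => 1) (Module.Basis.singleton Unit R) :=
  fun _ => LinearMap.ext fun x => by simp

end Transpose

end

noncomputable section

/-! ### Hopf algebras and comodules by duality -/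

section BialgebraPairing

variable {R U T : Type*} [CommSemiring R] [Semiring U] [Algebra R U] [Semiring T] [Algebra R T]

/-- A pairing of algebras `U` and `T` under which the product and the unit of each of them are the
transposes of the coproduct and the counit of the other. Nothing is assumed about the coproduct `Δ`
and the counit `e` of `T`; their axioms follow from those of the algebra `U`. -/
structure IsBialgebraPairing (p : U →ₗ[R] T →ₗ[R] R) (δ : U →ₐ[R] U ⊗[R] U) (ε : U →ₐ[R] R)
    (Δ : T →ₗ[R] T ⊗[R] T) (e : T →ₗ[R] R) : Prop where
  mul_comul : IsTranspose (tensorPairing p p) p (LinearMap.mul' R U) Δ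
  unit_counit : IsTranspose (LinearMap.mul R R) p (Algebra.linearMap R U) e
  comul_mul : IsTranspose p (tensorPairing p p) δ.toLinearMap (LinearMap.mul' R T)
  counit_unit : IsTranspose p (LinearMap.mul R R) ε.toLinearMap (Algebra.linearMap R T)

namespace IsBialgebraPairing

variable {p : U →ₗ[R] T →ₗ[R] R} {δ : U →ₐ[R] U ⊗[R] U} {ε : U →ₐ[R] R}
  {Δ : T →ₗ[R] T ⊗[R] T} {e : T →ₗ[R] R} (h : IsBialgebraPairing p δ ε Δ e)
include h

theorem apply_mul (u : U) (x y : T) : p u (x * y) = tensorPairing p p (δ u) (x ⊗ₜ y) := by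
  simpa using h.comul_mul u (x ⊗ₜ y)

theorem apply_one (u : U) : p u 1 = ε u := by
  simpa using h.counit_unit u 1

theorem one_apply (x : T) : p 1 x = e x := by
  simpa using (h.unit_counit 1 x).symm

theorem counit_one : e 1 = 1 := by
  rw [← h.one_apply, h.apply_one, map_one]

theorem counit_mul (x y : T) : e (x * y) = e x * e y := by
  rw [← h.one_apply, h.apply_mul, map_one, Algebra.TensorProduct.one_def, tensorPairing_tmul,
    h.one_apply, h.one_apply]

theorem isTranspose_convolution_rTensor {S : U →ₗ[R] U} {A : T →ₗ[R] T} (hA : IsTranspose p p S A) :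
    IsTranspose p p (LinearMap.mul' R U ∘ₗ S.rTensor U ∘ₗ δ.toLinearMap)
      (LinearMap.mul' R T ∘ₗ A.rTensor T ∘ₗ Δ) :=
  h.comul_mul.comp (hA.rTensor.comp h.mul_comul)

theorem isTranspose_convolution_lTensor {S : U →ₗ[R] U} {A : T →ₗ[R] T} (hA : IsTranspose p p S A) :
    IsTranspose p p (LinearMap.mul' R U ∘ₗ S.lTensor U ∘ₗ δ.toLinearMap)
      (LinearMap.mul' R T ∘ₗ A.lTensor T ∘ₗ Δ) :=
  h.comul_mul.comp (hA.lTensor.comp h.mul_comul)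

theorem isTranspose_unit_comp_counit :
    IsTranspose p p (Algebra.linearMap R U ∘ₗ ε.toLinearMap) (Algebra.linearMap R T ∘ₗ e) :=
  h.counit_unit.comp h.unit_counit

variable {ι : Type*} {b : ι → U} {c : Module.Basis ι R T} (hd : IsDualFamily p b c)
include hd

theorem comul_coassoc :
    TensorProduct.assoc R T T T ∘ₗ Δ.rTensor T ∘ₗ Δ = Δ.lTensor T ∘ₗ Δ := by
  have hl := IsTranspose.assoc.comp (h.mul_comul.rTensor.comp h.mul_comul)
  have hr := h.mul_comul.lTensor.comp h.mul_comul
  refine hl.unique (hd.tensor (hd.tensor hd)) ?_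
  convert hr using 1
  exact TensorProduct.ext_threefold' fun u v w => by simp [mul_assoc]

theorem rTensor_counit_comp_comul : e.rTensor T ∘ₗ Δ = TensorProduct.mk R R T 1 := by
  refine (h.unit_counit.rTensor.comp h.mul_comul).unique (isDualFamily_mul.tensor hd) ?_
  convert IsTranspose.lid_mk using 1
  exact TensorProduct.ext' fun r u => by simp [Algebra.smul_def]

theorem lTensor_counit_comp_comul : e.lTensor T ∘ₗ Δ = (TensorProduct.mk R T R).flip 1 := by
  refine (h.unit_counit.lTensor.comp h.mul_comul).unique (hd.tensor isDualFamily_mul) ?_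
  convert IsTranspose.rid_mk using 1
  exact TensorProduct.ext' fun u r => by simp [Algebra.smul_def, Algebra.commutes]

theorem comul_one : Δ 1 = 1 := by
  refine (hd.tensor hd).ext fun i => ?_
  rw [h.mul_comul, LinearMap.mul'_apply, h.apply_one, map_mul, Algebra.TensorProduct.one_def,
    tensorPairing_tmul, h.apply_one, h.apply_one]

theorem comul_map_mul (x y : T) : Δ (x * y) = Δ x * Δ y := by
  have hl := h.mul_comul.comp h.comul_mul
  have hr := (h.comul_mul.map h.comul_mul).comp
    (IsTranspose.tensorTensorTensorComm.comp (h.mul_comul.map h.mul_comul))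
  have hδ : δ.toLinearMap ∘ₗ LinearMap.mul' R U =
      (TensorProduct.map (LinearMap.mul' R U) (LinearMap.mul' R U) ∘ₗ
        (TensorProduct.tensorTensorTensorComm R U U U U).toLinearMap) ∘ₗ
          TensorProduct.map δ.toLinearMap δ.toLinearMap := by
    rw [← LinearMap.mul'_tensor]
    exact TensorProduct.ext' fun u v => by simp
  have := LinearMap.congr_fun (hl.unique (hd.tensor hd) (hδ ▸ hr)) (x ⊗ₜ y)
  rw [← LinearMap.comp_assoc, ← LinearMap.mul'_tensor] at this
  simpa using this

end IsBialgebraPairing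

variable {U T : Type*} [Ring U] [Algebra ℝ U] [Ring T] [Algebra ℝ T]
  {p : U →ₗ[ℝ] T →ₗ[ℝ] ℝ} {δ : U →ₐ[ℝ] U ⊗[ℝ] U} {ε : U →ₐ[ℝ] ℝ}
  {Δ : T →ₗ[ℝ] T ⊗[ℝ] T} {e : T →ₗ[ℝ] ℝ} {ι : Type*} {b : ι → U} {c : Module.Basis ι ℝ T}

theorem IsBialgebraPairing.isHopfAlgebraWith (h : IsBialgebraPairing p δ ε Δ e)
    (hd : IsDualFamily p b c) {S : U →ₗ[ℝ] U} {A : T →ₗ[ℝ] T} (hA : IsTranspose p p S A)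
    (hSl : LinearMap.mul' ℝ U ∘ₗ S.rTensor U ∘ₗ δ.toLinearMap =
      Algebra.linearMap ℝ U ∘ₗ ε.toLinearMap)
    (hSr : LinearMap.mul' ℝ U ∘ₗ S.lTensor U ∘ₗ δ.toLinearMap =
      Algebra.linearMap ℝ U ∘ₗ ε.toLinearMap) :
    IsHopfAlgebraWith Δ e A where
  coassoc := h.comul_coassoc hd
  rTensor_counit := h.rTensor_counit_comp_comul hd
  lTensor_counit := h.lTensor_counit_comp_comul hd
  comul_one := h.comul_one hd
  comul_mul := h.comul_map_mul hd
  counit_one := h.counit_one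
  counit_mul := h.counit_mul
  antipode_left := IsTranspose.unique hd (hSl ▸ h.isTranspose_convolution_rTensor hA)
    h.isTranspose_unit_comp_counit
  antipode_right := IsTranspose.unique hd (hSr ▸ h.isTranspose_convolution_lTensor hA)
    h.isTranspose_unit_comp_counit

/-- The restriction of a representation to an invariant submodule. -/
def restrictEnd {R U M : Type*} [CommSemiring R] [Semiring U] [Algebra R U] [AddCommMonoid M]
    [Module R M] (ρ : U →ₐ[R] Module.End R M) (N : Submodule R M)
    (hN : ∀ u, ∀ q ∈ N, ρ u q ∈ N) : U →ₐ[R] Module.End R N :=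
  AlgHom.ofLinearMap
    { toFun u := (ρ u).restrict (hN u)
      map_add' u v := by ext; simp
      map_smul' r u := by ext; simp }
    (by ext; simp) fun u v => by ext; simp

theorem IsBialgebraPairing.isLeftComodule (h : IsBialgebraPairing p δ ε Δ e)
    (hd : IsDualFamily p b c) {M V κ : Type*} [AddCommGroup M] [Module ℝ M] [AddCommGroup V]
    [Module ℝ V] {p' : M →ₗ[ℝ] V →ₗ[ℝ] ℝ} {m : κ → M} {v : Module.Basis κ ℝ V}
    (hd' : IsDualFamily p' m v) {ρ : U →ₐ[ℝ] Module.End ℝ M} {f : V →ₗ[ℝ] T ⊗[ℝ] V}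
    (hf : IsTranspose (tensorPairing p p') p' (TensorProduct.lift ρ.toLinearMap) f) :
    IsLeftComodule Δ e f where
  coassoc := by
    have hl := hf.lTensor.comp hf
    have hr := IsTranspose.assoc.comp (h.mul_comul.rTensor.comp hf)
    refine hl.unique (hd.tensor (hd.tensor hd')) ?_
    convert hr using 1
    exact TensorProduct.ext_threefold' fun u v w => by simp
  counit := by
    refine (h.unit_counit.rTensor.comp hf).unique (isDualFamily_mul.tensor hd') ?_
    convert IsTranspose.lid_mk using 1
    exact TensorProduct.ext' fun r u => by simp

end BialgebraPairing

end

noncomputable section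

/-! ### Bases of divided powers -/

section DividedPowerBasis

open Finsupp (weight)
open Finset.HasAntidiagonal (antidiagonal mem_antidiagonal)

variable {R σ U : Type*} [CommSemiring R] [Semiring U] [Algebra R U]

theorem finsupp_nat_induction {motive : (σ →₀ ℕ) → Prop} (zero : motive 0)
    (single : ∀ g, motive (.single g 1)) (add : ∀ K K', motive K → motive K' → motive (K + K'))
    (K : σ →₀ ℕ) : motive K := by
  refine Finsupp.induction_linear K zero add fun g n => ?_
  induction n with
  | zero => simpa only [Finsupp.single_zero] using zero
  | succ n ih => simpa only [Finsupp.single_add] using add _ _ ih (single g)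

open Classical in
/-- A basis of `U` behaving like the divided powers `x ^ K / K!` of commuting primitive elements
under the coproduct `δ` and the counit `ε`. No condition is put on the product. -/
structure IsDividedPowerBasis (b : Module.Basis (σ →₀ ℕ) R U) (δ : U →ₐ[R] U ⊗[R] U)
    (ε : U →ₐ[R] R) : Prop where
  one : b 0 = 1
  counit : ∀ K ≠ 0, ε (b K) = 0
  comul : ∀ K, δ (b K) = ∑ q ∈ antidiagonal K, b q.1 ⊗ₜ[R] b q.2

/-- The pairing of `U` with the polynomials under which `b` is dual to the monomials. -/
def monomialPairing (b : Module.Basis (σ →₀ ℕ) R U) : U →ₗ[R] MvPolynomial σ R →ₗ[R] R :=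
  b.constr R fun K => MvPolynomial.lcoeff R K

/-- The coproduct on polynomials transposing the product of `U`. It is correct only for products
whose matrix in the basis `b` is row-finite: otherwise `finsum` is `0`. -/
def transposeMul (b : Module.Basis (σ →₀ ℕ) R U) :
    MvPolynomial σ R →ₗ[R] MvPolynomial σ R ⊗[R] MvPolynomial σ R :=
  (MvPolynomial.basisMonomials σ R).constr R fun K =>
    ∑ᶠ q : (σ →₀ ℕ) × (σ →₀ ℕ), b.repr (b q.1 * b q.2) K •
      (MvPolynomial.monomial q.1 (1 : R) ⊗ₜ[R] MvPolynomial.monomial q.2 (1 : R))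

/-- The product of `U` is homogeneous when `b K` is given the degree of the monomial of exponent `K`
in variables of weights `w`. -/
def IsHomogeneousMul {M : Type*} [AddCommMonoid M] (b : Module.Basis (σ →₀ ℕ) R U) (w : σ → M) :
    Prop :=
  ∀ K K' K'', b.repr (b K' * b K'') K ≠ 0 → weight w K' + weight w K'' = weight w K

variable {b : Module.Basis (σ →₀ ℕ) R U} {δ : U →ₐ[R] U ⊗[R] U} {ε : U →ₐ[R] R}

theorem monomialPairing_basis (K : σ →₀ ℕ) (x : MvPolynomial σ R) :
    monomialPairing b (b K) x = MvPolynomial.coeff K x := by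
  rw [monomialPairing, Module.Basis.constr_basis, MvPolynomial.lcoeff_apply]

theorem isDualFamily_monomialPairing :
    IsDualFamily (monomialPairing b) b (MvPolynomial.basisMonomials σ R) :=
  fun _ => LinearMap.ext fun x => monomialPairing_basis _ x

theorem monomialPairing_monomial (u : U) (K : σ →₀ ℕ) :
    monomialPairing b u (MvPolynomial.monomial K 1) = b.repr u K := by
  classical
  have : (monomialPairing b).flip (MvPolynomial.monomial K 1) = b.coord K := b.ext fun K' => by
    rw [LinearMap.flip_apply, monomialPairing_basis, MvPolynomial.coeff_monomial,
      Module.Basis.coord_apply, Module.Basis.repr_self, Finsupp.single_apply]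
    simp only [eq_comm]
  exact LinearMap.congr_fun this u

theorem transposeMul_monomial {K : σ →₀ ℕ}
    (hK : {q : (σ →₀ ℕ) × (σ →₀ ℕ) | b.repr (b q.1 * b q.2) K ≠ 0}.Finite) :
    transposeMul b (MvPolynomial.monomial K 1) = ∑ q ∈ hK.toFinset, b.repr (b q.1 * b q.2) K •
      (MvPolynomial.monomial q.1 (1 : R) ⊗ₜ[R] MvPolynomial.monomial q.2 (1 : R)) := by
  rw [transposeMul, ← congrFun (MvPolynomial.coe_basisMonomials σ R) K, Module.Basis.constr_basis]
  refine finsum_eq_sum_of_support_subset _ fun q hq => ?_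
  rw [Set.Finite.coe_toFinset]
  exact left_ne_zero_of_smul hq

theorem isTranspose_mul'_transposeMul
    (hfin : ∀ K, {q : (σ →₀ ℕ) × (σ →₀ ℕ) | b.repr (b q.1 * b q.2) K ≠ 0}.Finite) :
    IsTranspose (tensorPairing (monomialPairing b) (monomialPairing b)) (monomialPairing b)
      (LinearMap.mul' R U) (transposeMul b) := by
  have hmul (q : (σ →₀ ℕ) × (σ →₀ ℕ)) (K : σ →₀ ℕ) :
      monomialPairing b (LinearMap.mul' R U (b.tensorProduct b q))
        (MvPolynomial.basisMonomials σ R K) = b.repr (b q.1 * b q.2) K := by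
    rw [Module.Basis.tensorProduct_apply', LinearMap.mul'_apply, MvPolynomial.coe_basisMonomials,
      monomialPairing_monomial]
  refine .of_finsum (isDualFamily_monomialPairing.tensorProduct isDualFamily_monomialPairing)
    (MvPolynomial.basisMonomials σ R) (fun K => ?_) fun K => ?_
  · simpa only [hmul] using hfin K
  · rw [transposeMul, Module.Basis.constr_basis]
    simp only [hmul]
    simp only [Module.Basis.tensorProduct_apply', MvPolynomial.coe_basisMonomials]

namespace IsDividedPowerBasis

variable (hb : IsDividedPowerBasis b δ ε)
include hb

open Classical in
theorem counit_apply (K : σ →₀ ℕ) : ε (b K) = if K = 0 then 1 else 0 := by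
  split_ifs with hK
  · rw [hK, hb.one, map_one]
  · exact hb.counit K hK

theorem isTranspose_comul_mul' :
    IsTranspose (monomialPairing b) (tensorPairing (monomialPairing b) (monomialPairing b))
      δ.toLinearMap (LinearMap.mul' R (MvPolynomial σ R)) := by
  classical
  have h : (monomialPairing b).compl₂ (LinearMap.mul' R (MvPolynomial σ R)) =
      tensorPairing (monomialPairing b) (monomialPairing b) ∘ₗ δ.toLinearMap :=
    b.ext fun K => TensorProduct.ext' fun x y => by
      simp [hb.comul, monomialPairing_basis, MvPolynomial.coeff_mul, LinearMap.sum_apply]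
  exact .of_compl₂_eq h

theorem isTranspose_counit_unit :
    IsTranspose (monomialPairing b) (LinearMap.mul R R) ε.toLinearMap
      (Algebra.linearMap R (MvPolynomial σ R)) := by
  classical
  have h : (monomialPairing b).compl₂ (Algebra.linearMap R (MvPolynomial σ R)) =
      LinearMap.mul R R ∘ₗ ε.toLinearMap :=
    b.ext fun K => LinearMap.ext fun r => by
      simp [hb.counit_apply, monomialPairing_basis, MvPolynomial.algebraMap_eq,
        MvPolynomial.coeff_C, eq_comm]
  exact .of_compl₂_eq h

theorem isBialgebraPairing
    (hfin : ∀ K, {q : (σ →₀ ℕ) × (σ →₀ ℕ) | b.repr (b q.1 * b q.2) K ≠ 0}.Finite) :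
    IsBialgebraPairing (monomialPairing b) δ ε (transposeMul b) (MvPolynomial.lcoeff R 0) where
  mul_comul := isTranspose_mul'_transposeMul hfin
  unit_counit r x := by
    rw [Algebra.linearMap_apply, Algebra.algebraMap_eq_smul_one, map_smul, ← hb.one,
      LinearMap.smul_apply, monomialPairing_basis]
    rfl
  comul_mul := hb.isTranspose_comul_mul'
  counit_unit := hb.isTranspose_counit_unit

theorem repr_zero (u : U) : b.repr u 0 = ε u := by
  have h : b.coord 0 = ε.toLinearMap := b.ext fun K => by
    classical
    rw [Module.Basis.coord_apply, Module.Basis.repr_self, Finsupp.single_apply,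
      AlgHom.toLinearMap_apply, hb.counit_apply]
  exact LinearMap.congr_fun h u

theorem eq_zero_of_repr_mul_zero_ne_zero {K' K'' : σ →₀ ℕ} (h : b.repr (b K' * b K'') 0 ≠ 0) :
    K' = 0 ∧ K'' = 0 := by
  rw [hb.repr_zero, map_mul] at h
  exact ⟨not_imp_comm.mp (hb.counit K') (left_ne_zero_of_mul h),
    not_imp_comm.mp (hb.counit K'') (right_ne_zero_of_mul h)⟩

theorem repr_add (u : U) (K₁ K₂ : σ →₀ ℕ) :
    b.repr u (K₁ + K₂) = tensorPairing (monomialPairing b) (monomialPairing b) (δ u)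
      (MvPolynomial.monomial K₁ 1 ⊗ₜ[R] MvPolynomial.monomial K₂ 1) := by
  rw [← monomialPairing_monomial, ← one_mul (1 : R), ← MvPolynomial.monomial_mul, mul_one]
  exact hb.isTranspose_comul_mul' u (_ ⊗ₜ[R] _)

theorem exists_of_repr_mul_add_ne_zero {K₁ K₂ K' K'' : σ →₀ ℕ}
    (h : b.repr (b K' * b K'') (K₁ + K₂) ≠ 0) :
    ∃ A A' B B', A + B = K' ∧ A' + B' = K'' ∧ b.repr (b A * b A') K₁ ≠ 0 ∧
      b.repr (b B * b B') K₂ ≠ 0 := by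
  classical
  rw [hb.repr_add, map_mul, hb.comul, hb.comul, Finset.sum_mul_sum] at h
  simp only [map_sum, LinearMap.sum_apply, Algebra.TensorProduct.tmul_mul_tmul, tensorPairing_tmul,
    monomialPairing_monomial] at h
  obtain ⟨q, hq, h⟩ := Finset.exists_ne_zero_of_sum_ne_zero h
  obtain ⟨r, hr, h⟩ := Finset.exists_ne_zero_of_sum_ne_zero h
  exact ⟨q.1, r.1, q.2, r.2, mem_antidiagonal.mp hq, mem_antidiagonal.mp hr,
    left_ne_zero_of_mul h, right_ne_zero_of_mul h⟩

theorem finite_repr_mul (hgen : ∀ g, {q : (σ →₀ ℕ) × (σ →₀ ℕ) |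
      b.repr (b q.1 * b q.2) (.single g 1) ≠ 0}.Finite) (K : σ →₀ ℕ) :
    {q : (σ →₀ ℕ) × (σ →₀ ℕ) | b.repr (b q.1 * b q.2) K ≠ 0}.Finite := by
  induction K using finsupp_nat_induction with
  | zero =>
    exact (Set.finite_singleton (0, 0)).subset fun q hq =>
      Prod.ext_iff.mpr (hb.eq_zero_of_repr_mul_zero_ne_zero hq)
  | single g => exact hgen g
  | add K₁ K₂ h₁ h₂ =>
    refine (h₁.image2 (· + ·) h₂).subset fun q hq => ?_
    obtain ⟨A, A', B, B', h, h', hA, hB⟩ := hb.exists_of_repr_mul_add_ne_zero hq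
    exact ⟨(A, A'), hA, (B, B'), hB, Prod.ext h h'⟩

theorem isHomogeneousMul {M : Type*} [AddCommMonoid M] {w : σ → M}
    (hgen : ∀ g K' K'', b.repr (b K' * b K'') (.single g 1) ≠ 0 →
      weight w K' + weight w K'' = w g) : IsHomogeneousMul b w := by
  intro K
  induction K using finsupp_nat_induction with
  | zero =>
    intro K' K'' h
    rw [(hb.eq_zero_of_repr_mul_zero_ne_zero h).1, (hb.eq_zero_of_repr_mul_zero_ne_zero h).2,
      map_zero, add_zero]
  | single g => simpa only [Finsupp.weight_single, one_smul] using hgen g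
  | add K₁ K₂ h₁ h₂ =>
    intro K' K'' h
    obtain ⟨A, A', B, B', rfl, rfl, hA, hB⟩ := hb.exists_of_repr_mul_add_ne_zero h
    rw [map_add, map_add, map_add, add_add_add_comm, h₁ _ _ hA, h₂ _ _ hB]

end IsDividedPowerBasis

end DividedPowerBasis

end

noncomputable section

section WeightedHomogeneous

open Finsupp (weight)
open MvPolynomial (weightedHomogeneousSubmodule)

variable {R σ : Type*} [CommSemiring R]

theorem map_mem_of_mem_weightedHomogeneousSubmodule {M N : Type*} [AddCommMonoid M]
    [AddCommMonoid N] [Module R N] {w : σ → M} {f : MvPolynomial σ R →ₗ[R] N}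
    {𝒩 : M → Submodule R N} (hf : ∀ K, f (MvPolynomial.monomial K 1) ∈ 𝒩 (weight w K)) {ν : M}
    {x : MvPolynomial σ R} (hx : x ∈ weightedHomogeneousSubmodule R w ν) : f x ∈ 𝒩 ν := by
  rw [x.as_sum, map_sum]
  refine Submodule.sum_mem _ fun K hK => ?_
  rw [← mul_one (MvPolynomial.coeff K x), ← smul_eq_mul, ← MvPolynomial.smul_monomial, map_smul,
    ← hx (MvPolynomial.mem_support_iff.mp hK)]
  exact Submodule.smul_mem _ _ (hf K)

theorem weight_pos {w : σ → ℝ} (hw : ∀ g, 0 < w g) {K : σ →₀ ℕ} (hK : K ≠ 0) :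
    0 < weight w K := by
  obtain ⟨g, hg⟩ := Finsupp.ne_iff.mp hK
  exact (hw g).trans_le (Finsupp.le_weight_of_ne_zero (fun g => (hw g).le) hg)

theorem weightedHomogeneousSubmodule_eq_bot_of_neg {w : σ → ℝ} (hw : ∀ g, 0 ≤ w g) {ν : ℝ}
    (hν : ν < 0) : weightedHomogeneousSubmodule R w ν = ⊥ := by
  refine (Submodule.eq_bot_iff _).mpr fun x hx => MvPolynomial.ext _ _ fun K => ?_
  by_contra h
  refine hν.not_ge ((hx h).symm ▸ ?_)
  exact Finset.sum_nonneg fun i _ => nsmul_nonneg (hw i) _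

theorem weightedHomogeneousSubmodule_zero_eq_span_one {w : σ → ℝ} (hw : ∀ g, 0 < w g) :
    weightedHomogeneousSubmodule R w 0 = Submodule.span R {1} := by
  refine le_antisymm (fun x hx => Submodule.mem_span_singleton.mpr
    ⟨MvPolynomial.coeff 0 x, MvPolynomial.ext _ _ fun K => ?_⟩) <|
    (Submodule.span_singleton_le_iff_mem _ _).mpr (MvPolynomial.isWeightedHomogeneous_one R w)
  classical
  rw [MvPolynomial.coeff_smul, MvPolynomial.coeff_one]
  split_ifs with h
  · rw [← h, smul_eq_mul, mul_one]
  · rw [smul_zero]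
    by_contra hne
    exact (weight_pos hw (Ne.symm h)).ne' (hx (Ne.symm hne))

end WeightedHomogeneous

/-! ### Antipode and grading on the dual of a basis of divided powers -/

section Antipode

open Finsupp (weight)
open Finset.HasAntidiagonal (mem_antidiagonal)
open MvPolynomial (weightedHomogeneousSubmodule)

variable {R σ U : Type*} [CommRing R] [Semiring U] [Algebra R U]
  {b : Module.Basis (σ →₀ ℕ) R U} {δ : U →ₐ[R] U ⊗[R] U} {ε : U →ₐ[R] R}

theorem transposeMul_mem_grading {M : Type*} [AddCommMonoid M] {w : σ → M}
    (hfin : ∀ K, {q : (σ →₀ ℕ) × (σ →₀ ℕ) | b.repr (b q.1 * b q.2) K ≠ 0}.Finite)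
    (hw : IsHomogeneousMul b w) {ν : M} {x : MvPolynomial σ R}
    (hx : x ∈ weightedHomogeneousSubmodule R w ν) :
    transposeMul b x ∈ ⨆ p : {p : M × M // p.1 + p.2 = ν}, LinearMap.range (TensorProduct.map
      (weightedHomogeneousSubmodule R w p.1.1).subtype
      (weightedHomogeneousSubmodule R w p.1.2).subtype) := by
  refine map_mem_of_mem_weightedHomogeneousSubmodule (w := w) (𝒩 := fun ν =>
    ⨆ p : {p : M × M // p.1 + p.2 = ν}, LinearMap.range (TensorProduct.map
      (weightedHomogeneousSubmodule R w p.1.1).subtype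
      (weightedHomogeneousSubmodule R w p.1.2).subtype)) (fun K => ?_) hx
  rw [transposeMul_monomial (hfin K)]
  refine Submodule.sum_mem _ fun q hq => Submodule.smul_mem _ _ <|
    Submodule.mem_iSup_of_mem ⟨(weight w q.1, weight w q.2),
      hw _ _ _ ((Set.Finite.mem_toFinset _).mp hq)⟩ ?_
  exact ⟨⟨MvPolynomial.monomial q.1 1, MvPolynomial.isWeightedHomogeneous_monomial _ _ _ rfl⟩
    ⊗ₜ[R] ⟨MvPolynomial.monomial q.2 1, MvPolynomial.isWeightedHomogeneous_monomial _ _ _ rfl⟩,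
    rfl⟩

/-- `K'` precedes `K` when `b K` occurs in the product of `b K'` and a basis vector other than
`b 0`. -/
def ProperLeftFactor (b : Module.Basis (σ →₀ ℕ) R U) (K' K : σ →₀ ℕ) : Prop :=
  ∃ K'' ≠ 0, b.repr (b K' * b K'') K ≠ 0

theorem IsHomogeneousMul.wellFounded_properLeftFactor {w : σ → ℝ} (h : IsHomogeneousMul b w)
    {c : ℝ} (hc : 0 < c) (hw : ∀ g, c ≤ w g) : WellFounded (ProperLeftFactor b) := by
  refine Subrelation.wf (r := InvImage (· < ·) fun K => ⌊weight w K / c⌋₊) ?_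
    (InvImage.wf _ wellFounded_lt)
  rintro K' K ⟨K'', h0, hK⟩
  have hw0 (g) : 0 ≤ w g := hc.le.trans (hw g)
  have hK' : 0 ≤ weight w K' / c :=
    div_nonneg (Finset.sum_nonneg fun i _ => nsmul_nonneg (hw0 i) _) hc.le
  obtain ⟨g, hg⟩ := Finsupp.ne_iff.mp h0
  rw [InvImage, ← Nat.add_one_le_iff, ← Nat.floor_add_one hK', ← h _ _ _ hK, add_div]
  gcongr
  exact (one_le_div hc).mpr ((hw g).trans (Finsupp.le_weight_of_ne_zero hw0 hg))

namespace IsDividedPowerBasis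

variable (hb : IsDividedPowerBasis b δ ε)
include hb

theorem tensorPairing_rTensor_comul_tmul_one {V W : Type*} [AddCommMonoid V] [Module R V]
    [AddCommMonoid W] [Module R W] (p : V →ₗ[R] W →ₗ[R] R) (S : U →ₗ[R] V) (u : U) (x : W) :
    tensorPairing p (monomialPairing b) (S.rTensor U (δ u)) (x ⊗ₜ[R] 1) = p (S u) x := by
  classical
  have hone (u : U) : monomialPairing b u 1 = ε u := by
    simpa using hb.isTranspose_counit_unit u 1
  have h : (tensorPairing p (monomialPairing b)).flip (x ⊗ₜ[R] 1) ∘ₗ S.rTensor U ∘ₗ δ.toLinearMap =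
      p.flip x ∘ₗ S := b.ext fun K => by
    simp only [LinearMap.comp_apply, LinearMap.flip_apply, AlgHom.toLinearMap_apply, hb.comul,
      map_sum, LinearMap.rTensor_tmul, tensorPairing_tmul, hone]
    rw [Finset.sum_eq_single (K, 0)]
    · rw [hb.one, map_one, mul_one]
    · intro q hq hne
      rw [hb.counit q.2, mul_zero]
      intro h0
      rw [mem_antidiagonal, h0, add_zero] at hq
      exact hne (Prod.ext hq h0)
    · exact fun hK => (hK (mem_antidiagonal.mpr (add_zero K))).elim
  exact LinearMap.congr_fun h u

open Classical in
/- The antipode axiom of `U`, paired with a monomial. Solved for the first summand, it determines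
the transpose of `S` recursively. -/
theorem monomialPairing_antipode_monomial
    (hfin : ∀ K, {q : (σ →₀ ℕ) × (σ →₀ ℕ) | b.repr (b q.1 * b q.2) K ≠ 0}.Finite)
    {S : U →ₗ[R] U} (hS : LinearMap.mul' R U ∘ₗ S.rTensor U ∘ₗ δ.toLinearMap =
      Algebra.linearMap R U ∘ₗ ε.toLinearMap) (u : U) (K : σ →₀ ℕ) :
    monomialPairing b (S u) (MvPolynomial.monomial K 1) +
      ∑ q ∈ (hfin K).toFinset.erase (K, 0), b.repr (b q.1 * b q.2) K *
        tensorPairing (monomialPairing b) (monomialPairing b) (S.rTensor U (δ u))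
          (MvPolynomial.monomial q.1 1 ⊗ₜ[R] MvPolynomial.monomial q.2 1) =
      monomialPairing b u (if K = 0 then 1 else 0) := by
  nontriviality R
  have hmem : (K, 0) ∈ (hfin K).toFinset := by simp [hb.one]
  have hunit : (if K = 0 then 1 else 0 : MvPolynomial σ R) =
      algebraMap R _ (MvPolynomial.lcoeff R 0 (MvPolynomial.monomial K 1)) := by
    rw [MvPolynomial.lcoeff_apply, MvPolynomial.coeff_monomial, apply_ite (algebraMap R _), map_one,
      map_zero]
  have h := isTranspose_mul'_transposeMul hfin (S.rTensor U (δ u)) (MvPolynomial.monomial K 1)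
  rw [transposeMul_monomial (hfin K), ← Finset.add_sum_erase _ _ hmem, hb.one, mul_one,
    Module.Basis.repr_self, Finsupp.single_eq_same, one_smul, MvPolynomial.monomial_zero', map_add,
    MvPolynomial.C_1, hb.tensorPairing_rTensor_comul_tmul_one, map_sum] at h
  simp only [map_smul, smul_eq_mul] at h
  rw [h, hunit]
  exact (congrArg (monomialPairing b · _) (LinearMap.congr_fun hS u)).trans
    ((hb.isBialgebraPairing hfin).isTranspose_unit_comp_counit u _).symm

theorem exists_transpose_antipode_monomial
    (hfin : ∀ K, {q : (σ →₀ ℕ) × (σ →₀ ℕ) | b.repr (b q.1 * b q.2) K ≠ 0}.Finite)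
    (hwf : WellFounded (ProperLeftFactor b)) {M : Type*} [AddCommMonoid M] {w : σ → M}
    (hw : IsHomogeneousMul b w) {S : U →ₗ[R] U}
    (hS : LinearMap.mul' R U ∘ₗ S.rTensor U ∘ₗ δ.toLinearMap =
      Algebra.linearMap R U ∘ₗ ε.toLinearMap) (K : σ →₀ ℕ) :
    ∃ a ∈ weightedHomogeneousSubmodule R w (weight w K),
      ∀ u, monomialPairing b u a = monomialPairing b (S u) (MvPolynomial.monomial K 1) := by
  classical
  induction K using hwf.induction with
  | _ K ih =>
    have hrepr (q) (hq : q ∈ (hfin K).toFinset.erase (K, 0)) : b.repr (b q.1 * b q.2) K ≠ 0 :=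
      (Set.Finite.mem_toFinset _).mp (Finset.mem_of_mem_erase hq)
    have hlt (q) (hq : q ∈ (hfin K).toFinset.erase (K, 0)) : ProperLeftFactor b q.1 K := by
      refine ⟨q.2, fun h0 => Finset.ne_of_mem_erase hq (Prod.ext ?_ h0), hrepr q hq⟩
      have h := hrepr q hq
      rw [h0, hb.one, mul_one, Module.Basis.repr_self] at h
      exact (Finsupp.single_apply_ne_zero.mp h).1.symm
    choose! a ha ha' using fun q hq => ih q.1 (hlt q hq)
    refine ⟨(if K = 0 then 1 else 0) - ∑ q ∈ (hfin K).toFinset.erase (K, 0),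
      b.repr (b q.1 * b q.2) K • (a q * MvPolynomial.monomial q.2 1), ?_, fun u => ?_⟩
    · refine Submodule.sub_mem _ ?_ (Submodule.sum_mem _ fun q hq => Submodule.smul_mem _ _ ?_)
      · split_ifs with h0
        · rw [h0, map_zero]
          exact MvPolynomial.isWeightedHomogeneous_one R w
        · exact Submodule.zero_mem _
      · rw [← hw _ _ _ (hrepr q hq)]
        exact MvPolynomial.IsWeightedHomogeneous.mul (ha q hq)
          (MvPolynomial.isWeightedHomogeneous_monomial _ _ _ rfl)
    · rw [map_sub, map_sum, sub_eq_iff_eq_add, ← hb.monomialPairing_antipode_monomial hfin hS]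
      congr 1
      refine Finset.sum_congr rfl fun q hq => ?_
      rw [map_smul, smul_eq_mul, tensorPairing_rTensor_tmul (ha' q hq),
        (hb.isBialgebraPairing hfin).apply_mul]

theorem exists_isTranspose_antipode
    (hfin : ∀ K, {q : (σ →₀ ℕ) × (σ →₀ ℕ) | b.repr (b q.1 * b q.2) K ≠ 0}.Finite)
    (hwf : WellFounded (ProperLeftFactor b)) {M : Type*} [AddCommMonoid M] {w : σ → M}
    (hw : IsHomogeneousMul b w) {S : U →ₗ[R] U}
    (hS : LinearMap.mul' R U ∘ₗ S.rTensor U ∘ₗ δ.toLinearMap =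
      Algebra.linearMap R U ∘ₗ ε.toLinearMap) :
    ∃ A : MvPolynomial σ R →ₗ[R] MvPolynomial σ R,
      IsTranspose (monomialPairing b) (monomialPairing b) S A ∧
      ∀ ν, ∀ x ∈ weightedHomogeneousSubmodule R w ν, A x ∈ weightedHomogeneousSubmodule R w ν := by
  choose a ha ha' using hb.exists_transpose_antipode_monomial hfin hwf hw hS
  let A := (MvPolynomial.basisMonomials σ R).constr R a
  have hA (K) : A (MvPolynomial.monomial K 1) = a K := by
    rw [← congrFun (MvPolynomial.coe_basisMonomials σ R) K, Module.Basis.constr_basis]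
  refine ⟨A, .of_basis b (MvPolynomial.basisMonomials σ R) fun K' K => ?_, fun ν x hx =>
    map_mem_of_mem_weightedHomogeneousSubmodule (fun K => ?_) hx⟩
  · rw [MvPolynomial.coe_basisMonomials, hA, ha']
  · rw [hA]
    exact ha K

end IsDividedPowerBasis

theorem IsDividedPowerBasis.exists_isConnectedGradedHopfAlgebra {U : Type*} [Ring U] [Algebra ℝ U]
    {b : Module.Basis (σ →₀ ℕ) ℝ U} {δ : U →ₐ[ℝ] U ⊗[ℝ] U} {ε : U →ₐ[ℝ] ℝ}
    (hb : IsDividedPowerBasis b δ ε)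
    (hfin : ∀ K, {q : (σ →₀ ℕ) × (σ →₀ ℕ) | b.repr (b q.1 * b q.2) K ≠ 0}.Finite)
    (hwf : WellFounded (ProperLeftFactor b)) {w : σ → ℝ} (hpos : ∀ g, 0 < w g)
    (hw : IsHomogeneousMul b w) {S : U →ₗ[ℝ] U}
    (hSl : LinearMap.mul' ℝ U ∘ₗ S.rTensor U ∘ₗ δ.toLinearMap =
      Algebra.linearMap ℝ U ∘ₗ ε.toLinearMap)
    (hSr : LinearMap.mul' ℝ U ∘ₗ S.lTensor U ∘ₗ δ.toLinearMap =
      Algebra.linearMap ℝ U ∘ₗ ε.toLinearMap) :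
    ∃ A, IsConnectedGradedHopfAlgebra (transposeMul b) (MvPolynomial.lcoeff ℝ 0) A
        (weightedHomogeneousSubmodule ℝ w) ∧
      IsTranspose (monomialPairing b) (monomialPairing b) S A := by
  classical
  obtain ⟨A, hA, hA'⟩ := hb.exists_isTranspose_antipode hfin hwf hw hSl
  let _ := MvPolynomial.weightedGradedAlgebra ℝ w
  exact ⟨A,
    { isHopf := (hb.isBialgebraPairing hfin).isHopfAlgebraWith isDualFamily_monomialPairing
        hA hSl hSr
      isInternal := DirectSum.Decomposition.isInternal _
      one_mem := MvPolynomial.isWeightedHomogeneous_one ℝ w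
      mul_mem := fun μ ν x hx y hy => MvPolynomial.IsWeightedHomogeneous.mul hx hy
      comul_mem := fun ν x hx => transposeMul_mem_grading hfin hw hx
      counit_mem := fun ν hν x hx => not_not.mp fun h => hν ((hx h).symm.trans (map_zero _))
      antipode_mem := hA'
      nonneg := fun ν => weightedHomogeneousSubmodule_eq_bot_of_neg fun g => (hpos g).le
      connected := weightedHomogeneousSubmodule_zero_eq_span_one hpos }, hA⟩

end Antipode

end

noncomputable section

/-! ### Row-finite operators -/

section RowFinite

open MvPolynomial
open Finsupp (single)

variable {R σ : Type*} [CommSemiring R]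

theorem exists_coeff_ne_zero_of_coeff_map_ne_zero {τ : Type*}
    (T : MvPolynomial σ R →ₗ[R] MvPolynomial τ R) {q : MvPolynomial σ R} {β : τ →₀ ℕ}
    (h : coeff β (T q) ≠ 0) : ∃ γ, coeff γ q ≠ 0 ∧ coeff β (T (monomial γ 1)) ≠ 0 := by
  rw [q.as_sum, map_sum, coeff_sum] at h
  obtain ⟨γ, hγ, hne⟩ := Finset.exists_ne_zero_of_sum_ne_zero h
  refine ⟨γ, mem_support_iff.mp hγ, fun h0 => hne ?_⟩
  rw [← mul_one (coeff γ q), ← smul_eq_mul, ← smul_monomial, map_smul, coeff_smul, h0, smul_zero]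

/-- The matrix of an operator on polynomials in the basis of monomials has finite rows: every
monomial occurs in the images of only finitely many monomials. -/
def RowFinite (T : MvPolynomial σ R →ₗ[R] MvPolynomial σ R) : Prop :=
  ∀ β, {γ | coeff β (T (monomial γ 1)) ≠ 0}.Finite

namespace RowFinite

variable {S T : MvPolynomial σ R →ₗ[R] MvPolynomial σ R}

theorem id : RowFinite (.id : MvPolynomial σ R →ₗ[R] MvPolynomial σ R) := by
  classical
  refine fun β => (Set.finite_singleton β).subset fun γ hγ => ?_
  by_contra hne
  exact hγ ((coeff_monomial _ _ _).trans (if_neg hne))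

theorem comp (hT : RowFinite T) (hS : RowFinite S) : RowFinite (T ∘ₗ S) := by
  refine fun β => ((hT β).biUnion fun γ' _ => hS γ').subset fun γ hγ => ?_
  obtain ⟨γ', hS', hT'⟩ := exists_coeff_ne_zero_of_coeff_map_ne_zero T hγ
  exact Set.mem_biUnion hT' hS'

theorem smul (hT : RowFinite T) (c : R) : RowFinite (c • T) :=
  fun β => (hT β).subset fun γ hγ => right_ne_zero_of_mul (a := c) (by simpa using hγ)

theorem mulLeft_monomial (γ₀ : σ →₀ ℕ) : RowFinite (LinearMap.mulLeft R (monomial γ₀ (1 : R))) := by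
  classical
  refine fun β => (Set.finite_singleton (β - γ₀)).subset fun γ hγ => ?_
  rw [Set.mem_ofPred_eq, LinearMap.mulLeft_apply, monomial_mul, coeff_monomial] at hγ
  rw [Set.mem_singleton_iff, ← of_not_not fun hne => hγ (if_neg hne), add_tsub_cancel_left]

theorem derivation (D : Derivation R (MvPolynomial σ R) (MvPolynomial σ R))
    (hD : ∀ δ, {c | coeff δ (D (X c)) ≠ 0}.Finite) :
    RowFinite (D : MvPolynomial σ R →ₗ[R] MvPolynomial σ R) := by
  classical
  refine fun β => ((Set.finite_Iic β).biUnion fun δ _ =>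
    (hD δ).image fun c => β + single c 1 - δ).subset fun γ hγ => ?_
  obtain ⟨c, δ, hc, hδ, he⟩ := exists_of_coeff_derivation_monomial_ne_zero D hγ
  have hle : δ ≤ β := by
    obtain ⟨γ, rfl⟩ := exists_eq_add_single hc
    rw [add_right_comm, add_left_inj] at he
    exact he ▸ le_add_self
  exact Set.mem_biUnion hle ⟨c, hδ, tsub_eq_of_eq_add he⟩

end RowFinite

end RowFinite

namespace RegParams

open MvPolynomial
open Finsupp (single weight)

variable {d : ℕ} {𝔏 : Type*} {P : RegParams d 𝔏}

theorem rowFinite_dN (n : NVec d) : RowFinite (P.dN n : CoordPoly d 𝔏 →ₗ[ℝ] CoordPoly d 𝔏) := by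
  refine RowFinite.derivation _ fun δ => ?_
  let f : Option 𝔏 × (NVec d →₀ ℕ) → CoordIdx d 𝔏 :=
    fun p => single (Sum.inl (p.1, p.2 + single n 1)) 1
  have hf : f.Injective := fun p q h => by
    simpa [f, Finsupp.single_left_inj, Prod.ext_iff] using h
  refine ((((Set.finite_singleton δ).preimage hf.injOn).image Sum.inl).insert
    (Sum.inr n)).subset ?_
  rintro (⟨l, k⟩ | m) hc
  · exact .inr ⟨(l, k), (P.coeff_dN_X_inl hc).2.symm, rfl⟩
  · exact .inl (congrArg _ (P.coeff_dN_X_inr hc).1)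

theorem rowFinite_dX (hscal : ∀ i, 0 < P.scal i) (i : Fin d) :
    RowFinite (P.dX i : CoordPoly d 𝔏 →ₗ[ℝ] CoordPoly d 𝔏) := by
  classical
  intro β
  have hN : {n : NVec d | β (Sum.inr (n + single i 1)) ≠ 0}.Finite :=
    (Finsupp.hasFiniteSupport β).preimage
      (Sum.inr_injective.comp (add_left_injective (single i 1))).injOn
  refine (hN.biUnion fun n _ => (Set.finite_Iic β).biUnion fun ε _ =>
    P.rowFinite_dN n ε).subset fun γ hγ => ?_
  obtain ⟨n, ε, hε, rfl⟩ := exists_coeff_dN_of_coeff_dX hscal hγ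
  exact Set.mem_biUnion (by simp) (Set.mem_biUnion (Set.mem_Iic.mpr le_self_add) hε)

end RegParams

end

noncomputable section

/-! ### The action of the basis on monomials -/

namespace RegParams

open MvPolynomial
open Finsupp (single weight)

variable {d : ℕ} {𝔏 : Type*} (P : RegParams d 𝔏)

/-- The homogeneity of a multi-index, shifted by a multiple of the number of its noises. -/
def coordWt (t : ℝ) (β : CoordIdx d 𝔏) : ℝ := P.hom β + t * noiseHom β

/-- The degree of a generator, shifted by a multiple of the number of its noises. For `t = 0` it is
the degree of the statement, which is positive but need not be bounded away from `0`; for `t > 0`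
it is. -/
def genWt (t : ℝ) : P.PlusGen → ℝ :=
  Sum.elim (fun p => P.coordWt t p.1.1 + P.η - P.scaledDeg p.1.2) P.scal

theorem genWt_inl (t : ℝ) (p : P.MPlus) :
    P.genWt t (Sum.inl p) = P.coordWt t p.1.1 + P.η - P.scaledDeg p.1.2 := rfl

theorem genWt_inr (t : ℝ) (i : Fin d) : P.genWt t (Sum.inr i) = P.scal i := rfl

theorem genWt_zero : P.genWt 0 = P.genDeg := by
  funext g
  rcases g with p | i <;> simp [genWt, genDeg, coordWt]

theorem coordWt_add (t : ℝ) (β γ : CoordIdx d 𝔏) :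
    P.coordWt t (β + γ) = P.coordWt t β + P.coordWt t γ := by
  simp only [coordWt, hom_add, noiseHom_add, Nat.cast_add]
  ring

theorem coordWt_genTarget (t : ℝ) (g : P.PlusGen) :
    P.coordWt t (P.genTarget g) =
      P.genWt t g + P.coordWt t (single (Sum.inr (P.genSource g)) 1) := by
  have h0 : P.scaledDeg 0 = 0 := by simp [scaledDeg]
  rcases g with p | i
  · simp only [genTarget, genSource, genWt, Sum.elim_inl, coordWt, hom_inr, noiseHom_inr,
      Nat.cast_zero]
    ring
  · simp only [genTarget, genSource, genWt, Sum.elim_inr, coordWt, hom_inr, noiseHom_inr,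
      scaledDeg_single, h0]
    ring

theorem lt_genWt_inl (t : ℝ) (ht : 0 ≤ t) (p : P.MPlus) : t < P.genWt t (Sum.inl p) := by
  have hnoise : (1 : ℝ) ≤ noiseHom p.1.1 := by exact_mod_cast p.2.1.2
  have hpos := p.2.2
  rw [genWt_inl, coordWt]
  nlinarith

variable {P} (hscal : ∀ i, 0 < P.scal i)
include hscal

theorem genDeg_pos (g : P.PlusGen) : 0 < P.genDeg g := by
  rw [← genWt_zero]
  rcases g with p | i
  · exact P.lt_genWt_inl 0 le_rfl p
  · exact hscal i

theorem exists_pos_le_genWt_one : ∃ c > 0, ∀ g, c ≤ P.genWt 1 g := by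
  obtain ⟨c, hc, hcs⟩ : ∃ c > 0, ∀ i, c ≤ P.scal i := by
    rcases isEmpty_or_nonempty (Fin d) with _ | _
    · exact ⟨1, one_pos, isEmptyElim⟩
    · obtain ⟨j, hj⟩ := Finite.exists_min P.scal
      exact ⟨P.scal j, hscal j, hj⟩
  refine ⟨min c 1, lt_min hc one_pos, fun g => ?_⟩
  rcases g with p | i
  · exact (min_le_right _ _).trans (P.lt_genWt_inl 1 zero_le_one p).le
  · exact (min_le_left _ _).trans (hcs i)

theorem finite_MPlus_le (β : CoordIdx d 𝔏) : {p : P.MPlus | p.1.1 ≤ β}.Finite := by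
  classical
  refine (((Set.finite_Iic β).biUnion fun γ _ =>
    (finite_sum_mul_natCast_lt hscal (P.η + P.hom γ)).image fun n => (γ, n)).preimage
      Subtype.val_injective.injOn).subset fun p hp => ?_
  exact Set.mem_biUnion hp ⟨p.1.2, p.2.2, rfl⟩

variable (P) in
omit hscal in
/-- The indices `(J, 𝐦)` which the multi-index `β` leaves room for: `𝗓^β` occurs only in the images
of the corresponding `𝖣_{(J, 𝐦)}`. -/
def plusIdxBelow (β : CoordIdx d 𝔏) : Set P.PlusIdx :=
  {K | (∀ p : P.MPlus, K (Sum.inl p) ≠ 0 → p.1.1 ≤ β) ∧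
    (∀ p : P.MPlus, K (Sum.inl p) ≤ noiseHom β) ∧ ∀ i, K (Sum.inr i) ≤ polyDeg β}

theorem finite_plusIdxBelow (β : CoordIdx d 𝔏) : (P.plusIdxBelow β).Finite := by
  classical
  let G : Finset P.PlusGen := (finite_MPlus_le hscal β).toFinset.disjSum Finset.univ
  refine (Set.finite_Iic (Finsupp.indicator G fun _ _ => noiseHom β + polyDeg β)).subset ?_
  rintro K ⟨hle, hnoise, hpoly⟩ (p | i)
  · by_cases h0 : K (Sum.inl p) = 0
    · simp [h0]
    · rw [Finsupp.indicator_of_mem (by simpa [G] using hle p h0)]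
      exact (hnoise p).trans (Nat.le_add_right _ _)
  · rw [Finsupp.indicator_of_mem (by simp [G])]
    exact (hpoly i).trans (Nat.le_add_left _ _)

theorem coeff_rho_dividedD_add_inr {K : P.PlusIdx} {i : Fin d} (hK : ∀ p, K (Sum.inl p) = 0)
    {β : CoordIdx d 𝔏} {q : CoordPoly d 𝔏}
    (h : coeff β (P.rho (P.dividedD (K + single (Sum.inr i) 1)) q) ≠ 0) :
    coeff β (P.dX i (P.rho (P.dividedD K) q)) ≠ 0 := by
  rw [dividedD_add_inr hscal hK, map_smul, LinearMap.smul_apply, coeff_smul, uGen,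
    rho_ι_mul_apply] at h
  exact right_ne_zero_of_smul h

variable (hsol : ∀ i, P.regSol ≤ P.scal i)
include hsol

theorem rho_dividedD_add_inl (K : P.PlusIdx) (p : P.MPlus) (q : CoordPoly d 𝔏) :
    P.rho (P.dividedD (K + single (Sum.inl p) 1)) q =
      ((K (Sum.inl p) + 1 : ℕ) : ℝ)⁻¹ •
        (monomial p.1.1 1 * P.rho (P.dividedD K) (P.dN p.1.2 q)) := by
  rw [dividedD_add_inl hscal hsol, map_smul, LinearMap.smul_apply,
    rho_sandwichLin hscal hsol _ _ (P.monomial_mem_coeffSpan p)]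

theorem exists_coeff_rho_dividedD_add_inl {K : P.PlusIdx} {p : P.MPlus} {β : CoordIdx d 𝔏}
    {q : CoordPoly d 𝔏} (h : coeff β (P.rho (P.dividedD (K + single (Sum.inl p) 1)) q) ≠ 0) :
    ∃ β', β = p.1.1 + β' ∧ coeff β' (P.rho (P.dividedD K) (P.dN p.1.2 q)) ≠ 0 := by
  classical
  rw [rho_dividedD_add_inl hscal hsol, coeff_smul, coeff_monomial_mul', one_mul] at h
  split_ifs at h with hle
  · exact ⟨β - p.1.1, (add_tsub_cancel_of_le hle).symm, right_ne_zero_of_smul h⟩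
  · exact absurd (smul_zero _) h

theorem mem_plusIdxBelow_of_coeff_rho (K : P.PlusIdx) : ∀ (β : CoordIdx d 𝔏) (q : CoordPoly d 𝔏),
    coeff β (P.rho (P.dividedD K) q) ≠ 0 → K ∈ P.plusIdxBelow β := by
  classical
  induction K using finsupp_sum_induction with
  | zero => simp [plusIdxBelow]
  | inr K i hK ih =>
    intro β q h
    obtain ⟨γ, hγ, hβ⟩ := exists_coeff_ne_zero_of_coeff_map_ne_zero
      (P.dX i : CoordPoly d 𝔏 →ₗ[ℝ] CoordPoly d 𝔏) (coeff_rho_dividedD_add_inr hscal hK h)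
    obtain ⟨-, -, hpoly⟩ := ih γ q hγ
    have hdeg := polyDeg_of_coeff_dX hscal hβ
    refine ⟨by simp [hK], by simp [hK], fun j => ?_⟩
    have hj := hpoly j
    rw [Finsupp.add_apply, Finsupp.single_apply]
    split_ifs <;> lia
  | inl K p ih =>
    intro β q h
    obtain ⟨β', rfl, hβ'⟩ := exists_coeff_rho_dividedD_add_inl hscal hsol h
    obtain ⟨hle, hnoise, hpoly⟩ := ih β' _ hβ'
    have hp := p.2.1.2
    refine ⟨fun p' hp' => ?_, fun p' => ?_, fun j => ?_⟩
    · obtain rfl | hne := eq_or_ne p' p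
      · exact le_self_add
      · exact (hle p' (by simpa [hne] using hp')).trans le_add_self
    · have hp' := hnoise p'
      rw [Finsupp.add_apply, Finsupp.single_apply, noiseHom_add]
      split_ifs <;> lia
    · have hj := hpoly j
      rw [polyDeg_add, Finsupp.add_apply, Finsupp.single_eq_of_ne (by simp)]
      lia

theorem rowFinite_rho_dividedD (K : P.PlusIdx) : RowFinite (P.rho (P.dividedD K)) := by
  induction K using finsupp_sum_induction with
  | zero =>
    rw [dividedD_zero, map_one]
    exact .id
  | inr K i hK ih =>
    exact fun β => ((rowFinite_dX hscal i).comp ih β).subset fun γ hγ =>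
      coeff_rho_dividedD_add_inr hscal hK hγ
  | inl K p ih =>
    have h := ((RowFinite.mulLeft_monomial p.1.1).comp (ih.comp (P.rowFinite_dN p.1.2))).smul
      ((K (Sum.inl p) + 1 : ℕ) : ℝ)⁻¹
    convert h using 1
    exact LinearMap.ext fun q => rho_dividedD_add_inl hscal hsol K p q

theorem finite_coeff_rho_dividedD (β : CoordIdx d 𝔏) :
    {q : P.PlusIdx × CoordIdx d 𝔏 |
      coeff β (P.rho (P.dividedD q.1) (monomial q.2 1)) ≠ 0}.Finite := by
  classical
  refine ((finite_plusIdxBelow hscal β).biUnion fun K _ =>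
    (rowFinite_rho_dividedD hscal hsol K β).image fun γ => (K, γ)).subset ?_
  rintro ⟨K, γ⟩ h
  exact Set.mem_biUnion (mem_plusIdxBelow_of_coeff_rho hscal hsol K β _ h) ⟨γ, h, rfl⟩

theorem coordWt_of_coeff_rho_dividedD (t : ℝ) (K : P.PlusIdx) : ∀ β γ : CoordIdx d 𝔏,
    coeff β (P.rho (P.dividedD K) (monomial γ 1)) ≠ 0 →
      P.coordWt t β = P.coordWt t γ + weight (P.genWt t) K := by
  classical
  induction K using finsupp_sum_induction with
  | zero =>
    intro β γ h
    rw [dividedD_zero, map_one, Module.End.one_apply, coeff_monomial] at h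
    rw [← of_not_not fun hne => h (if_neg hne), map_zero, add_zero]
  | inr K i hK ih =>
    intro β γ h
    obtain ⟨γ', hγ', hβ⟩ := exists_coeff_ne_zero_of_coeff_map_ne_zero
      (P.dX i : CoordPoly d 𝔏 →ₗ[ℝ] CoordPoly d 𝔏) (coeff_rho_dividedD_add_inr hscal hK h)
    have hdX : P.coordWt t β = P.coordWt t γ' + P.scal i := by
      rw [coordWt, coordWt, noiseHom_of_coeff_dX hscal hβ, hom_of_coeff_dX hscal hβ]
      ring
    rw [map_add, Finsupp.weight_single, one_smul, genWt_inr, hdX, ih γ' γ hγ', add_assoc]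
  | inl K p ih =>
    intro β γ h
    obtain ⟨β', rfl, hβ'⟩ := exists_coeff_rho_dividedD_add_inl hscal hsol h
    obtain ⟨γ', hγ', hβ'γ'⟩ := exists_coeff_ne_zero_of_coeff_map_ne_zero _ hβ'
    have hdN : P.coordWt t γ' = P.coordWt t γ + (P.η - P.scaledDeg p.1.2) := by
      rw [coordWt, coordWt, P.noiseHom_of_coeff_dN hγ', P.hom_of_coeff_dN hγ']
      ring
    rw [map_add, Finsupp.weight_single, one_smul, genWt_inl, coordWt_add, ih β' γ' hβ'γ', hdN]
    ring

end RegParams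

end

noncomputable section

/-! ### The dual of the enveloping algebra and the model space -/

section BasisPairing

variable {ι R M : Type*} [CommSemiring R] [AddCommMonoid M] [Module R M]

/-- The pairing of `M` with the finitely supported functions under which a basis of `M` is dual to
the canonical one. -/
def basisPairing (B : Module.Basis ι R M) : M →ₗ[R] (ι →₀ R) →ₗ[R] R :=
  B.constr R Finsupp.lapply

theorem isDualFamily_basisPairing (B : Module.Basis ι R M) :
    IsDualFamily (basisPairing B) B Finsupp.basisSingleOne := fun i => by
  rw [basisPairing, Module.Basis.constr_basis]
  rfl

theorem basisPairing_single (B : Module.Basis ι R M) (m : M) (i : ι) :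
    basisPairing B m (.single i 1) = B.repr m i := by
  classical
  have : (basisPairing B).flip (.single i 1) = B.coord i := B.ext fun j => by
    rw [LinearMap.flip_apply, basisPairing, Module.Basis.constr_basis, Module.Basis.coord_apply,
      Module.Basis.repr_self, Finsupp.lapply_apply, Finsupp.single_apply, Finsupp.single_apply]
    simp only [eq_comm]
  exact LinearMap.congr_fun this m

end BasisPairing

section RestrictSupport

open MvPolynomial

variable {σ R : Type*} [CommSemiring R] {s : Set (σ →₀ ℕ)}

theorem basisRestrictSupport_repr_apply (q : restrictSupport R s) (γ : s) :
    (basisRestrictSupport R s).repr q γ = coeff γ.1 (q : MvPolynomial σ R) := rfl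

theorem coe_basisRestrictSupport (γ : s) :
    (basisRestrictSupport R s γ : MvPolynomial σ R) = monomial γ.1 1 := by
  classical
  suffices h : basisRestrictSupport R s γ =
      ⟨monomial γ.1 1, (monomial_mem_restrictSupport R).mpr (.inl γ.2)⟩ by rw [h]
  refine (basisRestrictSupport R s).ext_elem fun γ' => ?_
  rw [Module.Basis.repr_self, basisRestrictSupport_repr_apply, coeff_monomial, Finsupp.single_apply]
  simp only [Subtype.ext_iff]

end RestrictSupport

namespace RegParams

open MvPolynomial
open Finsupp (single weight)

variable {d : ℕ} {𝔏 : Type*} {P : RegParams d 𝔏}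

variable (P) in
/-- The monomials as a basis of the span of the model. -/
def modelBasis : Module.Basis P.ModelIdx ℝ P.modelSpan :=
  basisRestrictSupport ℝ (P.Populated ∪ P.NMinus)

theorem modelBasis_repr_apply (q : P.modelSpan) (γ : P.ModelIdx) :
    P.modelBasis.repr q γ = coeff γ.1 (q : CoordPoly d 𝔏) :=
  basisRestrictSupport_repr_apply q γ

theorem coe_modelBasis (γ : P.ModelIdx) :
    (P.modelBasis γ : CoordPoly d 𝔏) = monomial γ.1 1 :=
  coe_basisRestrictSupport γ

variable (hscal : ∀ i, 0 < P.scal i) (hsol : ∀ i, P.regSol ≤ P.scal i)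
include hscal hsol

theorem repr_dBasis_single (u : P.UPlus) (g : P.PlusGen) :
    (dBasis hscal hsol).repr u (single g 1) = P.genCoeff g u := by
  classical
  have : (dBasis hscal hsol).coord (single g 1) = P.genCoeff g :=
    (dBasis hscal hsol).ext fun K => by
      rw [Module.Basis.coord_apply, Module.Basis.repr_self, Finsupp.single_apply, dBasis_apply,
        genCoeff_dividedD hscal hsol]
  exact LinearMap.congr_fun this u

theorem exists_of_repr_dBasis_mul_single_ne_zero {g : P.PlusGen} {K' K'' : P.PlusIdx}
    (h : (dBasis hscal hsol).repr (dBasis hscal hsol K' * dBasis hscal hsol K'') (single g 1) ≠ 0) :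
    ∃ γ, coeff (P.genTarget g) (P.rho (P.dividedD K') (monomial γ 1)) ≠ 0 ∧
      coeff γ (P.rho (P.dividedD K'') (monomial (single (Sum.inr (P.genSource g)) 1) 1)) ≠ 0 := by
  rw [repr_dBasis_single, genCoeff_apply, map_mul, Module.End.mul_apply, dBasis_apply,
    dBasis_apply] at h
  obtain ⟨γ, h'', h'⟩ := exists_coeff_ne_zero_of_coeff_map_ne_zero _ h
  exact ⟨γ, h', h''⟩

theorem isDividedPowerBasis_dBasis :
    IsDividedPowerBasis (dBasis hscal hsol) envelopingComul envelopingCounit where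
  one := by rw [dBasis_apply, dividedD_zero]
  counit K hK := by
    classical
    rw [dBasis_apply, envelopingCounit_dividedD hscal hsol, if_neg hK]
  comul K := by
    classical
    simp only [dBasis_apply]
    convert envelopingComul_dividedD hscal hsol K

theorem finite_prodCoeff (K : P.PlusIdx) :
    {q : P.PlusIdx × P.PlusIdx | prodCoeff (dBasis hscal hsol) q.1 q.2 K ≠ 0}.Finite := by
  refine (isDividedPowerBasis_dBasis hscal hsol).finite_repr_mul (fun g => ?_) K
  refine ((finite_coeff_rho_dividedD hscal hsol (P.genTarget g)).biUnion fun q' _ =>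
    (finite_coeff_rho_dividedD hscal hsol q'.2).image fun q'' => (q'.1, q''.1)).subset ?_
  rintro ⟨K', K''⟩ h
  obtain ⟨γ, h', h''⟩ := exists_of_repr_dBasis_mul_single_ne_zero hscal hsol h
  exact Set.mem_biUnion (x := (K', γ)) h' ⟨(K'', _), h'', rfl⟩

theorem isHomogeneousMul_dBasis (t : ℝ) : IsHomogeneousMul (dBasis hscal hsol) (P.genWt t) := by
  refine (isDividedPowerBasis_dBasis hscal hsol).isHomogeneousMul fun g K' K'' h => ?_
  obtain ⟨γ, h', h''⟩ := exists_of_repr_dBasis_mul_single_ne_zero hscal hsol h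
  have htarget := P.coordWt_genTarget t g
  rw [coordWt_of_coeff_rho_dividedD hscal hsol t K' _ γ h',
    coordWt_of_coeff_rho_dividedD hscal hsol t K'' γ _ h''] at htarget
  linarith

theorem finite_actCoeff (β : P.ModelIdx) :
    {q : P.PlusIdx × P.ModelIdx |
      actCoeff (dBasis hscal hsol) q.1 β.1 q.2.1 ≠ 0}.Finite := by
  simp only [actCoeff, dBasis_apply]
  exact (finite_coeff_rho_dividedD hscal hsol β.1).preimage
    (Function.injective_id.prodMap Subtype.val_injective).injOn

theorem basisPairing_restrictEnd_lift (K : P.PlusIdx) (γ β : P.ModelIdx) :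
    basisPairing P.modelBasis
        (TensorProduct.lift
          (restrictEnd P.rho P.modelSpan (rho_mem_modelSpan hscal hsol)).toLinearMap
          (dBasis hscal hsol K ⊗ₜ P.modelBasis γ))
        (single β 1) =
      actCoeff (dBasis hscal hsol) K β.1 γ.1 := by
  rw [basisPairing_single, modelBasis_repr_apply, actCoeff, ← coe_modelBasis γ]
  rfl

theorem isTranspose_action_coactPlus :
    IsTranspose
      (tensorPairing (pairing (dBasis hscal hsol)) (basisPairing P.modelBasis))
      (basisPairing P.modelBasis)
      (TensorProduct.lift
        (restrictEnd P.rho P.modelSpan (rho_mem_modelSpan hscal hsol)).toLinearMap)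
      (coactPlus (dBasis hscal hsol)) := by
  have hact (q : P.PlusIdx × P.ModelIdx) (β : P.ModelIdx) :=
    basisPairing_restrictEnd_lift hscal hsol q.1 q.2 β
  refine .of_finsum (isDualFamily_monomialPairing.tensorProduct (isDualFamily_basisPairing _))
    Finsupp.basisSingleOne (fun β => ?_) fun β => ?_
  · simp only [Module.Basis.tensorProduct_apply', Finsupp.coe_basisSingleOne, hact]
    exact finite_actCoeff hscal hsol β
  · rw [coactPlus, Module.Basis.constr_basis]
    simp only [Module.Basis.tensorProduct_apply', Finsupp.coe_basisSingleOne, hact,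
      coe_basisMonomials]
    rfl

end RegParams

end

open RegParams in
theorem mainTheorem4_general {d : ℕ} {𝔏 : Type*} (P : RegParams d 𝔏)
    (hscal : ∀ i, 0 < P.scal i) (hsol : ∀ i, P.regSol ≤ P.scal i) :
    ∃ b : Module.Basis P.PlusIdx ℝ P.UPlus,
      (∀ (K : P.PlusIdx) (l : List P.MPlus), (l : Multiset P.MPlus) = P.jPart K →
        b K = P.sfD K l) ∧
      (∀ K : P.PlusIdx,
        {q : P.PlusIdx × P.PlusIdx | RegParams.prodCoeff b q.1 q.2 K ≠ 0}.Finite) ∧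
      (∀ β : P.ModelIdx,
        {q : P.PlusIdx × P.ModelIdx | RegParams.actCoeff b q.1 β.1 q.2.1 ≠ 0}.Finite) ∧
      (∃ A : P.TPlus →ₗ[ℝ] P.TPlus,
        IsConnectedGradedHopfAlgebra (RegParams.comulPlus b) P.counitPlus A P.gradePlus ∧
        ∀ (U : P.UPlus) (M : P.TPlus),
          RegParams.pairing b U (A M) = RegParams.pairing b (envelopingAntipode U) M) ∧
      IsLeftComodule (RegParams.comulPlus b) P.counitPlus (RegParams.coactPlus b) := by
  have hb := isDividedPowerBasis_dBasis hscal hsol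
  have hfin := finite_prodCoeff hscal hsol
  have hhom : IsHomogeneousMul (dBasis hscal hsol) P.genDeg := by
    simpa only [genWt_zero] using isHomogeneousMul_dBasis hscal hsol 0
  have hwf : WellFounded (ProperLeftFactor (dBasis hscal hsol)) := by
    obtain ⟨c, hc, hcw⟩ := exists_pos_le_genWt_one hscal
    exact (isHomogeneousMul_dBasis hscal hsol 1).wellFounded_properLeftFactor hc hcw
  refine ⟨dBasis hscal hsol, fun K l hl => ?_, hfin, finite_actCoeff hscal hsol, ?_, ?_⟩
  · rw [dBasis_apply, dividedD_eq_sfD hscal hsol hl]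
  · exact hb.exists_isConnectedGradedHopfAlgebra hfin hwf (genDeg_pos hscal) hhom
      mul'_rTensor_envelopingAntipode mul'_lTensor_envelopingAntipode
  · exact (hb.isBialgebraPairing hfin).isLeftComodule isDualFamily_monomialPairing
      (isDualFamily_basisPairing P.modelBasis) (isTranspose_action_coactPlus hscal hsol)

theorem mainTheorem4 {d : ℕ} {𝔏 : Type*} [Finite 𝔏] (P : RegParams d 𝔏)
    (hscal : ∀ i, 1 ≤ P.scal i) (hη : 0 < P.η) (hreg : ∀ l, P.reg l < P.alpha l)
    (hsol : ∀ i, P.regSol ≤ P.scal i) :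
    ∃ b : Module.Basis P.PlusIdx ℝ P.UPlus,
      (∀ (K : P.PlusIdx) (l : List P.MPlus), (l : Multiset P.MPlus) = P.jPart K →
        b K = P.sfD K l) ∧
      (∀ K : P.PlusIdx,
        {q : P.PlusIdx × P.PlusIdx | RegParams.prodCoeff b q.1 q.2 K ≠ 0}.Finite) ∧
      (∀ β : P.ModelIdx,
        {q : P.PlusIdx × P.ModelIdx | RegParams.actCoeff b q.1 β.1 q.2.1 ≠ 0}.Finite) ∧
      (∃ A : P.TPlus →ₗ[ℝ] P.TPlus,
        IsConnectedGradedHopfAlgebra (RegParams.comulPlus b) P.counitPlus A P.gradePlus ∧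
        ∀ (U : P.UPlus) (M : P.TPlus),
          RegParams.pairing b U (A M) = RegParams.pairing b (envelopingAntipode U) M) ∧
      IsLeftComodule (RegParams.comulPlus b) P.counitPlus (RegParams.coactPlus b) :=
  mainTheorem4_general P (fun i => zero_lt_one.trans_le (hscal i)) hsol
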